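/- Let $m=2m^0\ge 2$ be even and $n\ge 4$. **The group.** Let $\widetilde{\mathfrak S}_n$ be the group generated by $z_1,r_1,\dots,r_{n-1}$ with relations: $z_1$ is central, $z_1^2=e$, $r_i^2=e$, $(r_ir_{i+1})^3=e$, $r_ir_j=z_1r_jr_i$ $(|i-j|\ge 2)$; let $\Phi:\widetilde{\mathfrak S}_n\to\mathfrak S_n$, $r_i\mapsto(i\ i{+}1)$, $z_1\mapsto e$. Let $D^\wedge_n$ be the group generated by $z_2,\widehat\eta_1,\dots,\widehat\eta_n$ with relations: $z_2$ is central, $z_2^2=e$, $\widehat\eta_j^{\,m}=e$, $\widehat\eta_j\widehat\eta_k=z_2\widehat\eta_k\widehat\eta_j$ $(j\ne k)$. Put $U'=D^\wedge_n\times Z_3$, $Z_3=\langle z_3\rangle$ of order 2. Let $s\in\widetilde{\mathfrak S}_n$, with $\sigma=\Phi(s)$, act on $U'$ by $s(z_2)=z_2$, $s(z_3)=z_3$, and $s(\widehat\eta_j)=\widehat\eta_{\sigma(j)}$ if $\sigma$ is even, $s(\widehat\eta_j)=z_3\widehat\eta_{\sigma(j)}$ if $\sigma$ is odd. The representation group of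 the generalized symmetric group $G(m,1,n)$ is $R(G(m,1,n))=U'\rtimes\widetilde{\mathfrak S}_n$. A complex representation of it has spin type $\chi^{\rm II}=(-1,-1,1)$ if $z_1,z_2,z_3$ act as the scalars $-1,-1,1$. **Parameters.** Let $\omega=e^{2\pi\sqrt{-1}/m}$, let $\zeta^{(a)}$ be the character $y\mapsto\omega^a$ of $T=\mathbb Z_m=\langle y\rangle$, and $\widehat T^0=\{\zeta^{(a)}: 0\le a<m^0\}$. Let $\boldsymbol Y_n(\widehat T^0)$ be the set of families $\Lambda^n=(\boldsymbol\lambda^\zeta)_{\zeta\in\widehat T^0}$ of Young diagrams of total size $n$, and ${}^t\Lambda^n=({}^t\boldsymbol\lambda^\zeta)_\zeta$ (transposed diagrams). Given $\Lambda^n$, put $n_\zeta=|\boldsymbol\lambda^\zeta|$, split $\{1,\dots,n\}$ into successive intervals $I_\zeta$ of length $n_\zeta$ (in the order of $a$), and let $\gamma_j=a$ for $j\in I_{\zeta^{(a)}}$. Put $\mathfrak S_{\boldsymbol\nu}=\prod_\zeta\mathfrak S_{I_\zeta}\subset\mathfrak S_n$, $\widetilde{\mathfrak S}_{\boldsymbol\nu}=\Phi^{-1}(\mathfrak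 S_{\boldsymbol\nu})$, $\widetilde{\mathfrak A}_n=\Phi^{-1}(\mathfrak A_n)$, and let $\pi_{\Lambda^n}=\boxtimes_\zeta\pi_{\boldsymbol\lambda^\zeta}$ be the irreducible representation of $\mathfrak S_{\boldsymbol\nu}$ attached to $\Lambda^n$, where $\pi_{\boldsymbol\lambda}$ is the irreducible representation of the symmetric group with Young diagram $\boldsymbol\lambda$. Call $\Lambda^n$ quasi-trivial if all $n_\zeta\le 1$. Let $\rho_{\Lambda^n}$ be the restriction of $\pi_{\Lambda^n}$ to $\mathfrak A_n\cap\mathfrak S_{\boldsymbol\nu}$. If ${}^t\Lambda^n=\Lambda^n$ is not quasi-trivial, $\rho_{\Lambda^n}$ is the direct sum of two inequivalent irreducible representations; call them $\rho^{(0)}_{\Lambda^n},\rho^{(1)}_{\Lambda^n}$ (in a fixed order). **Representations.** Let $k=[n/2]$, $\varepsilon$ the $2\times2$ identity matrix, $a=\begin{pmatrix}0&1\\1&0\end{pmatrix}$, $b=\begin{pmatrix}0&-\sqrt{-1}\\ \sqrt{-1}&0\end{pmatrix}$, $c=\begin{pmatrix}1&0\\0&-1\end{pmatrix}$, and $Y_{2i-1}=c^{\otimes(i-1)}\otimes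 a\otimes\varepsilon^{\otimes(k-i)}$, $Y_{2i}=c^{\otimes(i-1)}\otimes b\otimes\varepsilon^{\otimes(k-i)}$ $(1\le i\le k)$, $Y_{2k+1}=c^{\otimes k}$. For integers $\gamma=(\gamma_j)$ let $P_\gamma$ be the representation of $U'$ with $z_2\mapsto-1$, $z_3\mapsto 1$, $\widehat\eta_j\mapsto\omega^{\gamma_j}Y_j$. Put $P^+_\gamma=P_\gamma$ and $P^-_\gamma=P_{\gamma'}$, where $\gamma'$ is $\gamma$ with $\gamma_n$ replaced by $\gamma_n+m^0$. Let $\nabla'_n$, $\nabla''_n$ and, for $n$ even, $\nabla^{\rm II}_n$ be the representations of $\widetilde{\mathfrak S}_n$ with $z_1\mapsto -1$ and $$\nabla'_n(r_i)=\tfrac1{\sqrt2}(Y_i-Y_{i+1}),\quad \nabla''_n(r_i)=-Y_{2k+1}\nabla'_n(r_i)Y_{2k+1},\quad \nabla^{\rm II}_n(r_i)=\sqrt{-1}\,Y_{2k+1}\nabla'_n(r_i);$$ let $\mho^+_n,\mho^-_n$ be the restrictions of $\nabla'_n,\nabla''_n$ to $\widetilde{\mathfrak A}_n$. For a subgroup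 $K\subset\widetilde{\mathfrak S}_n$, a representation $\pi^0$ of $U'\rtimes K$ and a representation $\pi^1$ of $K$, let $\Pi(\pi^0,\pi^1)$ be the representation of $R(G(m,1,n))$ induced from $\pi^0\otimes\pi^1$ on $U'\rtimes K$; write $\rho\cdot J$ for $(u,s)\mapsto\rho(u)J(s)$, and lift representations along $\Phi$ where needed. * For $n$ even, $K=\widetilde{\mathfrak S}_{\boldsymbol\nu}$: $\ \Pi^{\rm II}_{\Lambda^n}=\Pi(P_\gamma\cdot\nabla^{\rm II}_n,\ \pi_{\Lambda^n})$. * For $n$ odd, $K=\widetilde{\mathfrak A}_n\cap\widetilde{\mathfrak S}_{\boldsymbol\nu}$: $\ \Pi^{\mho+}_{\Lambda^n}=\Pi(P^+_\gamma\cdot\mho^+_n,\ \rho_{\Lambda^n})$ if ${}^t\Lambda^n\ne\Lambda^n$; $\ \Pi^{\mho+}_{\Lambda^n,\kappa}=\Pi(P^+_\gamma\cdot\mho^+_n,\ \rho^{(\kappa)}_{\Lambda^n})$ $(\kappa=0,1)$ if ${}^t\Lambda^n=\Lambda^n$ is not quasi-trivial; $\ \Pi^{\mho\epsilon}_{\Lambda^n}=\Pi(P^\epsilon_\gamma\cdot\mho^\epsilon_n,\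 \mathbf 1)$ $(\epsilon=\pm)$ if $\Lambda^n$ is quasi-trivial. **Theorem 7.9.** A complete set of representatives of the equivalence classes of irreducible representations of $R(G(m,1,n))$ of spin type $\chi^{\rm II}=(-1,-1,1)$ (i.e. irreducible representations of that type, pairwise inequivalent, and exhausting all of them up to equivalence) is given as follows. (i) For $n$ even: $\Pi^{\rm II}_{\Lambda^n}$, $\Lambda^n\in\boldsymbol Y_n(\widehat T^0)$. (ii) For $n$ odd and $n>m^0$: the $\Pi^{\mho+}_{\Lambda^n}$, one for each unordered pair $\{\Lambda^n,{}^t\Lambda^n\}$ with $\Lambda^n\in\boldsymbol Y_n(\widehat T^0)$, ${}^t\Lambda^n\ne\Lambda^n$ (with any choice of a member of the pair), together with the $\Pi^{\mho+}_{\Lambda^n,\kappa}$, $\kappa\in\{0,1\}$, $\Lambda^n\in\boldsymbol Y_n(\widehat T^0)$ with ${}^t\Lambda^n=\Lambda^n$ not quasi-trivial. (iii) For $n$ odd and $n\le m^0$: the representations listed in (ii), together with the $\Pi^{\mho\epsilon}_{\Lambda^n}$, $\epsilon\in\{+,-\}$, $\Lambda^n\in\boldsymbol Y_n(\widehat T^0)$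 quasi-trivial. -/

import Mathlib

open scoped TensorProduct

noncomputable section

namespace SpinGSG

/-! ### The double cover of the symmetric group -/

/-- The positions `i` and `i + 1` exchanged by the `i`-th simple transposition (0-based). -/
def lo {n : ℕ} (i : Fin (n - 1)) : Fin n := ⟨i, by omega⟩

/-- The position `i + 1`, see `lo`. -/
def hi {n : ℕ} (i : Fin (n - 1)) : Fin n := ⟨i + 1, by omega⟩

/-- Generators `z₁, r₁, …, r_{n-1}` of the double cover of `𝔖ₙ` (the `rᵢ` are indexed from 0). -/
inductive SGen (n : ℕ)
  | z : SGen n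
  | r (i : Fin (n - 1)) : SGen n

/-- Relations: `z₁` is a central involution, `rᵢ² = e`, `(rᵢ rᵢ₊₁)³ = e`,
`rᵢ rⱼ = z₁ rⱼ rᵢ` for `|i - j| ≥ 2`. -/
def sRels (n : ℕ) : Set (FreeGroup (SGen n)) :=
  let z : FreeGroup (SGen n) := .of .z
  let r : Fin (n - 1) → FreeGroup (SGen n) := fun i => .of (.r i)
  {w | w = z ^ 2 ∨ (∃ i, w = z * r i * (r i * z)⁻¹) ∨ (∃ i, w = r i ^ 2) ∨
    (∃ i j : Fin (n - 1), (i : ℕ) + 1 = j ∧ w = (r i * r j) ^ 3) ∨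
    (∃ i j : Fin (n - 1), ((i : ℕ) + 2 ≤ j ∨ (j : ℕ) + 2 ≤ i) ∧
      w = r i * r j * (z * r j * r i)⁻¹)}

/-- Schur's representation group of the symmetric group `𝔖ₙ`. -/
abbrev STilde (n : ℕ) : Type := PresentedGroup (sRels n)

/-- Homomorphisms out of the double cover of `𝔖ₙ`. -/
def sLift {n : ℕ} {G : Type*} [Group G] (z : G) (r : Fin (n - 1) → G)
    (hz : z ^ 2 = 1) (hzr : ∀ i, z * r i = r i * z) (hr : ∀ i, r i ^ 2 = 1)
    (hb : ∀ i j : Fin (n - 1), (i : ℕ) + 1 = j → (r i * r j) ^ 3 = 1)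
    (hc : ∀ i j : Fin (n - 1), ((i : ℕ) + 2 ≤ j ∨ (j : ℕ) + 2 ≤ i) →
      r i * r j = z * r j * r i) : STilde n →* G :=
  PresentedGroup.toGroup (f := fun x => SGen.casesOn x z r) (by
    rintro w (rfl | ⟨i, rfl⟩ | ⟨i, rfl⟩ | ⟨i, j, hij, rfl⟩ | ⟨i, j, hij, rfl⟩)
    · simpa using hz
    · simpa only [map_mul, map_inv, FreeGroup.lift_apply_of, mul_inv_eq_one] using hzr i
    · simpa using hr i
    · simpa using hb i j hij
    · simpa only [map_mul, map_inv, FreeGroup.lift_apply_of, mul_inv_eq_one] using hc i j hij)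

theorem sLift_z {n : ℕ} {G : Type*} [Group G] (z : G) (r : Fin (n - 1) → G) (hz hzr hr hb hc) :
    sLift z r hz hzr hr hb hc (.of .z) = z := by
  simp [sLift]

theorem sLift_r {n : ℕ} {G : Type*} [Group G] (z : G) (r : Fin (n - 1) → G) (hz hzr hr hb hc)
    (i : Fin (n - 1)) : sLift z r hz hzr hr hb hc (.of (.r i)) = r i := by
  simp [sLift]

theorem swap_braid {α : Type*} [DecidableEq α] (a b c : α) (hab : a ≠ b) (hbc : b ≠ c)
    (hac : a ≠ c) : (Equiv.swap a b * Equiv.swap b c) ^ 3 = 1 := by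
  ext x
  simp only [pow_succ, pow_zero, one_mul, Equiv.Perm.mul_apply, Equiv.Perm.one_apply]
  by_cases h1 : x = a
  · subst h1
    simp [Equiv.swap_apply_of_ne_of_ne, *, Ne.symm]
  · by_cases h2 : x = b
    · subst h2
      simp [Equiv.swap_apply_of_ne_of_ne, *, Ne.symm]
    · by_cases h3 : x = c
      · subst h3
        simp [Equiv.swap_apply_of_ne_of_ne, *, Ne.symm]
      · simp [Equiv.swap_apply_of_ne_of_ne, *]

/-- The covering map onto the symmetric group, `rᵢ ↦ (i i+1)`, `z₁ ↦ e`. -/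
def PhiS (n : ℕ) : STilde n →* Equiv.Perm (Fin n) :=
  sLift 1 (fun i => Equiv.swap (lo i) (hi i)) (by simp) (by simp)
    (by intro i; simp [sq])
    (by
      intro i j hij
      have : hi i = lo j := by simp [lo, hi, hij]
      rw [this]
      apply swap_braid <;> simp [lo, hi, Fin.ext_iff] <;> omega)
    (by
      intro i j hij
      rw [one_mul]
      refine (Equiv.Perm.Disjoint.commute ?_).eq
      intro x
      by_cases h : x = lo i ∨ x = hi i
      · right
        apply Equiv.swap_apply_of_ne_of_ne <;> rintro rfl <;>
          simp [lo, hi, Fin.ext_iff] at h <;> omega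
      · left
        push Not at h
        exact Equiv.swap_apply_of_ne_of_ne h.1 h.2)

theorem PhiS_r {n : ℕ} (i : Fin (n - 1)) : PhiS n (.of (.r i)) = Equiv.swap (lo i) (hi i) :=
  sLift_r ..

theorem PhiS_z {n : ℕ} : PhiS n (.of .z) = 1 := sLift_z ..

theorem STilde.induction {n : ℕ} {P : STilde n → Prop} (h1 : P 1)
    (hmul : ∀ s t, P s → P t → P (s * t)) (hinv : ∀ s, P s → P s⁻¹)
    (hz : P (.of .z)) (hr : ∀ i, P (.of (.r i))) (s : STilde n) : P s := by
  let H : Subgroup (STilde n) :=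
    { carrier := {s | P s}, one_mem' := h1, mul_mem' := fun {a b} ha hb => hmul a b ha hb,
      inv_mem' := fun {a} ha => hinv a ha }
  have := PresentedGroup.generated_by (sRels n) H (by
    rintro (_ | i)
    · exact hz
    · exact hr i) s
  exact this

/-! ### The central extension of `D_n(T)`, `T = ℤ/m`, `m = 2 m₀`, and the representation group -/

/-- Generators `z₂` and `η̂₁, …, η̂ₙ`. -/
inductive DGen (n : ℕ)
  | z : DGen n
  | eta (j : Fin n) : DGen n

/-- Relations: `z₂` is a central involution, `η̂ⱼᵐ = e`, `η̂ⱼ η̂ₖ = z₂ η̂ₖ η̂ⱼ` for `j ≠ k`;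
here `m = 2 * m₀`. -/
def dRels (m₀ n : ℕ) : Set (FreeGroup (DGen n)) :=
  let z : FreeGroup (DGen n) := .of .z
  let η : Fin n → FreeGroup (DGen n) := fun j => .of (.eta j)
  {w | w = z ^ 2 ∨ (∃ j, w = z * η j * (η j * z)⁻¹) ∨ (∃ j, w = η j ^ (2 * m₀)) ∨
    (∃ j k, j ≠ k ∧ w = η j * η k * (z * η k * η j)⁻¹)}

/-- The double cover of `D_n(T) = (ℤ/m)ⁿ`, `m = 2 * m₀`, with central subgroup `⟨z₂⟩`. -/
abbrev DHat (m₀ n : ℕ) : Type := PresentedGroup (dRels m₀ n)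

/-- Homomorphisms out of the double cover of `D_n(T)`. -/
def dLift {m₀ n : ℕ} {G : Type*} [Group G] (z : G) (η : Fin n → G)
    (hz : z ^ 2 = 1) (hzr : ∀ i, z * η i = η i * z) (hη : ∀ i, η i ^ (2 * m₀) = 1)
    (hc : ∀ i j, i ≠ j → η i * η j = z * η j * η i) : DHat m₀ n →* G :=
  PresentedGroup.toGroup (f := fun x => DGen.casesOn x z η) (by
    rintro w (rfl | ⟨i, rfl⟩ | ⟨i, rfl⟩ | ⟨i, j, hij, rfl⟩)
    · simpa using hz
    · simpa only [map_mul, map_inv, FreeGroup.lift_apply_of, mul_inv_eq_one] using hzr i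
    · simpa using hη i
    · simpa only [map_mul, map_inv, FreeGroup.lift_apply_of, mul_inv_eq_one] using hc i j hij)

theorem dLift_z {m₀ n : ℕ} {G : Type*} [Group G] (z : G) (η : Fin n → G) (hz hzr hη hc) :
    dLift (m₀ := m₀) z η hz hzr hη hc (.of .z) = z := by
  simp [dLift]

theorem dLift_eta {m₀ n : ℕ} {G : Type*} [Group G] (z : G) (η : Fin n → G) (hz hzr hη hc)
    (j : Fin n) : dLift (m₀ := m₀) z η hz hzr hη hc (.of (.eta j)) = η j := by
  simp [dLift]

theorem dz_sq {m₀ n : ℕ} : (.of .z : DHat m₀ n) ^ 2 = 1 :=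
  PresentedGroup.one_of_mem (rels := dRels m₀ n) (x := (FreeGroup.of DGen.z) ^ 2) (Or.inl rfl)

theorem dz_comm {m₀ n : ℕ} (j : Fin n) :
    (.of .z : DHat m₀ n) * .of (.eta j) = .of (.eta j) * .of .z :=
  PresentedGroup.mk_eq_mk_of_mul_inv_mem (rels := dRels m₀ n)
    (x := FreeGroup.of .z * FreeGroup.of (.eta j)) (y := FreeGroup.of (.eta j) * FreeGroup.of .z)
    (Or.inr (Or.inl ⟨j, rfl⟩))

theorem eta_pow {m₀ n : ℕ} (j : Fin n) : (.of (.eta j) : DHat m₀ n) ^ (2 * m₀) = 1 :=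
  PresentedGroup.one_of_mem (rels := dRels m₀ n) (x := (FreeGroup.of (DGen.eta j)) ^ (2 * m₀))
    (Or.inr (Or.inr (Or.inl ⟨j, rfl⟩)))

theorem eta_comm {m₀ n : ℕ} (j k : Fin n) (h : j ≠ k) :
    (.of (.eta j) : DHat m₀ n) * .of (.eta k) = .of .z * .of (.eta k) * .of (.eta j) :=
  PresentedGroup.mk_eq_mk_of_mul_inv_mem (rels := dRels m₀ n)
    (x := FreeGroup.of (.eta j) * FreeGroup.of (.eta k))
    (y := FreeGroup.of .z * FreeGroup.of (.eta k) * FreeGroup.of (.eta j))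
    (Or.inr (Or.inr (Or.inr ⟨j, k, h, rfl⟩)))

/-- The endomorphism `η̂ⱼ ↦ η̂_{σ(j)}`, `z₂ ↦ z₂`. -/
def permD (m₀ : ℕ) {n : ℕ} (σ : Equiv.Perm (Fin n)) : DHat m₀ n →* DHat m₀ n :=
  dLift (.of .z) (fun j => .of (.eta (σ j))) dz_sq (fun _ => dz_comm _) (fun _ => eta_pow _)
    (fun _ _ h => eta_comm _ _ (fun h' => h (σ.injective h')))

/-- The homomorphism `η̂ⱼ ↦ sgn σ`, `z₂ ↦ 1`. -/
def signD (m₀ : ℕ) {n : ℕ} (σ : Equiv.Perm (Fin n)) : DHat m₀ n →* ℤˣ :=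
  dLift 1 (fun _ => Equiv.Perm.sign σ) (by simp) (by simp)
    (by intro i; rw [pow_mul, Int.units_sq, one_pow]) (by simp)

/-- The group `U' = D^∧_n × Z₃`; the group `Z₃` of order two is `ℤˣ`, with `z₃ = -1`. -/
abbrev U (m₀ n : ℕ) : Type := DHat m₀ n × ℤˣ

/-- The endomorphism `η̂ⱼ ↦ z₃^{L(σ)} η̂_{σ(j)}`, `z₂ ↦ z₂`, `z₃ ↦ z₃` (where `(-1)^{L(σ)} = sgn σ`). -/
def actU (m₀ : ℕ) {n : ℕ} (σ : Equiv.Perm (Fin n)) : U m₀ n →* U m₀ n :=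
  ((permD m₀ σ).comp (MonoidHom.fst _ _)).prod
    ((signD m₀ σ).comp (MonoidHom.fst _ _) * MonoidHom.snd _ _)

theorem permD_eta {m₀ n : ℕ} (σ : Equiv.Perm (Fin n)) (j : Fin n) :
    permD m₀ σ (.of (.eta j)) = .of (.eta (σ j)) := dLift_eta ..

theorem permD_z {m₀ n : ℕ} (σ : Equiv.Perm (Fin n)) :
    permD m₀ σ (.of .z) = .of .z := dLift_z ..

theorem permD_mul {m₀ n : ℕ} (σ τ : Equiv.Perm (Fin n)) :
    permD m₀ (σ * τ) = (permD m₀ σ).comp (permD m₀ τ) := by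
  apply PresentedGroup.ext
  rintro (_ | j)
  · simp [permD_z]
  · simp [permD_eta]

theorem permD_one {m₀ n : ℕ} : permD m₀ (1 : Equiv.Perm (Fin n)) = MonoidHom.id _ := by
  apply PresentedGroup.ext
  rintro (_ | j)
  · simp [permD_z]
  · simp [permD_eta]

theorem signD_mul {m₀ n : ℕ} (σ τ : Equiv.Perm (Fin n)) :
    signD m₀ (σ * τ) = (signD m₀ σ).comp (permD m₀ τ) * signD m₀ τ := by
  apply PresentedGroup.ext
  rintro (_ | j)
  · simp [signD, dLift_z, permD_z]
  · simp [signD, dLift_eta, permD_eta]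

theorem signD_one {m₀ n : ℕ} : signD m₀ (1 : Equiv.Perm (Fin n)) = 1 := by
  apply PresentedGroup.ext
  rintro (_ | j)
  · simp [signD, dLift_z]
  · simp [signD, dLift_eta]

theorem actU_mul {m₀ n : ℕ} (σ τ : Equiv.Perm (Fin n)) (u : U m₀ n) :
    actU m₀ (σ * τ) u = actU m₀ σ (actU m₀ τ u) := by
  simp [actU, permD_mul, signD_mul, mul_assoc]

theorem actU_one {m₀ n : ℕ} (u : U m₀ n) : actU m₀ (1 : Equiv.Perm (Fin n)) u = u := by
  simp [actU, permD_one, signD_one]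

/-- The action of `𝔖ₙ` on `U'`. -/
def permAct (m₀ n : ℕ) : Equiv.Perm (Fin n) →* MulAut (U m₀ n) where
  toFun σ :=
    { toFun := actU m₀ σ
      invFun := actU m₀ σ⁻¹
      left_inv := fun u => by rw [← actU_mul, inv_mul_cancel, actU_one]
      right_inv := fun u => by rw [← actU_mul, mul_inv_cancel, actU_one]
      map_mul' := map_mul _ }
  map_one' := by ext1 u; exact actU_one u
  map_mul' σ τ := by ext1 u; exact actU_mul σ τ u

/-- The action of the double cover of `𝔖ₙ` on `U'`. -/
def act (m₀ n : ℕ) : STilde n →* MulAut (U m₀ n) := (permAct m₀ n).comp (PhiS n)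

/-- The representation group `R(G(m,1,n)) = U' ⋊ 𝔖̃ₙ` of the generalized symmetric group
`G(m,1,n)`, for even `m = 2 * m₀` and `n ≥ 4`. -/
abbrev RGroup (m₀ n : ℕ) : Type := U m₀ n ⋊[act m₀ n] STilde n

/-- The central element `z₁`. -/
def z₁ (m₀ n : ℕ) : RGroup m₀ n := SemidirectProduct.inr (.of .z)

/-- The central element `z₂`. -/
def z₂ (m₀ n : ℕ) : RGroup m₀ n := SemidirectProduct.inl (.of .z, 1)

/-- The central element `z₃`. -/
def z₃ (m₀ n : ℕ) : RGroup m₀ n := SemidirectProduct.inl (1, -1)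

/-- `ρ` has spin type `(β₁, β₂, β₃)`: the central element `zᵢ` acts as the scalar `βᵢ`. -/
def HasSpinType {m₀ n : ℕ} {V : Type*} [AddCommGroup V] [Module ℂ V]
    (ρ : Representation ℂ (RGroup m₀ n) V) (β₁ β₂ β₃ : ℂ) : Prop :=
  ρ (z₁ m₀ n) = β₁ • LinearMap.id ∧ ρ (z₂ m₀ n) = β₂ • LinearMap.id ∧
    ρ (z₃ m₀ n) = β₃ • LinearMap.id

/-- The family `F` is a complete set of representatives of the irreducible representations of
`R(G(m,1,n))` of spin type `(β₁, β₂, β₃)`: its members are such representations, they are pairwise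
inequivalent, and every such representation is equivalent to one of them. -/
structure IsCompleteSetOfReps.{u} {m₀ n : ℕ} (β₁ β₂ β₃ : ℂ) {ι : Type}
    (F : ι → Rep.{0} ℂ (RGroup m₀ n)) : Prop where
  irreducible : ∀ i, (F i).ρ.IsIrreducible
  spinType : ∀ i, HasSpinType (F i).ρ β₁ β₂ β₃
  inequivalent : ∀ i j, Nonempty ((F i).ρ.Equiv (F j).ρ) → i = j
  complete : ∀ (V : Type u) [AddCommGroup V] [Module ℂ V] (ρ : Representation ℂ (RGroup m₀ n) V),
    ρ.IsIrreducible → HasSpinType ρ β₁ β₂ β₃ → ∃ i, Nonempty (ρ.Equiv (F i).ρ)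

/-! ### The matrices `Y_j` -/

/-- Square matrices of degree `2 ^ k`, with rows and columns indexed by `{0,1}^k`. -/
abbrev Mat (k : ℕ) : Type := Matrix (Fin k → Fin 2) (Fin k → Fin 2) ℂ

/-- The Kronecker product `A₀ ⊗ ⋯ ⊗ A_{k-1}` of `2 × 2` matrices. -/
def kron {k : ℕ} (A : Fin k → Matrix (Fin 2) (Fin 2) ℂ) : Mat k :=
  Matrix.of fun x y => ∏ l, A l (x l) (y l)

theorem kron_mul {k : ℕ} (A B : Fin k → Matrix (Fin 2) (Fin 2) ℂ) :
    kron A * kron B = kron (fun l => A l * B l) := by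
  ext x y
  simp only [kron, Matrix.mul_apply, Matrix.of_apply]
  rw [Finset.prod_univ_sum]
  simp [Finset.prod_mul_distrib]

theorem kron_one {k : ℕ} : kron (fun _ : Fin k => 1) = 1 := by
  ext x y
  simp only [kron, Matrix.of_apply, Matrix.one_apply]
  by_cases h : x = y
  · simp [h]
  · obtain ⟨l, hl⟩ := Function.ne_iff.mp h
    rw [if_neg h]
    exact Finset.prod_eq_zero (Finset.mem_univ l) (by simp [hl])

theorem kron_neg {k : ℕ} (A B : Fin k → Matrix (Fin 2) (Fin 2) ℂ) (l₀ : Fin k)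
    (h₀ : A l₀ = - B l₀) (h : ∀ l, l ≠ l₀ → A l = B l) : kron A = - kron B := by
  ext x y
  simp only [kron, Matrix.of_apply, Matrix.neg_apply]
  rw [← Finset.mul_prod_erase _ _ (Finset.mem_univ l₀),
    ← Finset.mul_prod_erase (a := l₀) _ (fun l => B l (x l) (y l)) (Finset.mem_univ l₀), h₀]
  rw [Finset.prod_congr rfl (fun l hl => by rw [h l (Finset.ne_of_mem_erase hl)])]
  simp

def matA : Matrix (Fin 2) (Fin 2) ℂ := !![0, 1; 1, 0]

def matB : Matrix (Fin 2) (Fin 2) ℂ := !![0, -Complex.I; Complex.I, 0]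

def matC : Matrix (Fin 2) (Fin 2) ℂ := !![1, 0; 0, -1]

/-- The `l`-th tensor factor of `Y_{p+1}`. -/
def yFactor (p l : ℕ) : Matrix (Fin 2) (Fin 2) ℂ :=
  if l < p / 2 then matC else if l = p / 2 then (if p % 2 = 0 then matA else matB) else 1

/-- The matrices `Y_{2i-1} = c^{⊗(i-1)} ⊗ a ⊗ ε^{⊗(k-i)}`, `Y_{2i} = c^{⊗(i-1)} ⊗ b ⊗ ε^{⊗(k-i)}`
(`1 ≤ i ≤ k`) and `Y_{2k+1} = c^{⊗k}`, with 0-based index: `Y k p` is the matrix `Y_{p+1}`. -/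
def Y (k p : ℕ) : Mat k := kron fun l => yFactor p l

theorem matA_sq : matA * matA = 1 := by
  ext i j; fin_cases i <;> fin_cases j <;> simp [matA]

theorem matB_sq : matB * matB = 1 := by
  ext i j; fin_cases i <;> fin_cases j <;> simp [matB]

theorem matC_sq : matC * matC = 1 := by
  ext i j; fin_cases i <;> fin_cases j <;> simp [matC]

theorem matAB : matA * matB = -(matB * matA) := by
  ext i j; fin_cases i <;> fin_cases j <;> simp [matA, matB]

theorem matAC : matA * matC = -(matC * matA) := by
  ext i j; fin_cases i <;> fin_cases j <;> simp [matA, matC]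

theorem matBC : matB * matC = -(matC * matB) := by
  ext i j; fin_cases i <;> fin_cases j <;> simp [matB, matC]

theorem Y_sq (k p : ℕ) : Y k p * Y k p = 1 := by
  rw [Y, kron_mul, ← kron_one]
  congr 1
  ext1 l
  unfold yFactor
  split_ifs <;> simp [matA_sq, matB_sq, matC_sq]

theorem Y_anti_lt (k p q : ℕ) (h : p < q) (hq : q ≤ 2 * k) : Y k p * Y k q = -(Y k q * Y k p) := by
  rw [Y, Y, kron_mul, kron_mul]
  refine kron_neg _ _ ⟨p / 2, by omega⟩ ?_ ?_
  · rcases lt_or_eq_of_le (Nat.div_le_div_right (c := 2) h.le) with h' | h'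
    · simp only [yFactor, h', lt_irrefl, if_false, if_true]
      split_ifs
      · exact matAC
      · exact matBC
    · have h1 : p % 2 = 0 := by omega
      have h2 : q % 2 ≠ 0 := by omega
      simp only [yFactor, ← h', lt_irrefl, if_false, if_true, h1, h2]
      exact matAB
  · intro l hl
    have hl' : (l : ℕ) ≠ p / 2 := fun e => hl (Fin.ext e)
    have h' : p / 2 ≤ q / 2 := Nat.div_le_div_right h.le
    unfold yFactor
    split_ifs <;> first | rfl | omega | simp

theorem Y_anti (k p q : ℕ) (h : p ≠ q) (hp : p ≤ 2 * k) (hq : q ≤ 2 * k) :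
    Y k p * Y k q = -(Y k q * Y k p) := by
  rcases lt_or_gt_of_ne h with h' | h'
  · exact Y_anti_lt k p q h' hq
  · rw [Y_anti_lt k q p h' hp, neg_neg]

/-! ### Spin representations of the double cover of `𝔖ₙ` -/

/-- An invertible matrix from an involutive one. -/
def invol {k : ℕ} (A : Mat k) (h : A * A = 1) : (Mat k)ˣ := ⟨A, A, h, h⟩

/-- A matrix representation of `𝔖̃ₙ` with `z₁ ↦ -1`, `rᵢ ↦ w i`. -/
def spinLift {n k : ℕ} (w : Fin (n - 1) → Mat k) (h1 : ∀ i, w i * w i = 1)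
    (h2 : ∀ i j : Fin (n - 1), (i : ℕ) + 1 = j → (w i * w j) ^ 3 = 1)
    (h3 : ∀ i j : Fin (n - 1), ((i : ℕ) + 2 ≤ j ∨ (j : ℕ) + 2 ≤ i) → w i * w j = -(w j * w i)) :
    STilde n →* (Mat k)ˣ :=
  sLift (-1) (fun i => invol (w i) (h1 i)) (by simp) (by simp)
    (by intro i; ext1; simpa [invol, sq] using h1 i)
    (by intro i j h; ext1; simpa [invol] using h2 i j h)
    (by intro i j h; ext1; simpa [invol] using h3 i j h)

theorem spinLift_r {n k : ℕ} (w : Fin (n - 1) → Mat k) (h1 h2 h3) (i : Fin (n - 1)) :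
    (spinLift w h1 h2 h3 (.of (.r i)) : Mat k) = w i := by
  simp [spinLift, sLift_r, invol]

theorem spinLift_z {n k : ℕ} (w : Fin (n - 1) → Mat k) (h1 h2 h3) :
    (spinLift w h1 h2 h3 (.of .z) : Mat k) = -1 := by
  simp [spinLift, sLift_z]

/-- `(Y_i - Y_{i+1}) / √2` (with the 0-based index). -/
def v (k i : ℕ) : Mat k := ((Real.sqrt 2 : ℝ) : ℂ)⁻¹ • (Y k i - Y k (i + 1))

theorem sqrt_two_inv_mul : ((Real.sqrt 2 : ℝ) : ℂ)⁻¹ * ((Real.sqrt 2 : ℝ) : ℂ)⁻¹ = 1 / 2 := by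
  rw [← mul_inv, ← Complex.ofReal_mul, Real.mul_self_sqrt (by norm_num)]
  norm_num

theorem v_sq (k i : ℕ) (h : i + 1 ≤ 2 * k) : v k i * v k i = 1 := by
  have h1 := Y_anti k i (i + 1) (by omega) (by omega) h
  have h2 : (Y k i - Y k (i + 1)) * (Y k i - Y k (i + 1)) = (2 : ℂ) • 1 := by
    rw [sub_mul, mul_sub, mul_sub, Y_sq, Y_sq, h1, two_smul]
    abel
  rw [v, smul_mul_smul_comm, h2, sqrt_two_inv_mul, smul_smul]
  norm_num

theorem cube_of_braid {R : Type*} [Ring R] (x y : R) (hx : x * x = 1) (hy : y * y = 1)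
    (h : x * y + y * x = -1) : (x * y) ^ 3 = 1 := by
  have e : y * x = -1 - x * y := by rw [← h]; abel
  have e2 : x * y * (x * y) = -(x * y) - 1 := by
    calc x * y * (x * y) = x * (y * x) * y := by noncomm_ring
      _ = -(x * y) - (x * x) * (y * y) := by rw [e]; noncomm_ring
      _ = _ := by rw [hx, hy]; noncomm_ring
  calc (x * y) ^ 3 = (x * y * (x * y)) * (x * y) := by noncomm_ring
    _ = -(x * y * (x * y)) - x * y := by rw [e2]; noncomm_ring; rw [← mul_assoc, e2]; noncomm_ring
    _ = 1 := by rw [e2]; abel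

theorem v_braid (k i : ℕ) (h : i + 2 ≤ 2 * k) : (v k i * v k (i + 1)) ^ 3 = 1 := by
  refine cube_of_braid _ _ (v_sq k i (by omega)) (v_sq k (i + 1) (by omega)) ?_
  have h1 := Y_anti k i (i + 1) (by omega) (by omega) (by omega)
  have h2 := Y_anti k i (i + 2) (by omega) (by omega) (by omega)
  have h3 := Y_anti k (i + 1) (i + 2) (by omega) (by omega) (by omega)
  have h4 : (Y k i - Y k (i + 1)) * (Y k (i + 1) - Y k (i + 2)) +
      (Y k (i + 1) - Y k (i + 2)) * (Y k i - Y k (i + 1)) = (-2 : ℂ) • 1 := by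
    simp only [sub_mul, mul_sub, Y_sq, h1, h2, h3, neg_smul, two_smul]
    abel
  simp only [v]
  rw [smul_mul_smul_comm, smul_mul_smul_comm, ← smul_add, sqrt_two_inv_mul, show i + 1 + 1 = i + 2 from rfl, h4, smul_smul]
  norm_num

theorem v_anti (k i j : ℕ) (hij : i + 2 ≤ j ∨ j + 2 ≤ i) (hi : i + 1 ≤ 2 * k) (hj : j + 1 ≤ 2 * k) :
    v k i * v k j = -(v k j * v k i) := by
  have h1 := Y_anti k i j (by omega) (by omega) (by omega)
  have h2 := Y_anti k i (j + 1) (by omega) (by omega) (by omega)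
  have h3 := Y_anti k (i + 1) j (by omega) (by omega) (by omega)
  have h4 := Y_anti k (i + 1) (j + 1) (by omega) (by omega) (by omega)
  simp only [v]
  rw [smul_mul_smul_comm, smul_mul_smul_comm, ← smul_neg]
  congr 1
  simp only [sub_mul, mul_sub, h1, h2, h3, h4]
  abel

/-- `v_i Y_i = - Y_{i+1} v_i`, `v_i Y_{i+1} = - Y_i v_i`, `v_i Y_p = - Y_p v_i` otherwise. -/
theorem v_Y {n k : ℕ} (hn : n ≤ 2 * k + 1) (i : Fin (n - 1)) (j : Fin n) :
    v k i * Y k j = -(Y k (Equiv.swap (lo i) (hi i) j : Fin n) * v k i) := by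
  have hi' := i.2
  have hj' := j.2
  simp only [v, smul_mul_assoc, mul_smul_comm, ← smul_neg]
  congr 1
  by_cases h1 : j = lo i
  · subst h1
    rw [Equiv.swap_apply_left]
    simp only [lo, hi, sub_mul, mul_sub, Y_sq]
    abel
  · by_cases h2 : j = hi i
    · subst h2
      rw [Equiv.swap_apply_right]
      simp only [lo, hi, sub_mul, mul_sub, Y_sq]
      abel
    · rw [Equiv.swap_apply_of_ne_of_ne h1 h2]
      have h3 : (j : ℕ) ≠ i := fun e => h1 (Fin.ext e)
      have h4 : (j : ℕ) ≠ i + 1 := fun e => h2 (Fin.ext e)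
      have h5 := Y_anti k i j (by omega) (by omega) (by omega)
      have h6 := Y_anti k (i + 1) j (by omega) (by omega) (by omega)
      simp only [sub_mul, mul_sub, h5, h6]
      abel

/-- The spin representation `∇'_n`: `rᵢ ↦ (Y_i - Y_{i+1}) / √2`, `z₁ ↦ -1`, on matrices of degree
`2 ^ [n/2]`. -/
def nabla' (n : ℕ) : STilde n →* (Mat (n / 2))ˣ :=
  spinLift (fun i => v (n / 2) i)
    (fun i => v_sq _ _ (by omega))
    (fun i j h => by rw [← h]; exact v_braid _ _ (by omega))
    (fun i j h => v_anti _ _ _ h (by omega) (by omega))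

/-- The last matrix `Y_{2k+1} = c^{⊗k}`, `k = [n/2]`. -/
abbrev Ylast (n : ℕ) : Mat (n / 2) := Y (n / 2) (2 * (n / 2))

theorem conj_mul {k : ℕ} (Z a b : Mat k) (hZ : Z * Z = 1) :
    -(Z * a * Z) * -(Z * b * Z) = Z * (a * b) * Z := by
  calc _ = Z * a * (Z * Z) * b * Z := by noncomm_ring
    _ = _ := by rw [hZ]; noncomm_ring

theorem conj_cube {k : ℕ} (Z a : Mat k) (hZ : Z * Z = 1) (ha : a ^ 3 = 1) :
    (Z * a * Z) ^ 3 = 1 := by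
  calc (Z * a * Z) ^ 3 = Z * a * (Z * Z) * a * (Z * Z) * a * Z := by noncomm_ring
    _ = Z * a ^ 3 * Z := by rw [hZ]; noncomm_ring
    _ = 1 := by rw [ha, mul_one, hZ]

/-- The spin representation `∇''_n`: `rᵢ ↦ - Y_{2k+1} ∇'_n(rᵢ) Y_{2k+1}`, `z₁ ↦ -1`,
`k = [n/2]`. -/
def nabla'' (n : ℕ) : STilde n →* (Mat (n / 2))ˣ :=
  spinLift (fun i => -(Ylast n * v (n / 2) i * Ylast n))
    (fun i => by rw [conj_mul _ _ _ (Y_sq _ _), v_sq _ _ (by omega), mul_one, Y_sq])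
    (fun i j h => by
      rw [conj_mul _ _ _ (Y_sq _ _)]
      exact conj_cube _ _ (Y_sq _ _) (by rw [← h]; exact v_braid _ _ (by omega)))
    (fun i j h => by
      rw [conj_mul _ _ _ (Y_sq _ _), conj_mul _ _ _ (Y_sq _ _),
        v_anti _ _ _ h (by omega) (by omega)]
      noncomm_ring)

theorem Ylast_v {n : ℕ} (hn : Even n) (i : Fin (n - 1)) :
    v (n / 2) i * Ylast n = -(Ylast n * v (n / 2) i) := by
  have hn' := Nat.div_mul_cancel hn.two_dvd
  have h1 := Y_anti (n / 2) i (2 * (n / 2)) (by omega) (by omega) (by omega)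
  have h2 := Y_anti (n / 2) (i + 1) (2 * (n / 2)) (by omega) (by omega) (by omega)
  simp only [v, smul_mul_assoc, mul_smul_comm, ← smul_neg]
  congr 1
  simp only [sub_mul, mul_sub, h1, h2]
  abel

theorem iY_mul {k : ℕ} (Z a b : Mat k) (hZ : Z * Z = 1) (ha : a * Z = -(Z * a)) :
    (Complex.I • Z) * a * ((Complex.I • Z) * b) = a * b := by
  calc (Complex.I • Z) * a * ((Complex.I • Z) * b)
      = (Complex.I * Complex.I) • (Z * (a * Z) * b) := by
        simp only [smul_mul_assoc, mul_smul_comm, smul_smul, mul_assoc]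
    _ = -(Z * (a * Z) * b) := by simp
    _ = (Z * Z) * (a * b) := by rw [ha]; noncomm_ring
    _ = _ := by rw [hZ, one_mul]

/-- For `n` even, the spin representation `∇^II_n`: `rᵢ ↦ (√-1 Y_{n+1}) ∇'_n(rᵢ)`, `z₁ ↦ -1`. -/
def nablaII {n : ℕ} (hn : Even n) : STilde n →* (Mat (n / 2))ˣ :=
  spinLift (fun i => (Complex.I • Ylast n) * v (n / 2) i)
    (fun i => by rw [iY_mul _ _ _ (Y_sq _ _) (Ylast_v hn i), v_sq _ _ (by omega)])
    (fun i j h => by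
      rw [iY_mul _ _ _ (Y_sq _ _) (Ylast_v hn i), ← h]; exact v_braid _ _ (by omega))
    (fun i j h => by
      rw [iY_mul _ _ _ (Y_sq _ _) (Ylast_v hn i), iY_mul _ _ _ (Y_sq _ _) (Ylast_v hn j),
        v_anti _ _ _ h (by omega) (by omega)])

/-! ### The representations `P_γ` of `U'` -/

/-- The primitive root `ω = exp(2π√-1 / m)`, `m = 2 * m₀`. -/
def omega (m₀ : ℕ) : ℂ := Complex.exp (2 * Real.pi * Complex.I / ((2 * m₀ : ℕ) : ℂ))

theorem omega_pow (m₀ : ℕ) : omega m₀ ^ (2 * m₀) = 1 := by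
  rcases Nat.eq_zero_or_pos m₀ with rfl | h
  · simp
  · exact (Complex.isPrimitiveRoot_exp (2 * m₀) (by omega)).pow_eq_one

theorem omega_ne_zero (m₀ : ℕ) : omega m₀ ≠ 0 := Complex.exp_ne_zero _

theorem omega_half {m₀ : ℕ} (h : 0 < m₀) : omega m₀ ^ m₀ = -1 := by
  rw [omega, ← Complex.exp_nat_mul]
  rw [show (m₀ : ℂ) * (2 * Real.pi * Complex.I / ((2 * m₀ : ℕ) : ℂ)) = Real.pi * Complex.I from ?_]
  · exact Complex.exp_pi_mul_I
  · have : (m₀ : ℂ) ≠ 0 := by exact_mod_cast h.ne'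
    push_cast
    field_simp

/-- `ζ_γ(η̂ⱼ) Y_j` with `ζ_γ(η̂ⱼ) = ω^{γ_j}`. -/
def scaledY (m₀ : ℕ) {n : ℕ} (γ : Fin n → ℕ) (j : Fin n) : Mat (n / 2) :=
  omega m₀ ^ γ j • Y (n / 2) j

theorem scaledY_pow (m₀ : ℕ) {n : ℕ} (γ : Fin n → ℕ) (j : Fin n) :
    scaledY m₀ γ j ^ (2 * m₀) = 1 := by
  rw [scaledY, smul_pow, ← pow_mul, mul_comm, pow_mul, omega_pow, one_pow, one_smul, pow_mul, sq,
    Y_sq, one_pow]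

def scaledYUnit (m₀ : ℕ) {n : ℕ} (γ : Fin n → ℕ) (j : Fin n) : (Mat (n / 2))ˣ where
  val := scaledY m₀ γ j
  inv := (omega m₀ ^ γ j)⁻¹ • Y (n / 2) j
  val_inv := by
    rw [scaledY, smul_mul_smul_comm, Y_sq, mul_inv_cancel₀ (pow_ne_zero _ (omega_ne_zero _)),
      one_smul]
  inv_val := by
    rw [scaledY, smul_mul_smul_comm, Y_sq, inv_mul_cancel₀ (pow_ne_zero _ (omega_ne_zero _)),
      one_smul]

/-- The spin irreducible representation `P_γ` of `D^∧_n`: `z₂ ↦ -1`, `η̂ⱼ ↦ ω^{γ_j} Y_j`. (Extended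
to `U'` with `z₃ ↦ 1`, it takes the same value at `ηⱼ = z₃^{j-1} η̂ⱼ` as at `η̂ⱼ`.) -/
def P (m₀ : ℕ) {n : ℕ} (γ : Fin n → ℕ) : DHat m₀ n →* (Mat (n / 2))ˣ :=
  dLift (-1) (scaledYUnit m₀ γ) (by simp) (by simp)
    (by intro j; ext1; simpa [scaledYUnit] using scaledY_pow m₀ γ j)
    (by
      intro i j h
      ext1
      have := Y_anti (n / 2) i j (by simpa [Fin.ext_iff] using h) (by omega) (by omega)
      simp only [scaledYUnit, scaledY, Units.val_mul, Units.val_neg,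
        smul_mul_smul_comm, neg_mul, one_mul, this, mul_comm (omega m₀ ^ γ i), smul_neg])

theorem P_eta (m₀ : ℕ) {n : ℕ} (γ : Fin n → ℕ) (j : Fin n) :
    (P m₀ γ (.of (.eta j)) : Mat (n / 2)) = scaledY m₀ γ j := by
  simp [P, dLift_eta, scaledYUnit]

theorem P_z (m₀ : ℕ) {n : ℕ} (γ : Fin n → ℕ) : (P m₀ γ (.of .z) : Mat (n / 2)) = -1 := by
  simp [P, dLift_z]

/-- The representation `P_γ · 1_{Z₃}` of `U' = D^∧_n × Z₃`. -/
def PU (m₀ : ℕ) {n : ℕ} (γ : Fin n → ℕ) : U m₀ n →* (Mat (n / 2))ˣ :=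
  (P m₀ γ).comp (MonoidHom.fst _ _)

/-- `τ_n γ`: the last entry `γ_n` is replaced by `γ_n + m₀` modulo `m = 2 * m₀`. -/
def tauLast (m₀ : ℕ) {n : ℕ} (γ : Fin n → ℕ) (j : Fin n) : ℕ :=
  if (j : ℕ) + 1 = n then (γ j + m₀) % (2 * m₀) else γ j

/-- The intertwining relation `P_γ(s(u)) = A P_γ(u) A⁻¹` may be checked on the generators `η̂ⱼ`. -/
theorem intertwine {m₀ n : ℕ} (γ : Fin n → ℕ) (s : STilde n) (A : (Mat (n / 2))ˣ)
    (h : ∀ j, (A : Mat (n / 2)) * scaledY m₀ γ j = scaledY m₀ γ (PhiS n s j) * A) :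
    (PU m₀ γ).comp (act m₀ n s).toMonoidHom = (MulAut.conj A).toMonoidHom.comp (PU m₀ γ) := by
  have key : (P m₀ γ).comp (permD m₀ (PhiS n s)) = (MulAut.conj A).toMonoidHom.comp (P m₀ γ) := by
    apply PresentedGroup.ext
    rintro (_ | j)
    · have : P m₀ γ (.of .z) = -1 := by ext1; simpa using P_z m₀ γ
      simp [permD_z, this]
    · simp only [MonoidHom.comp_apply, permD_eta, MulEquiv.coe_toMonoidHom, MulAut.conj_apply]
      rw [eq_mul_inv_iff_mul_eq]
      ext1
      simpa [P_eta] using (h j).symm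
  ext1 u
  exact DFunLike.congr_fun key u.1

/-! ### Partition-valued data -/

/-- `𝐘_n(T̂⁰)`: families `Λ = (λ^ζ)` of Young diagrams of total size `n`, indexed by
`ζ ∈ T̂⁰ = {ζ^(a) ; 0 ≤ a < m₀}`, the index `a : Fin m₀` standing for the character
`ζ^(a)(y) = ω^a`. -/
abbrev MultiDiagram (m₀ n : ℕ) : Type :=
  {Λ : Fin m₀ → YoungDiagram // ∑ a, (Λ a).card = n}

/-- The number of cells does not change under transposition. -/
theorem card_transpose (μ : YoungDiagram) : μ.transpose.card = μ.card := by
  refine Finset.card_bij (fun c _ => c.swap) ?_ ?_ ?_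
  · intro c hc; exact YoungDiagram.mem_transpose.mp hc
  · intro c _ d _ h; exact Prod.swap_injective h
  · intro c hc
    exact ⟨c.swap, YoungDiagram.mem_transpose.mpr (by simpa using hc), by simp⟩

namespace MultiDiagram

variable {m₀ n : ℕ}

/-- `ᵗΛ = (ᵗλ^ζ)`. -/
def transpose (Λ : MultiDiagram m₀ n) : MultiDiagram m₀ n :=
  ⟨fun a => (Λ.1 a).transpose, by simp only [card_transpose]; exact Λ.2⟩

/-- `Λ` is quasi-trivial if every `λ^ζ` has at most one cell. -/
def QuasiTrivial (Λ : MultiDiagram m₀ n) : Prop := ∀ a, (Λ.1 a).card ≤ 1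

/-- The identification of `{1,…,n}` with the disjoint union of successive intervals of lengths
`n_ζ = |λ^ζ|`. -/
def blockEquiv (Λ : MultiDiagram m₀ n) : Fin n ≃ (a : Fin m₀) × Fin (Λ.1 a).card :=
  (finCongr Λ.2.symm).trans finSigmaFinEquiv.symm

/-- The index `a` of the interval `I_{n,ζ}`, `ζ = ζ^(a)`, of the standard partition that
contains `j`. -/
def block (Λ : MultiDiagram m₀ n) (j : Fin n) : Fin m₀ := (Λ.blockEquiv j).1

/-- The parameter `γ ∈ Γ⁰_n ∩ Γ¹_n` determined by `Λ`. -/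
def gamma (Λ : MultiDiagram m₀ n) (j : Fin n) : ℕ := Λ.block j

/-- The Frobenius-Young subgroup `𝔖_ν = ∏_ζ 𝔖_{I_{n,ζ}}` of `𝔖ₙ`. -/
def youngSubgroup (Λ : MultiDiagram m₀ n) : Subgroup (Equiv.Perm (Fin n)) where
  carrier := {σ | ∀ j, Λ.block (σ j) = Λ.block j}
  one_mem' := fun _ => rfl
  mul_mem' := fun {σ τ} hσ hτ j => (hσ (τ j)).trans (hτ j)
  inv_mem' := fun {σ} hσ j => by simpa using (hσ (σ⁻¹ j)).symm

/-- The projection `𝔖_ν → 𝔖_{I_{n,ζ}}`. -/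
def blockPerm (Λ : MultiDiagram m₀ n) (a : Fin m₀) :
    Λ.youngSubgroup →* Equiv.Perm {j : Fin n // Λ.block j = a} where
  toFun σ := σ.1.subtypePerm (fun j => by rw [σ.2 j])
  map_one' := rfl
  map_mul' _ _ := rfl

/-- A numbering of the cells of `λ^ζ` by the interval `I_{n,ζ}`. -/
def tableau (Λ : MultiDiagram m₀ n) (a : Fin m₀) :
    {j : Fin n // Λ.block j = a} ≃ (Λ.1 a).cells :=
  ((Λ.blockEquiv.subtypeEquiv fun _ => Iff.rfl).trans (Equiv.sigmaSubtype a)).trans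
    (Λ.1 a).cells.equivFin.symm

end MultiDiagram

/-! ### Irreducible representations of symmetric groups -/

/-- Permutations of the cells of `μ` preserving each row. -/
def rowGroup (μ : YoungDiagram) : Subgroup (Equiv.Perm μ.cells) where
  carrier := {p | ∀ x, (p x).1.1 = x.1.1}
  one_mem' := fun _ => rfl
  mul_mem' := fun {p q} hp hq x => (hp (q x)).trans (hq x)
  inv_mem' := fun {p} hp x => by simpa using (hp (p⁻¹ x)).symm

/-- Permutations of the cells of `μ` preserving each column. -/
def colGroup (μ : YoungDiagram) : Subgroup (Equiv.Perm μ.cells) where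
  carrier := {p | ∀ x, (p x).1.2 = x.1.2}
  one_mem' := fun _ => rfl
  mul_mem' := fun {p q} hp hq x => (hp (q x)).trans (hq x)
  inv_mem' := fun {p} hp x => by simpa using (hp (p⁻¹ x)).symm

open Classical in
/-- The Young symmetrizer `(∑_{p ∈ row group} p) (∑_{q ∈ column group} sgn(q) q)`. -/
def youngSymmetrizer (μ : YoungDiagram) : MonoidAlgebra ℂ (Equiv.Perm μ.cells) :=
  (∑ p : rowGroup μ, MonoidAlgebra.single (p : Equiv.Perm μ.cells) (1 : ℂ)) *
    ∑ q : colGroup μ, MonoidAlgebra.single (q : Equiv.Perm μ.cells)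
      (((Equiv.Perm.sign (q : Equiv.Perm μ.cells) : ℤˣ) : ℤ) : ℂ)

/-- The left ideal of the group algebra generated by the Young symmetrizer. -/
abbrev SpechtModule (μ : YoungDiagram) : Type :=
  (Ideal.span {youngSymmetrizer μ} : Ideal (MonoidAlgebra ℂ (Equiv.Perm μ.cells)))

/-- The irreducible representation `π_μ` of the symmetric group on the cells of `μ`: the action by
left multiplication on the left ideal generated by the Young symmetrizer. -/
def specht (μ : YoungDiagram) : Representation ℂ (Equiv.Perm μ.cells) (SpechtModule μ) where
  toFun g :=
    { toFun := fun x => ⟨MonoidAlgebra.single g 1 * x.1, Ideal.mul_mem_left _ _ x.2⟩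
      map_add' := fun x y => Subtype.ext (mul_add _ _ _)
      map_smul' := fun c x => Subtype.ext (mul_smul_comm _ _ _) }
  map_one' := by
    ext x : 2
    simp [← MonoidAlgebra.one_def]
  map_mul' g h := by
    ext x : 2
    simp [← mul_assoc, MonoidAlgebra.single_mul_single]

/-! ### Representations of the inducing subgroups -/

/-- The subgroup `H'_n = U' ⋊ K` of `R(G(m,1,n))` for a subgroup `K` of `𝔖̃ₙ`. -/
abbrev HGroup (m₀ : ℕ) {n : ℕ} (K : Subgroup (STilde n)) : Type :=
  U m₀ n ⋊[(act m₀ n).comp K.subtype] K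

/-- The inclusion `U' ⋊ K → U' ⋊ 𝔖̃ₙ`. -/
def inclH (m₀ : ℕ) {n : ℕ} (K : Subgroup (STilde n)) : HGroup m₀ K →* RGroup m₀ n :=
  SemidirectProduct.map (MonoidHom.id _) K.subtype (fun _ => rfl)

/-- The representation `π⁰ = ρ · J` of `U' ⋊ K`, `(u, s) ↦ ρ(u) J(s)`, with `ρ = P_γ · 1_{Z₃}`, for a
matrix representation `J` of `𝔖̃ₙ` such that `ρ(s(u)) = J(s) ρ(u) J(s)⁻¹` for `s ∈ K`. -/
def piZero {m₀ n : ℕ} (γ : Fin n → ℕ) (K : Subgroup (STilde n)) (J : STilde n →* (Mat (n / 2))ˣ)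
    (h : ∀ s ∈ K, (PU m₀ γ).comp (act m₀ n s).toMonoidHom =
      (MulAut.conj (J s)).toMonoidHom.comp (PU m₀ γ)) :
    Representation ℂ (HGroup m₀ K) ((Fin (n / 2) → Fin 2) → ℂ) :=
  ((Matrix.toLinAlgEquiv' (R := ℂ) (n := Fin (n / 2) → Fin 2)).toMulEquiv.toMonoidHom.comp
    (Units.coeHom _)).comp
    (SemidirectProduct.lift (PU m₀ γ) (J.comp K.subtype) fun s => h s s.2)

/-- `Π(π⁰, π¹) = Ind (π⁰ ⊠ π¹)`, induced from `U' ⋊ K` to `R(G(m,1,n))`, where `π⁰ ⊠ π¹` is the tensor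
product of `π⁰` with the representation `π¹` of `K` pulled back to `U' ⋊ K`. -/
def induced {m₀ n : ℕ} {K : Subgroup (STilde n)} {V W : Type} [AddCommGroup V] [Module ℂ V]
    [AddCommGroup W] [Module ℂ W] (π₀ : Representation ℂ (HGroup m₀ K) V)
    (π₁ : Representation ℂ K W) : Rep.{0} ℂ (RGroup m₀ n) :=
  Rep.of (Representation.ind (inclH m₀ K)
    (π₀.tprod (π₁.comp (SemidirectProduct.rightHom : HGroup m₀ K →* K))))

namespace MultiDiagram

variable {m₀ n : ℕ}

/-- The space of `π_Λ`. -/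
def OuterModule (Λ : MultiDiagram m₀ n) : Type := ⨂[ℂ] a : Fin m₀, SpechtModule (Λ.1 a)

instance (Λ : MultiDiagram m₀ n) : AddCommGroup Λ.OuterModule :=
  inferInstanceAs (AddCommGroup (⨂[ℂ] a : Fin m₀, SpechtModule (Λ.1 a)))

instance (Λ : MultiDiagram m₀ n) : Module ℂ Λ.OuterModule :=
  inferInstanceAs (Module ℂ (⨂[ℂ] a : Fin m₀, SpechtModule (Λ.1 a)))

/-- The outer tensor product `π_Λ = ⊠_ζ π_{λ^ζ}`, a representation of `𝔖_ν`. -/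
def outer (Λ : MultiDiagram m₀ n) : Representation ℂ Λ.youngSubgroup Λ.OuterModule :=
  PiTensorProduct.mapMonoidHom.comp
    (MonoidHom.pi fun a => (specht (Λ.1 a)).comp
      ((Λ.tableau a).permCongrHom.toMonoidHom.comp (Λ.blockPerm a)))

/-- The group `𝔄ₙ ∩ 𝔖_ν`. -/
def altYoung (Λ : MultiDiagram m₀ n) : Subgroup (Equiv.Perm (Fin n)) :=
  alternatingGroup (Fin n) ⊓ Λ.youngSubgroup

/-- The restriction of `π_Λ` to `𝔄ₙ ∩ 𝔖_ν`. -/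
def outerAlt (Λ : MultiDiagram m₀ n) : Representation ℂ Λ.altYoung Λ.OuterModule :=
  Λ.outer.comp (Subgroup.inclusion inf_le_right)

end MultiDiagram

/-- The subrepresentations `W 0`, `W 1` decompose `σ` into two inequivalent irreducibles. -/
def IsSplitting {G V : Type*} [Group G] [AddCommGroup V] [Module ℂ V] (σ : Representation ℂ G V)
    (W : Fin 2 → Subrepresentation σ) : Prop :=
  (∀ κ, (W κ).toRepresentation.IsIrreducible) ∧ IsCompl (W 0) (W 1) ∧
    IsEmpty ((W 0).toRepresentation.Equiv (W 1).toRepresentation)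

namespace MultiDiagram

variable {m₀ n : ℕ}

/-- A fixed choice `ρ^(0)_Λ, ρ^(1)_Λ` of the two irreducible constituents of the restriction of
`π_Λ` to `𝔄ₙ ∩ 𝔖_ν`, in some order (for `Λ` symmetric and not quasi-trivial). -/
def constituent (Λ : MultiDiagram m₀ n) : Fin 2 → Subrepresentation Λ.outerAlt :=
  letI : Nonempty (Fin 2 → Subrepresentation Λ.outerAlt) := ⟨fun _ => ⊤⟩
  Classical.epsilon (IsSplitting Λ.outerAlt)

/-- The Schur-Young subgroup `𝔖̃_ν`, the preimage of `𝔖_ν` in `𝔖̃ₙ`. -/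
abbrev stabEven (Λ : MultiDiagram m₀ n) : Subgroup (STilde n) := Λ.youngSubgroup.comap (PhiS n)

/-- `𝔄̃ₙ ∩ 𝔖̃_ν`, the preimage of `𝔄ₙ ∩ 𝔖_ν` in `𝔖̃ₙ`. -/
abbrev stabOdd (Λ : MultiDiagram m₀ n) : Subgroup (STilde n) := Λ.altYoung.comap (PhiS n)

theorem gamma_of_mem {Λ : MultiDiagram m₀ n} {σ : Equiv.Perm (Fin n)} (h : σ ∈ Λ.youngSubgroup)
    (j : Fin n) : Λ.gamma (σ j) = Λ.gamma j := congrArg Fin.val (h j)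

end MultiDiagram

/-! ### `n` even -/

theorem intertwine_Y {n k : ℕ} (J : STilde n →* (Mat k)ˣ) (X : Fin n → Mat k)
    (χ : Equiv.Perm (Fin n) →* ℤˣ) (hz : (J (.of .z) : Mat k) = -1)
    (hr : ∀ i j, (J (.of (.r i)) : Mat k) * X j = (((χ (Equiv.swap (lo i) (hi i)) : ℤˣ) : ℤ) : ℂ) •
      (X (Equiv.swap (lo i) (hi i) j) * J (.of (.r i)))) (s : STilde n) :
    ∀ j : Fin n, (J s : Mat k) * X j =
      (((χ (PhiS n s) : ℤˣ) : ℤ) : ℂ) • (X (PhiS n s j) * J s) := by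
  induction s using STilde.induction with
  | h1 => simp
  | hmul s t hs ht =>
    intro j
    rw [map_mul, map_mul, Units.val_mul, mul_assoc, ht, mul_smul_comm, ← mul_assoc, hs,
      smul_mul_assoc, smul_smul, map_mul, mul_assoc]
    push_cast
    rw [mul_comm (((χ (PhiS n t) : ℤˣ) : ℤ) : ℂ)]; rfl
  | hinv s hs =>
    intro j
    have hs' := hs (((PhiS n) s)⁻¹ j)
    rw [show PhiS n s ((PhiS n s)⁻¹ j) = j from (PhiS n s).apply_symm_apply j] at hs'
    have hsq : ((((χ (PhiS n s) : ℤˣ) : ℤ) : ℂ)) * (((χ (PhiS n s) : ℤˣ) : ℤ) : ℂ) = 1 := by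
      rw [← Int.cast_mul, ← Units.val_mul, Int.units_mul_self]; simp
    rw [map_inv, map_inv, Units.inv_mul_eq_iff_eq_mul, mul_smul_comm, ← mul_assoc, hs',
      smul_mul_assoc, smul_smul, map_inv, Int.units_inv_eq_self, hsq, one_smul, mul_assoc,
      Units.mul_inv, mul_one]
  | hz =>
    intro j
    rw [PhiS_z, hz]
    simp
  | hr i =>
    intro j
    rw [PhiS_r]
    exact hr i j

theorem nablaII_Y {n : ℕ} (hn : Even n) (s : STilde n) (j : Fin n) :
    (nablaII hn s : Mat (n / 2)) * Y (n / 2) j = Y (n / 2) (PhiS n s j) * nablaII hn s := by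
  have := intertwine_Y (nablaII hn) (fun j => Y (n / 2) j) 1 (spinLift_z ..) (by
    intro i j
    have h1 := v_Y (k := n / 2) (by omega) i j
    have h2 := Y_anti (n / 2) (Equiv.swap (lo i) (hi i) j : Fin n) (2 * (n / 2))
      (by have := Nat.div_mul_cancel hn.two_dvd; omega) (by omega) le_rfl
    rw [nablaII, spinLift_r, mul_assoc, h1]
    simp only [Ylast, smul_mul_assoc, mul_smul_comm, ← mul_assoc, h2, mul_neg, neg_mul, smul_neg]
    simp) s j
  simpa using this

/-- For even `n`: `Π^II_Λ = Π(π⁰, π¹)` with `π⁰ = (P_γ · 1_{Z₃}) · ∇^II_n`, `π¹ = π_Λ`. -/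
def PiII {m₀ n : ℕ} (hn : Even n) (Λ : MultiDiagram m₀ n) : Rep.{0} ℂ (RGroup m₀ n) :=
  induced (K := Λ.stabEven) (W := Λ.OuterModule)
    (piZero Λ.gamma Λ.stabEven (nablaII hn) fun s hs => intertwine _ _ _ fun j => by
      simp only [scaledY, smul_mul_assoc, mul_smul_comm, nablaII_Y hn s,
        MultiDiagram.gamma_of_mem hs])
    (Λ.outer.comp ((PhiS n).subgroupComap Λ.youngSubgroup))

/-! ### `n` odd -/

theorem nabla'_Y {n : ℕ} (s : STilde n) (j : Fin n) : (nabla' n s : Mat (n / 2)) * Y (n / 2) j =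
    (((Equiv.Perm.sign (PhiS n s) : ℤˣ) : ℤ) : ℂ) • (Y (n / 2) (PhiS n s j) * nabla' n s) :=
  intertwine_Y (nabla' n) (fun j => Y (n / 2) j) Equiv.Perm.sign (spinLift_z ..) (by
    intro i j
    have h1 := v_Y (k := n / 2) (by omega) i j
    have h2 : lo i ≠ hi i := by simp [lo, hi, Fin.ext_iff]
    rw [nabla', spinLift_r, h1, Equiv.Perm.sign_swap h2]
    simp) s j

/-- The matrices `Y_j` with `Y_{2k+1}` replaced by `-Y_{2k+1}`. -/
def YMinus (k p : ℕ) : Mat k := -(Y k (2 * k) * Y k p * Y k (2 * k))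

theorem nabla''_Y {n : ℕ} (s : STilde n) (j : Fin n) :
    (nabla'' n s : Mat (n / 2)) * YMinus (n / 2) j =
    (((Equiv.Perm.sign (PhiS n s) : ℤˣ) : ℤ) : ℂ) •
      (YMinus (n / 2) (PhiS n s j) * nabla'' n s) :=
  intertwine_Y (nabla'' n) (fun j => YMinus (n / 2) j) Equiv.Perm.sign (spinLift_z ..) (by
    intro i j
    have h1 := v_Y (k := n / 2) (by omega) i j
    have h2 : lo i ≠ hi i := by simp [lo, hi, Fin.ext_iff]
    rw [nabla'', spinLift_r, Equiv.Perm.sign_swap h2, YMinus, conj_mul _ _ _ (Y_sq _ _), YMinus,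
      conj_mul _ _ _ (Y_sq _ _), h1]
    simp) s j

theorem scaledY_tauLast {m₀ n : ℕ} (hn : Odd n) (Λ : MultiDiagram m₀ n) (j : Fin n) :
    scaledY m₀ (tauLast m₀ Λ.gamma) j = omega m₀ ^ Λ.gamma j • YMinus (n / 2) j := by
  obtain ⟨k, rfl⟩ := hn
  have e : (2 * k + 1) / 2 = k := by omega
  have hlt : Λ.gamma j < m₀ := (Λ.block j).2
  unfold scaledY tauLast YMinus
  generalize (2 * k + 1) / 2 = k' at *
  subst e
  by_cases h : (j : ℕ) + 1 = 2 * k' + 1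
  · rw [if_pos h, Nat.mod_eq_of_lt (by omega), pow_add, omega_half (by omega),
      show (j : ℕ) = 2 * k' by omega, mul_assoc, Y_sq]
    simp
  · rw [if_neg h, Y_anti k' (2 * k') j (by omega) le_rfl (by omega), neg_mul, neg_neg, mul_assoc,
      Y_sq, mul_one]

/-- `∇'_n` for `ε = +` (`true`) and `∇''_n` for `ε = -` (`false`); the representation `℧^ε_n` of
`𝔄̃ₙ` is its restriction. -/
def nablaSign (n : ℕ) : Bool → STilde n →* (Mat (n / 2))ˣ
  | true => nabla' n
  | false => nabla'' n

/-- The parameter `γ` of `P^+_γ = P_γ` for `ε = +`, and `τ_n γ` of `P^-_γ = P_{τ_n γ}` for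
`ε = -`. -/
def gammaSign (m₀ : ℕ) {n : ℕ} (γ : Fin n → ℕ) : Bool → Fin n → ℕ
  | true => γ
  | false => tauLast m₀ γ

theorem intertwine_odd {m₀ n : ℕ} (hn : Odd n) (Λ : MultiDiagram m₀ n) (ε : Bool) (s : STilde n)
    (hs : s ∈ Λ.stabOdd) :
    (PU m₀ (gammaSign m₀ Λ.gamma ε)).comp (act m₀ n s).toMonoidHom =
      (MulAut.conj (nablaSign n ε s)).toMonoidHom.comp (PU m₀ (gammaSign m₀ Λ.gamma ε)) := by
  have hsgn : Equiv.Perm.sign (PhiS n s) = 1 := hs.1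
  have hg := MultiDiagram.gamma_of_mem (Λ := Λ) hs.2
  apply intertwine
  intro j
  cases ε
  · simp only [gammaSign, nablaSign, scaledY_tauLast hn, smul_mul_assoc, mul_smul_comm, nabla''_Y,
      hsgn, hg]
    simp
  · simp only [gammaSign, nablaSign, scaledY, smul_mul_assoc, mul_smul_comm, nabla'_Y, hsgn, hg]
    simp

/-- For odd `n`: `π⁰ = (P^ε_γ · 1_{Z₃}) · ℧^ε_n` on `U' ⋊ (𝔄̃ₙ ∩ 𝔖̃_ν)`. -/
def piZeroOdd {m₀ n : ℕ} (hn : Odd n) (Λ : MultiDiagram m₀ n) (ε : Bool) :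
    Representation ℂ (HGroup m₀ Λ.stabOdd) ((Fin (n / 2) → Fin 2) → ℂ) :=
  piZero (gammaSign m₀ Λ.gamma ε) Λ.stabOdd (nablaSign n ε) (intertwine_odd hn Λ ε)

/-- `Π^{℧+}_Λ = Π(π⁰, ρ_Λ)`, where `ρ_Λ` is the restriction of `π_Λ` to `𝔄ₙ ∩ 𝔖_ν`. -/
def PiAsym {m₀ n : ℕ} (hn : Odd n) (Λ : MultiDiagram m₀ n) : Rep.{0} ℂ (RGroup m₀ n) :=
  induced (K := Λ.stabOdd) (W := Λ.OuterModule) (piZeroOdd hn Λ true)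
    (Λ.outerAlt.comp ((PhiS n).subgroupComap Λ.altYoung))

/-- `Π^{℧+}_{Λ,κ} = Π(π⁰, ρ^(κ)_Λ)`. -/
def PiSym {m₀ n : ℕ} (hn : Odd n) (Λ : MultiDiagram m₀ n) (κ : Fin 2) : Rep.{0} ℂ (RGroup m₀ n) :=
  induced (K := Λ.stabOdd) (W := (Λ.constituent κ).toSubmodule) (piZeroOdd hn Λ true)
    ((Λ.constituent κ).toRepresentation.comp ((PhiS n).subgroupComap Λ.altYoung))

/-- `Π^{℧ε}_Λ = Π(π⁰, 1)` for `Λ` quasi-trivial (then `𝔄̃ₙ ∩ 𝔖̃_ν = Z₁`). -/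
def PiTri {m₀ n : ℕ} (hn : Odd n) (ε : Bool) (Λ : MultiDiagram m₀ n) : Rep.{0} ℂ (RGroup m₀ n) :=
  induced (K := Λ.stabOdd) (W := ℂ) (piZeroOdd hn Λ ε) (Representation.trivial ℂ Λ.stabOdd ℂ)

/-- `𝐘^𝔄_n(T̂⁰)^asym`: the unordered pairs `{Λ, ᵗΛ}` with `ᵗΛ ≠ Λ`. -/
def AsymPair (m₀ n : ℕ) : Type :=
  {p : Set (MultiDiagram m₀ n) // ∃ Λ, Λ.transpose ≠ Λ ∧ p = {Λ, Λ.transpose}}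

/-- The `Λ` occurring in `𝐘^𝔄_n(T̂⁰)^sym`: `ᵗΛ = Λ` and some `λ^ζ` has at least two cells. -/
def SymDiagram (m₀ n : ℕ) : Type :=
  {Λ : MultiDiagram m₀ n // Λ.transpose = Λ ∧ ∃ a, 2 ≤ (Λ.1 a).card}

/-- `𝐘_n(T̂⁰)^tri`: the quasi-trivial `Λ`. -/
def TriDiagram (m₀ n : ℕ) : Type := {Λ : MultiDiagram m₀ n // Λ.QuasiTrivial}

end SpinGSG

end

open SpinGSG

universe u

/-!
The theorem is Clifford theory for the normal subgroup `U'` of `R(G(m,1,n)) = U' ⋊ 𝔖̃ₙ`, combined with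
the representation theory of Young subgroups.

*Representations of `U'`.* The matrices `Y_1, …, Y_{2k}` generate the full matrix algebra
(`adjoin_Y`), and any `2k` anticommuting involutions in an algebra define a homomorphism from it
(`exists_algHom_of_anticomm`). Hence all `P_γ` are irreducible, and an irreducible representation of
`U'` with `z₂ ↦ -1`, `z₃ ↦ 1` is determined by the scalars `ω^{2 γ_j}` by which the central elements
`η̂ⱼ²` act and, for odd `n`, by the sign `ε` in the scalar by which the product of all `η̂ⱼ` acts
(`exists_occurs`, `orderedProd_ySign`). An element of `𝔖̃ₙ` over `σ` permutes the `γ_j` by `σ` and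
multiplies `ε` by the sign of `σ`. Modulo `m₀`, each `γ` is a permutation of the function
`block` of a family of diagrams, and the families which occur for the same `γ` have the same numbers
of cells (`MultiDiagram.exists_block_eq`, `MultiDiagram.block_eq_of_perm`). The sign `ε` can be
made positive if an odd permutation preserves `γ`, that is, unless the family is quasi-trivial. This
gives representatives of the orbits of `𝔖̃ₙ`; their stabilizers lie over the Young subgroup for even
`n` and over its even part for odd `n` (`evenDatum_separated`, `oddDatum_separated`,
`evenDatum_cover`, `oddDatum_cover`), and `∇^II_n`, `℧^±_n` extend `P^±_γ` to them.

*Clifford theory.* An element of the group algebra of `U'` acts as the identity on `P_γ` and as zero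
on representations not containing `P_γ` (`exists_isotypic_element`). On an induced representation it
projects to the inducing one, so induction from the stabilizer preserves irreducibility and
inequivalence (`ind_isIrreducible`, `nonempty_equiv_of_ind_equiv`). Conversely, if `P_γ` occurs in an
irreducible representation, then the space of intertwining maps is acted on by the stabilizer; as `z₁`
acts by `-1` on both sides, it is a representation of the Young subgroup or its even part, and
Frobenius reciprocity shows that the representation is one of the induced ones
(`SpinDatum.isCompleteSetOfReps`).

*Young subgroups.* The Specht modules are irreducible and pairwise inequivalent by the properties of
Young symmetrizers, and so are their outer tensor products. The number of these is the number of
conjugacy classes, so by the orthogonality of characters they occur in every representation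
(`isExhausting_of_conjClasses`, `MultiDiagram.outerOn_isExhausting`). The sign twist transposes the
diagrams (`MultiDiagram.outerOn_signTwist`), which by the theory of subgroups of index two describes
the irreducible constituents of the restrictions to the even part: the restriction of `π_Λ` stays
irreducible if `ᵗΛ ≠ Λ`, is then equivalent to that of its transpose, and otherwise splits into two
inequivalent constituents, provided that the Young subgroup contains an odd permutation.
-/

noncomputable section

namespace SpinGSG

open Representation

/-! ### Representations of finite groups -/

section General

variable {G : Type*} [Group G] {V W : Type*} [AddCommGroup V] [Module ℂ V]
  [AddCommGroup W] [Module ℂ W]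

theorem isIrreducible_iff (ρ : Representation ℂ G V) :
    ρ.IsIrreducible ↔ Nontrivial V ∧ ∀ Y : Submodule ℂ V, (∀ g, ∀ v ∈ Y, ρ g v ∈ Y) →
      Y = ⊥ ∨ Y = ⊤ := by
  constructor
  · intro h
    refine ⟨?_, fun Y hY => ?_⟩
    · by_contra hV
      rw [not_nontrivial_iff_subsingleton] at hV
      obtain ⟨a, b, hab⟩ := h.toNontrivial
      exact hab (Subrepresentation.toSubmodule_injective (Subsingleton.elim _ _))
    · rcases h.eq_bot_or_eq_top ⟨Y, fun g v hv => hY g v hv⟩ with h | h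
      · left; exact congrArg Subrepresentation.toSubmodule h
      · right; exact congrArg Subrepresentation.toSubmodule h
  · rintro ⟨h1, h2⟩
    have : Nontrivial (Subrepresentation ρ) := by
      refine ⟨⊥, ⊤, fun h => ?_⟩
      have : (⊥ : Submodule ℂ V) = ⊤ := congrArg Subrepresentation.toSubmodule h
      exact bot_ne_top this
    refine ⟨fun Y => ?_⟩
    rcases h2 Y.toSubmodule (fun g v hv => Y.apply_mem_toSubmodule g hv) with h | h
    · left; exact Subrepresentation.toSubmodule_injective h
    · right; exact Subrepresentation.toSubmodule_injective h

theorem IsIrreducible.nontrivial {ρ : Representation ℂ G V} (h : ρ.IsIrreducible) :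
    Nontrivial V := ((isIrreducible_iff ρ).1 h).1

theorem IsIrreducible.eq_top {ρ : Representation ℂ G V} (h : ρ.IsIrreducible)
    (Y : Submodule ℂ V) (hY : ∀ g, ∀ v ∈ Y, ρ g v ∈ Y) {v : V} (hv : v ∈ Y) (h0 : v ≠ 0) :
    Y = ⊤ := by
  rcases ((isIrreducible_iff ρ).1 h).2 Y hY with h | h
  · subst h; exact absurd (by simpa using hv) h0
  · exact h

/-- A submodule stable under a finite group has a stable complement (Maschke). -/
theorem exists_stable_compl [Finite G] (ρ : Representation ℂ G V) (Y : Submodule ℂ V)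
    (hY : ∀ g, ∀ v ∈ Y, ρ g v ∈ Y) :
    ∃ Z : Submodule ℂ V, (∀ g, ∀ v ∈ Z, ρ g v ∈ Z) ∧ IsCompl Y Z := by
  have : NeZero (Nat.card G : ℂ) := ⟨by exact_mod_cast Nat.card_pos.ne'⟩
  obtain ⟨Z, hZ⟩ := exists_isCompl (⟨Y, fun g v hv => hY g v hv⟩ : Subrepresentation ρ)
  refine ⟨Z.toSubmodule, fun g v hv => Z.apply_mem_toSubmodule g hv, ?_, ?_⟩
  · rw [disjoint_iff]
    exact congrArg Subrepresentation.toSubmodule hZ.inf_eq_bot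
  · rw [codisjoint_iff]
    exact congrArg Subrepresentation.toSubmodule hZ.sup_eq_top

theorem IsIrreducible.finiteDimensional [Finite G] {ρ : Representation ℂ G V}
    (h : ρ.IsIrreducible) : FiniteDimensional ℂ V := by
  obtain ⟨v, hv⟩ := @exists_ne V (IsIrreducible.nontrivial h) 0
  have := IsIrreducible.eq_top h (Submodule.span ℂ (Set.range fun g => ρ g v)) (by
    intro g
    change Submodule.span ℂ _ ≤ (Submodule.span ℂ _).comap (ρ g)
    rw [Submodule.span_le]
    rintro _ ⟨g', rfl⟩
    exact Submodule.subset_span ⟨g * g', by simp⟩) (v := v) (Submodule.subset_span ⟨1, by simp⟩) hv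
  rw [FiniteDimensional, Module.finite_def, ← this]
  exact Submodule.fg_span (Set.finite_range _)

/-- The algebra of operators of a group representation preserves stable submodules. -/
theorem asAlgebraHom_mem (ρ : Representation ℂ G V) (Y : Submodule ℂ V)
    (hY : ∀ g, ∀ v ∈ Y, ρ g v ∈ Y) (e : MonoidAlgebra ℂ G) {v : V} (hv : v ∈ Y) :
    ρ.asAlgebraHom e v ∈ Y := by
  induction e using MonoidAlgebra.induction_linear with
  | zero => simp
  | add x y hx hy => rw [map_add]; exact Y.add_mem hx hy
  | single g a => rw [asAlgebraHom_single]; exact Y.smul_mem _ (hY _ _ hv)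

theorem intertwining_asAlgebraHom {ρ : Representation ℂ G V} {σ : Representation ℂ G W}
    (f : ρ.IntertwiningMap σ) (e : MonoidAlgebra ℂ G) (v : V) :
    f (ρ.asAlgebraHom e v) = σ.asAlgebraHom e (f v) := by
  induction e using MonoidAlgebra.induction_linear with
  | zero => simp
  | add x y hx hy => simp [map_add, hx, hy]
  | single g a => simp [asAlgebraHom_single, f.isIntertwining]

/-- A representation of a finite group is irreducible as soon as some element of the group algebra
acts on it by a nonzero operator with image spanned by a cyclic vector. -/
theorem isIrreducible_of_rank_one [Finite G] (ρ : Representation ℂ G V) (e : MonoidAlgebra ℂ G)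
    (w : V) (h1 : ∀ v, ∃ c : ℂ, ρ.asAlgebraHom e v = c • w) (h2 : ∃ v, ρ.asAlgebraHom e v ≠ 0)
    (h3 : ∀ Y : Submodule ℂ V, (∀ g, ∀ v ∈ Y, ρ g v ∈ Y) → w ∈ Y → Y = ⊤) :
    ρ.IsIrreducible := by
  obtain ⟨v₀, hv₀⟩ := h2
  have key : ∀ Y : Submodule ℂ V, (∀ g, ∀ v ∈ Y, ρ g v ∈ Y) →
      (∃ v ∈ Y, ρ.asAlgebraHom e v ≠ 0) → Y = ⊤ := by
    rintro Y hY ⟨v, hv, hne⟩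
    apply h3 Y hY
    obtain ⟨c, hc⟩ := h1 v
    have hc0 : c ≠ 0 := by rintro rfl; simp [hc] at hne
    have := Y.smul_mem c⁻¹ (asAlgebraHom_mem ρ Y hY e hv)
    rwa [hc, smul_smul, inv_mul_cancel₀ hc0, one_smul] at this
  rw [isIrreducible_iff]
  refine ⟨⟨v₀, 0, fun h => hv₀ (by rw [h, map_zero])⟩, fun Y hY => ?_⟩
  obtain ⟨Z, hZ, hc⟩ := exists_stable_compl ρ Y hY
  obtain ⟨y, hy, z, hz, hyz⟩ := Submodule.mem_sup.1 (hc.sup_eq_top ▸ Submodule.mem_top : v₀ ∈ Y ⊔ Z)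
  by_cases h : ρ.asAlgebraHom e y = 0
  · left
    have hZt : Z = ⊤ := key Z hZ ⟨z, hz, by
      intro h'; apply hv₀; rw [← hyz, map_add, h, h', add_zero]⟩
    have := hc.inf_eq_bot
    rwa [hZt, inf_top_eq] at this
  · right
    exact key Y hY ⟨y, hy, h⟩

theorem exists_irreducible_stable [Finite G] [Nontrivial V] (ρ : Representation ℂ G V) :
    ∃ Y : Subrepresentation ρ, Y.toRepresentation.IsIrreducible := by
  have : NeZero (Nat.card G : ℂ) := ⟨by exact_mod_cast Nat.card_pos.ne'⟩
  have : Nontrivial ρ.asModule := inferInstanceAs (Nontrivial V)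
  have : IsAtomic (Subrepresentation ρ) :=
    (OrderIso.isAtomic_iff Subrepresentation.subrepresentationSubmoduleOrderIso).2
      (inferInstanceAs (IsAtomic (Submodule (MonoidAlgebra ℂ G) ρ.asModule)))
  have hbt : (⊤ : Subrepresentation ρ) ≠ ⊥ := fun h =>
    top_ne_bot (congrArg Subrepresentation.toSubmodule h : (⊤ : Submodule ℂ V) = ⊥)
  obtain ⟨Y, hY, -⟩ := (eq_bot_or_exists_atom_le (⊤ : Subrepresentation ρ)).resolve_left hbt
  refine ⟨Y, ?_⟩
  rw [isIrreducible_iff]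
  constructor
  · rw [Submodule.nontrivial_iff_ne_bot]
    intro h
    exact hY.1 (Subrepresentation.toSubmodule_injective h)
  · intro Z hZ
    let Z' : Subrepresentation ρ := ⟨Z.map Y.toSubmodule.subtype, by
      rintro g _ ⟨z, hz, rfl⟩
      exact ⟨_, hZ g z hz, rfl⟩⟩
    have hle : Z' ≤ Y := by
      intro v hv
      obtain ⟨z, -, rfl⟩ := (hv : v ∈ Z.map Y.toSubmodule.subtype)
      exact z.2
    rcases hY.le_iff.1 hle with h | h
    · left
      have : Z.map Y.toSubmodule.subtype = ⊥ := congrArg Subrepresentation.toSubmodule h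
      rw [eq_bot_iff]
      intro z hz
      have hz' : (z : V) ∈ Z.map Y.toSubmodule.subtype := ⟨z, hz, rfl⟩
      rw [this] at hz'
      exact Subtype.val_injective hz'
    · right
      have : Z.map Y.toSubmodule.subtype = Y.toSubmodule :=
        congrArg Subrepresentation.toSubmodule h
      rw [eq_top_iff]
      intro y _
      have hy : (y : V) ∈ Z.map Y.toSubmodule.subtype := by rw [this]; exact y.2
      obtain ⟨z, hz, hzy⟩ := hy
      rwa [Subtype.val_injective hzy] at hz

theorem nonempty_equiv_of_ne_zero {ρ : Representation ℂ G V} {σ : Representation ℂ G W}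
    (hρ : ρ.IsIrreducible) (hσ : σ.IsIrreducible) (f : ρ.IntertwiningMap σ) (hf : f ≠ 0) :
    Nonempty (ρ.Equiv σ) :=
  ⟨f.ofBijective ((IsIrreducible.bijective_or_eq_zero f).resolve_right hf)⟩

theorem equiv_ne_zero [Nontrivial V] {ρ : Representation ℂ G V} {σ : Representation ℂ G W}
    (e : ρ.Equiv σ) : e.toIntertwiningMap ≠ 0 := by
  intro h
  obtain ⟨v, hv⟩ := exists_ne (0 : V)
  apply hv
  have : e v = 0 := by
    have := DFunLike.congr_fun h v
    simpa using this
  rw [← e.symm_apply_apply v, this]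
  exact map_zero e.symm

theorem equiv_map {ρ : Representation ℂ G V} {σ : Representation ℂ G W} (e : ρ.Equiv σ) (g : G)
    (v : V) : e (ρ g v) = σ g (e v) :=
  IntertwiningMap.isIntertwining _ _ e.toIntertwiningMap g v

/-- Schur's lemma: endomorphisms of an irreducible representation are scalars. -/
theorem schur_scalar [Finite G] {ρ : Representation ℂ G V} (hρ : ρ.IsIrreducible) (f : V →ₗ[ℂ] V)
    (hf : ∀ g v, f (ρ g v) = ρ g (f v)) : ∃ c : ℂ, ∀ v, f v = c • v := by
  have := IsIrreducible.finiteDimensional hρ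
  have hF : ∀ g, f ∘ₗ ρ g = ρ g ∘ₗ f := fun g => LinearMap.ext (hf g)
  obtain ⟨c, hc⟩ := (IsIrreducible.algebraMap_intertwiningMap_bijective_of_isAlgClosed
    (ρ := ρ)).2 ⟨f, hF⟩
  refine ⟨c, fun v => ?_⟩
  have := DFunLike.congr_fun hc v
  exact this.symm

end General

/-! ### Complete families of representations -/

section Counting

variable {G : Type*} [Group G] [Finite G]

/-- A family `ρ` of representations meets every nonzero representation of `G`: each of them receives
a nonzero intertwining map from a member of the family. -/
def IsExhausting.{w} {G : Type*} [Group G] {I : Type*} {V : I → Type*} [∀ i, AddCommGroup (V i)]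
    [∀ i, Module ℂ (V i)] (ρ : ∀ i, Representation ℂ G (V i)) : Prop :=
  ∀ (M : Type w) [AddCommGroup M] [Module ℂ M] [Nontrivial M] (σ : Representation ℂ G M),
    ∃ i, ∃ f : (ρ i).IntertwiningMap σ, f ≠ 0

/-- If `V` has no nonzero intertwining map to `M`, the isotypic operator `∑ χ_V(g⁻¹) g` kills `M`:
it is a sum of values of averaged maps `V → M`. -/
theorem sum_character_smul_eq_zero {V M : Type*} [AddCommGroup V] [Module ℂ V]
    [FiniteDimensional ℂ V] [AddCommGroup M] [Module ℂ M] [Fintype G] (ρ : Representation ℂ G V)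
    (σ : Representation ℂ G M) (h : ∀ f : ρ.IntertwiningMap σ, f = 0) (m : M) :
    ∑ g, ρ.character g⁻¹ • σ g m = 0 := by
  let b := Module.finBasis ℂ V
  have key : ∀ i (v : V), ∑ g : G, b.coord i (ρ g⁻¹ v) • σ g m = 0 := by
    intro i
    let F : V →ₗ[ℂ] M := ∑ g : G, ((b.coord i) ∘ₗ ρ g⁻¹).smulRight (σ g m)
    have hF : ∀ v, F v = ∑ g : G, b.coord i (ρ g⁻¹ v) • σ g m := by
      intro v; simp [F, LinearMap.sum_apply]
    have hint : ∀ g, F ∘ₗ ρ g = σ g ∘ₗ F := by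
      intro h
      ext v
      simp only [LinearMap.comp_apply, hF, map_sum, map_smul]
      refine Fintype.sum_bijective (fun g => h⁻¹ * g) (Group.mulLeft_bijective _) _ _ ?_
      intro g
      rw [← Module.End.mul_apply, ← Module.End.mul_apply, ← map_mul, ← map_mul]
      simp
    intro v
    rw [← hF]
    have := DFunLike.congr_fun (h ⟨F, hint⟩) v
    exact this
  have : ∀ g : G, ρ.character g⁻¹ = ∑ i, b.coord i (ρ g⁻¹ (b i)) := by
    intro g
    rw [Representation.character, LinearMap.trace_eq_matrix_trace ℂ b, Matrix.trace]
    simp [LinearMap.toMatrix_apply]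
  simp only [this, Finset.sum_smul]
  rw [Finset.sum_comm]
  exact Finset.sum_eq_zero fun i _ => key i (b i)

/-- Pairwise inequivalent irreducible representations which are at least as numerous as the
conjugacy classes form a complete family: their characters span the class functions, in particular
the indicator function of `1`. -/
theorem isExhausting_of_conjClasses.{w} {I : Type*} {V : I → Type*} [∀ i, AddCommGroup (V i)]
    [∀ i, Module ℂ (V i)] (ρ : ∀ i, Representation ℂ G (V i)) (hirr : ∀ i, (ρ i).IsIrreducible)
    (hne : ∀ i j, Nonempty ((ρ i).Equiv (ρ j)) → i = j)
    (hcard : ∃ f : ConjClasses G → I, Function.Injective f) : IsExhausting.{w} ρ := by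
  classical
  intro M _ _ _ σ
  by_contra hno
  push Not at hno
  obtain ⟨φ, hφ⟩ := hcard
  have := Fintype.ofFinite G
  have : Invertible (Nat.card G : ℂ) :=
    invertibleOfNonzero (by exact_mod_cast Nat.card_pos.ne')
  have : ∀ i, FiniteDimensional ℂ (V i) := fun i => IsIrreducible.finiteDimensional (hirr i)
  have := hirr
  let χ : ConjClasses G → ConjClasses G → ℂ := fun j => Quotient.lift (ρ (φ j)).character (by
    intro a b hab
    obtain ⟨c, rfl⟩ := isConj_iff.1 hab
    rw [char_conj])
  have hχ : ∀ j g, χ j (ConjClasses.mk g) = (ρ (φ j)).character g := fun _ _ => rfl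
  have horth : ∀ i j, (Nat.card G : ℂ)⁻¹ * ∑ g : G, (ρ (φ i)).character g *
      (ρ (φ j)).character g⁻¹ = if i = j then 1 else 0 := by
    intro i j
    rw [char_orthonormal]
    congr 1
    apply propext
    constructor
    · intro h
      exact hφ (hne _ _ h).symm
    · rintro rfl
      exact ⟨Representation.Equiv.refl _⟩
  have hli : LinearIndependent ℂ χ := by
    rw [Fintype.linearIndependent_iff]
    intro c hc i
    have h1 : ∀ g : G, ∑ j, c j * (ρ (φ j)).character g = 0 := by
      intro g
      have := congrFun hc (ConjClasses.mk g)
      simpa [hχ] using this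
    calc c i = ∑ j, c j * (if j = i then 1 else 0) := by simp
      _ = (Nat.card G : ℂ)⁻¹ * ∑ g : G, (∑ j, c j * (ρ (φ j)).character g) *
          (ρ (φ i)).character g⁻¹ := by
        simp only [← horth, Finset.sum_mul, Finset.mul_sum]
        rw [Finset.sum_comm]
        refine Finset.sum_congr rfl fun g _ => Finset.sum_congr rfl fun j _ => by ring
      _ = 0 := by simp [h1]
  have hspan := hli.span_eq_top_of_card_eq_finrank' (by simp)
  have hmem : (Pi.single (ConjClasses.mk (1 : G)) 1 : ConjClasses G → ℂ) ∈
      Submodule.span ℂ (Set.range χ) := hspan ▸ Submodule.mem_top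
  obtain ⟨c, hc⟩ := (Submodule.mem_span_range_iff_exists_fun ℂ).1 hmem
  have hδ : ∀ g : G, ∑ j, c j * (ρ (φ j)).character g = if g = 1 then 1 else 0 := by
    intro g
    have := congrFun hc (ConjClasses.mk g)
    simp only [Finset.sum_apply, Pi.smul_apply, hχ, smul_eq_mul, Pi.single_apply,
      ConjClasses.mk_eq_mk_iff_isConj] at this
    rw [this]
    simp
  obtain ⟨m, hm⟩ := exists_ne (0 : M)
  apply hm
  calc m = ∑ g : G, (if g⁻¹ = 1 then (1 : ℂ) else 0) • σ g m := by
        simp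
    _ = ∑ j, c j • ∑ g : G, (ρ (φ j)).character g⁻¹ • σ g m := by
        simp only [← hδ, Finset.sum_smul, Finset.smul_sum, mul_smul]
        rw [Finset.sum_comm]
    _ = 0 := Finset.sum_eq_zero fun j _ => by
        rw [sum_character_smul_eq_zero (ρ (φ j)) σ (hno (φ j)) m, smul_zero]

/-- Restriction to a subgroup of an exhausting family is exhausting (Frobenius reciprocity). -/
theorem IsExhausting.restrict.{w} {S B : Type} [Group S] [Group B] (i : B →* S)
    (hi : Function.Injective i) {I : Type*} {V : I → Type*} [∀ i, AddCommGroup (V i)]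
    [∀ i, Module ℂ (V i)] {ρ : ∀ i, Representation ℂ S (V i)} (hρ : IsExhausting.{w} ρ) :
    IsExhausting.{w} fun k => (ρ k).comp i := by
  classical
  intro M _ _ _ σ
  obtain ⟨m, hm⟩ := exists_ne (0 : M)
  let f₀ : S → M := fun s => if h : ∃ b, i b = s then σ h.choose m else 0
  have hf₀ : f₀ ∈ coindV i σ := by
    intro b s
    by_cases h : ∃ b', i b' = s
    · obtain ⟨b', rfl⟩ := h
      have e1 : ∀ b'', f₀ (i b'') = σ b'' m := by
        intro b''
        have h : ∃ b', i b' = i b'' := ⟨b'', rfl⟩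
        simp only [f₀, dif_pos h]
        rw [hi h.choose_spec]
      rw [← map_mul, e1, e1, map_mul]; rfl
    · have h' : ¬ ∃ b', i b' = i b * s := by
        rintro ⟨b', hb'⟩
        exact h ⟨b⁻¹ * b', by simp [hb']⟩
      simp only [f₀, dif_neg h, dif_neg h', map_zero]
  have hne : (⟨f₀, hf₀⟩ : coindV i σ) ≠ 0 := by
    intro h
    have h1 : f₀ 1 = 0 := congrFun (congrArg Subtype.val h) 1
    have h2 : ∃ b, i b = 1 := ⟨1, map_one i⟩
    simp only [f₀, dif_pos h2] at h1
    rw [hi (h2.choose_spec.trans (map_one i).symm), map_one] at h1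
    exact hm h1
  have : Nontrivial (coindV i σ) := ⟨_, _, hne⟩
  obtain ⟨k, F, hF⟩ := hρ (coindV i σ) (coind i σ)
  have hFs : ∀ s v t, (F (ρ k s v)).1 t = (F v).1 (t * s) := by
    intro s v t
    rw [F.isIntertwining]
    rfl
  refine ⟨k, ⟨LinearMap.proj 1 ∘ₗ (coindV i σ).subtype ∘ₗ F.toLinearMap, fun b => ?_⟩, ?_⟩
  · ext v
    change (F (ρ k (i b) v)).1 1 = σ b ((F v).1 1)
    rw [hFs, one_mul, ← (F v).2 b 1, mul_one]
  · intro h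
    apply hF
    refine DFunLike.ext _ _ fun v => Subtype.ext (funext fun s => ?_)
    have := DFunLike.congr_fun h (ρ k s v)
    change (F (ρ k s v)).1 1 = 0 at this
    rw [hFs, one_mul] at this
    exact this

end Counting

/-! ### Subgroups of index two -/

section IndexTwo

variable {S B : Type*} [Group S] [Group B] {V V' : Type*} [AddCommGroup V] [Module ℂ V]
  [AddCommGroup V'] [Module ℂ V']

/-- The twist of a representation by a sign character. -/
def signTwist (χ : S →* ℤˣ) (ρ : Representation ℂ S V) : Representation ℂ S V where
  toFun s := ((χ s : ℤ) : ℂ) • ρ s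
  map_one' := by simp
  map_mul' s t := by
    rw [map_mul, map_mul, smul_mul_smul_comm]
    push_cast
    rfl

theorem signTwist_apply (χ : S →* ℤˣ) (ρ : Representation ℂ S V) (s : S) (v : V) :
    signTwist χ ρ s v = ((χ s : ℤ) : ℂ) • ρ s v := rfl

theorem signTwist_pos {χ : S →* ℤˣ} {ρ : Representation ℂ S V} {s : S} (h : χ s = 1) (v : V) :
    signTwist χ ρ s v = ρ s v := by simp [signTwist_apply, h]

theorem signTwist_neg {χ : S →* ℤˣ} {ρ : Representation ℂ S V} {s : S} (h : χ s = -1) (v : V) :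
    signTwist χ ρ s v = -ρ s v := by simp [signTwist_apply, h]

theorem IsIrreducible.signTwist {χ : S →* ℤˣ} {ρ : Representation ℂ S V} (h : ρ.IsIrreducible) :
    (signTwist χ ρ).IsIrreducible := by
  rw [isIrreducible_iff] at h ⊢
  refine ⟨h.1, fun Y hY => h.2 Y fun g v hv => ?_⟩
  have := hY g v hv
  rcases Int.units_eq_one_or (χ g) with h | h
  · rwa [signTwist_pos h] at this
  · rwa [signTwist_neg h, Y.neg_mem_iff] at this

variable (χ : S →* ℤˣ) (i : B →* S) (hi : ∀ s, χ s = 1 ↔ ∃ b, i b = s)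

include hi in
/-- To be stable under `S` it is enough to be stable under `B` and one element outside of `B`. -/
theorem stable_of_stable {ρ : Representation ℂ S V} {τ : S} (hτ : χ τ = -1) {Y : Submodule ℂ V}
    (h1 : ∀ b, ∀ v ∈ Y, ρ (i b) v ∈ Y) (h2 : ∀ v ∈ Y, ρ τ v ∈ Y) (s : S) (v : V) (hv : v ∈ Y) :
    ρ s v ∈ Y := by
  rcases Int.units_eq_one_or (χ s) with h | h
  · obtain ⟨b, rfl⟩ := (hi s).1 h
    exact h1 b v hv
  · obtain ⟨b, hb⟩ := (hi (τ⁻¹ * s)).1 (by rw [map_mul, map_inv, hτ, h]; simp)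
    rw [show s = τ * i b by rw [hb, mul_inv_cancel_left], map_mul]
    exact h2 _ (h1 _ _ hv)

include hi in
/-- Let `f` intertwine the restrictions to `B` of two representations of `S`. Then its conjugate
`f'` by an odd element is such that odd elements carry `f` to `f'` and `f'` to `f`. -/
theorem exists_conjugate {ρ : Representation ℂ S V} {ρ' : Representation ℂ S V'} {τ : S}
    (hτ : χ τ = -1) (f : V →ₗ[ℂ] V') (hf : ∀ b v, f (ρ (i b) v) = ρ' (i b) (f v)) :
    ∃ f' : V →ₗ[ℂ] V', (∀ v, f' v = ρ' τ⁻¹ (f (ρ τ v))) ∧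
      (∀ s, χ s = 1 → ∀ v, f (ρ s v) = ρ' s (f v) ∧ f' (ρ s v) = ρ' s (f' v)) ∧
      ∀ s, χ s = -1 → ∀ v, f (ρ s v) = ρ' s (f' v) ∧ f' (ρ s v) = ρ' s (f v) := by
  have hfs : ∀ s, χ s = 1 → ∀ v, f (ρ s v) = ρ' s (f v) := by
    intro s hs v
    obtain ⟨b, rfl⟩ := (hi s).1 hs
    exact hf b v
  let f' : V →ₗ[ℂ] V' := ρ' τ⁻¹ ∘ₗ f ∘ₗ ρ τ
  have hf' : ∀ v, f' v = ρ' τ⁻¹ (f (ρ τ v)) := fun _ => rfl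
  have hodd : ∀ s, χ s = -1 → ∀ v, f (ρ s v) = ρ' s (f' v) := by
    intro s hs v
    have e : ρ s v = ρ (s * τ⁻¹) (ρ τ v) := by
      rw [← Module.End.mul_apply, ← map_mul, inv_mul_cancel_right]
    rw [e, hfs _ (by rw [map_mul, map_inv, hτ, hs]; simp), hf', map_mul, Module.End.mul_apply]
  have hodd' : ∀ s, χ s = -1 → ∀ v, f' (ρ s v) = ρ' s (f v) := by
    intro s hs v
    have e := hodd s⁻¹ (by rw [map_inv, hs]; simp) (ρ s v)
    rw [← Module.End.mul_apply, ← map_mul, inv_mul_cancel, map_one, Module.End.one_apply] at e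
    rw [e, ← Module.End.mul_apply, ← map_mul, mul_inv_cancel, map_one, Module.End.one_apply]
  have heven : ∀ s, χ s = 1 → ∀ v, f' (ρ s v) = ρ' s (f' v) := by
    intro s hs v
    rw [hf', hf', ← Module.End.mul_apply, ← map_mul, hodd _ (by rw [map_mul, hτ, hs]; simp),
      map_mul, Module.End.mul_apply, ← Module.End.mul_apply, ← map_mul, inv_mul_cancel, map_one,
      Module.End.one_apply, hf']
  exact ⟨f', hf', fun s hs v => ⟨hfs s hs v, heven s hs v⟩, fun s hs v => ⟨hodd s hs v, hodd' s hs v⟩⟩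

include hi in
/-- Two irreducible representations of `S` sharing a constituent on the subgroup `B` of index two
are equal up to the sign twist. -/
theorem equiv_or_equiv_signTwist {ρ : Representation ℂ S V} {ρ' : Representation ℂ S V'}
    (hρ : ρ.IsIrreducible) (hρ' : ρ'.IsIrreducible) {τ : S} (hτ : χ τ = -1)
    (f : V →ₗ[ℂ] V') (hf : ∀ b v, f (ρ (i b) v) = ρ' (i b) (f v)) (hf0 : f ≠ 0) :
    Nonempty (ρ.Equiv ρ') ∨ Nonempty ((signTwist χ ρ).Equiv ρ') := by
  obtain ⟨f', -, heven, hodd⟩ := exists_conjugate χ i hi hτ f hf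
  -- `f + f'` is equivariant, and if it vanishes then `f` is equivariant for the twist
  by_cases h0 : f + f' = 0
  · right
    refine nonempty_equiv_of_ne_zero (IsIrreducible.signTwist hρ) hρ' ⟨f, fun s => ?_⟩ ?_
    · ext v
      have hv : f' v = - f v := by
        have := LinearMap.congr_fun h0 v
        exact (neg_eq_of_add_eq_zero_right this).symm
      change f (SpinGSG.signTwist χ ρ s v) = ρ' s (f v)
      rcases Int.units_eq_one_or (χ s) with h | h
      · rw [signTwist_pos h, (heven s h v).1]
      · rw [signTwist_neg h, map_neg, (hodd s h v).1, hv, map_neg, neg_neg]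
    · intro h
      exact hf0 (congrArg IntertwiningMap.toLinearMap h)
  · left
    refine nonempty_equiv_of_ne_zero hρ hρ' ⟨f + f', fun s => ?_⟩ ?_
    · ext v
      change f (ρ s v) + f' (ρ s v) = ρ' s (f v + f' v)
      rcases Int.units_eq_one_or (χ s) with h | h
      · rw [(heven s h v).1, (heven s h v).2, map_add]
      · rw [(hodd s h v).1, (hodd s h v).2, map_add, add_comm]
    · intro h
      exact h0 (congrArg IntertwiningMap.toLinearMap h)

include hi in
/-- A proper nonzero `B`-stable subspace `Y` of an irreducible representation of `S` is complemented
by its translate `τ Y`. -/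
theorem isCompl_translate {ρ : Representation ℂ S V} (hρ : ρ.IsIrreducible) {τ : S}
    (hτ : χ τ = -1) {Y : Submodule ℂ V} (hY : ∀ b, ∀ v ∈ Y, ρ (i b) v ∈ Y) (h0 : Y ≠ ⊥)
    (h1 : Y ≠ ⊤) : IsCompl Y (Y.map (ρ τ)) := by
  have hev : ∀ s, χ s = 1 → ∀ v ∈ Y, ρ s v ∈ Y := by
    intro s hs v hv
    obtain ⟨b, rfl⟩ := (hi s).1 hs
    exact hY b v hv
  have hB : ∀ b, χ (i b) = 1 := fun b => (hi _).2 ⟨b, rfl⟩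
  have hYτ : ∀ b, ∀ v ∈ Y.map (ρ τ), ρ (i b) v ∈ Y.map (ρ τ) := by
    rintro b _ ⟨v, hv, rfl⟩
    refine ⟨ρ (τ⁻¹ * i b * τ) v, hev _ (by simp [hτ, hB]) v hv, ?_⟩
    rw [← Module.End.mul_apply, ← Module.End.mul_apply, ← map_mul, ← map_mul]
    congr 2
    group
  have hττ : ∀ v ∈ Y.map (ρ τ), ρ τ v ∈ Y := by
    rintro _ ⟨v, hv, rfl⟩
    rw [← Module.End.mul_apply, ← map_mul]
    exact hev _ (by simp [hτ]) v hv
  obtain ⟨y, hy, hy0⟩ := (Submodule.ne_bot_iff Y).1 h0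
  constructor
  · rw [disjoint_iff]
    by_contra hne
    obtain ⟨z, hz, hz0⟩ := (Submodule.ne_bot_iff _).1 hne
    have := IsIrreducible.eq_top hρ (Y ⊓ Y.map (ρ τ))
      (stable_of_stable χ i hi hτ (fun b v hv => ⟨hY b v hv.1, hYτ b v hv.2⟩)
        (fun v hv => ⟨hττ v hv.2, ⟨v, hv.1, rfl⟩⟩)) hz hz0
    exact h1 (eq_top_iff.2 (this ▸ inf_le_left))
  · rw [codisjoint_iff]
    refine IsIrreducible.eq_top hρ _ (stable_of_stable χ i hi hτ ?_ ?_)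
      (Submodule.mem_sup_left hy) hy0
    · intro b v hv
      obtain ⟨a, ha, c, hc, rfl⟩ := Submodule.mem_sup.1 hv
      rw [map_add]
      exact Submodule.add_mem_sup (hY b a ha) (hYτ b c hc)
    · intro v hv
      obtain ⟨a, ha, c, hc, rfl⟩ := Submodule.mem_sup.1 hv
      rw [map_add, add_comm]
      exact Submodule.add_mem_sup (hττ c hc) ⟨a, ha, rfl⟩

include hi in
theorem isIrreducible_restrict {ρ : Representation ℂ S V} (hρ : ρ.IsIrreducible) {τ : S}
    (hτ : χ τ = -1) (hne : ¬ Nonempty ((signTwist χ ρ).Equiv ρ)) :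
    Representation.IsIrreducible (ρ.comp i : Representation ℂ B V) := by
  rw [isIrreducible_iff]
  refine ⟨IsIrreducible.nontrivial hρ, fun Y hY => ?_⟩
  by_contra hcon
  push Not at hcon
  have hc := isCompl_translate χ i hi hρ hτ hY hcon.1 hcon.2
  have hev : ∀ s, χ s = 1 → ∀ v ∈ Y, ρ s v ∈ Y := by
    intro s hs v hv
    obtain ⟨b, rfl⟩ := (hi s).1 hs
    exact hY b v hv
  -- the operator which is `1` on `Y` and `-1` on `τ Y` intertwines `ρ` with its twist
  let T : V →ₗ[ℂ] V := LinearMap.ofIsCompl hc Y.subtype (-(Y.map (ρ τ)).subtype)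
  have hT1 : ∀ v ∈ Y, T v = v := fun v hv => LinearMap.ofIsCompl_apply_left hc ⟨v, hv⟩
  have hT2 : ∀ v ∈ Y, T (ρ τ v) = -ρ τ v := fun v hv =>
    LinearMap.ofIsCompl_apply_right hc ⟨ρ τ v, v, hv, rfl⟩
  have hT3 : ∀ s, χ s = -1 → ∀ v ∈ Y, T (ρ s v) = -ρ s v := by
    intro s hs v hv
    have e : ρ s v = ρ τ (ρ (τ⁻¹ * s) v) := by
      rw [← Module.End.mul_apply, ← map_mul, mul_inv_cancel_left]
    rw [e]
    exact hT2 _ (hev _ (by rw [map_mul, map_inv, hτ, hs]; simp) v hv)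
  have hT : ∀ s v, T (signTwist χ ρ s v) = ρ s (T v) := by
    intro s v
    obtain ⟨a, ha, _, ⟨c, hcY, rfl⟩, rfl⟩ :=
      Submodule.mem_sup.1 (hc.sup_eq_top ▸ Submodule.mem_top : v ∈ Y ⊔ Y.map (ρ τ))
    have e : ρ s (ρ τ c) = ρ (s * τ) c := by rw [map_mul, Module.End.mul_apply]
    rcases Int.units_eq_one_or (χ s) with h | h
    · rw [signTwist_pos h, map_add, map_add, map_add, hT1 a ha, hT1 _ (hev s h a ha), hT2 c hcY,
        map_add, map_neg, e, hT3 _ (by rw [map_mul, h, hτ]; simp) c hcY]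
    · rw [signTwist_neg h, map_neg, map_add, map_add, map_add, hT1 a ha, hT3 s h a ha, hT2 c hcY,
        map_add, map_neg, e, hT1 _ (hev _ (by rw [map_mul, h, hτ]; simp) c hcY)]
      abel
  refine hne (nonempty_equiv_of_ne_zero (IsIrreducible.signTwist hρ) hρ
    ⟨T, fun s => LinearMap.ext (hT s)⟩ ?_)
  intro h
  obtain ⟨y, hy, hy0⟩ := (Submodule.ne_bot_iff Y).1 hcon.1
  apply hy0
  rw [← hT1 y hy]
  exact DFunLike.congr_fun h y

include hi in
/-- An irreducible representation of `S` equivalent to its sign twist splits into two inequivalent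
irreducible representations of `B`: the eigenspaces of an involution intertwining it with its
twist. -/
theorem exists_isSplitting [Finite S] {ρ : Representation ℂ S V} (hρ : ρ.IsIrreducible) {τ : S}
    (hτ : χ τ = -1) (he : Nonempty ((signTwist χ ρ).Equiv ρ)) :
    ∃ W : Fin 2 → Subrepresentation (ρ.comp i : Representation ℂ B V), IsSplitting _ W := by
  obtain ⟨e⟩ := he
  have hB : ∀ b, χ (i b) = 1 := fun b => (hi _).2 ⟨b, rfl⟩
  obtain ⟨v₀, hv₀⟩ := @exists_ne V (IsIrreducible.nontrivial hρ) 0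
  have he1 : ∀ s, χ s = 1 → ∀ v, e (ρ s v) = ρ s (e v) := by
    intro s hs v
    rw [← equiv_map e, signTwist_pos hs]
  have he2 : ∀ s, χ s = -1 → ∀ v, e (ρ s v) = -ρ s (e v) := by
    intro s hs v
    rw [← equiv_map e, signTwist_neg hs, map_neg, neg_neg]
  obtain ⟨c, hc⟩ := schur_scalar hρ (e.toLinearMap ∘ₗ e.toLinearMap) (by
    intro s v
    change e (e (ρ s v)) = ρ s (e (e v))
    rcases Int.units_eq_one_or (χ s) with h | h
    · rw [he1 s h, he1 s h]
    · rw [he2 s h, map_neg, he2 s h, neg_neg])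
  replace hc : ∀ v, e (e v) = c • v := hc
  obtain ⟨d, hd⟩ := IsAlgClosed.exists_pow_nat_eq c (n := 2) (by norm_num)
  have hinj : Function.Injective e := e.injective
  have hc0 : c ≠ 0 := by
    rintro rfl
    have := hc v₀
    rw [zero_smul, ← map_zero e] at this
    have h2 := hinj this
    rw [← map_zero e] at h2
    exact hv₀ (hinj h2)
  have hd0 : d ≠ 0 := by rintro rfl; exact hc0 (by rw [← hd]; simp)
  let T : V →ₗ[ℂ] V := d⁻¹ • e.toLinearMap
  have hTv : ∀ v, T v = d⁻¹ • e v := fun _ => rfl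
  have hTT : ∀ v, T (T v) = v := by
    intro v
    rw [hTv, hTv, map_smul, hc, smul_smul, smul_smul, ← hd]
    have : d⁻¹ * d⁻¹ * d ^ 2 = 1 := by field_simp
    rw [this, one_smul]
  have hT1 : ∀ s, χ s = 1 → ∀ v, T (ρ s v) = ρ s (T v) := by
    intro s hs v; rw [hTv, he1 s hs, hTv, map_smul]
  have hT2 : ∀ s, χ s = -1 → ∀ v, T (ρ s v) = -ρ s (T v) := by
    intro s hs v; rw [hTv, he2 s hs, hTv, map_smul, smul_neg]
  let E : ℂ → Submodule ℂ V := fun a => Module.End.eigenspace T a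
  have hE : ∀ a v, v ∈ E a ↔ T v = a • v := fun a v => Module.End.mem_eigenspace_iff
  have hEB : ∀ a b, ∀ v ∈ E a, ρ (i b) v ∈ E a := by
    intro a b v hv
    rw [hE] at hv ⊢
    rw [hT1 _ (hB b), hv, map_smul]
  have hEτ : ∀ a, ∀ v ∈ E a, ρ τ v ∈ E (-a) := by
    intro a v hv
    rw [hE] at hv ⊢
    rw [hT2 _ hτ, hv, map_smul, neg_smul]
  have hdisj : ∀ a : ℂ, a ≠ 0 → E a ⊓ E (-a) = ⊥ := by
    intro a ha
    rw [eq_bot_iff]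
    rintro v ⟨h1, h2⟩
    rw [SetLike.mem_coe, hE] at h1 h2
    rw [h1, neg_smul, ← sub_eq_zero, sub_neg_eq_add, ← two_smul ℂ, smul_smul] at h2
    simpa [ha] using h2
  have hcod : ∀ a : ℂ, a ^ 2 = 1 → E a ⊔ E (-a) = ⊤ := by
    intro a ha
    rw [eq_top_iff]
    intro v _
    have hv : v = (1 / 2 : ℂ) • (v + a • T v) + (1 / 2 : ℂ) • (v - a • T v) := by
      rw [← smul_add, add_add_sub_cancel, ← two_smul ℂ, smul_smul]; norm_num
    have haa : a * a = 1 := by rw [← sq, ha]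
    rw [hv]
    refine Submodule.add_mem_sup (Submodule.smul_mem _ _ ?_) (Submodule.smul_mem _ _ ?_)
    · rw [hE, map_add, map_smul, hTT, smul_add, smul_smul, haa, one_smul, add_comm]
    · rw [hE, map_sub, map_smul, hTT, smul_sub, smul_smul, neg_mul, haa, neg_smul, neg_smul,
        one_smul]
      abel
  have hbot : ∀ a : ℂ, a ^ 2 = 1 → E a ≠ ⊥ := by
    intro a ha h
    have htop := hcod a ha
    rw [h, bot_sup_eq] at htop
    have h1 := hEτ (-a) v₀ (htop ▸ Submodule.mem_top)
    rw [neg_neg, h, Submodule.mem_bot] at h1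
    apply hv₀
    have : ρ τ⁻¹ (ρ τ v₀) = v₀ := by
      rw [← Module.End.mul_apply, ← map_mul, inv_mul_cancel, map_one, Module.End.one_apply]
    rw [← this, h1, map_zero]
  have hirr : ∀ a : ℂ, a ^ 2 = 1 →
      (⟨E a, fun b v hv => hEB a b v hv⟩ : Subrepresentation
        (ρ.comp i : Representation ℂ B V)).toRepresentation.IsIrreducible := by
    intro a ha
    have ha0 : a ≠ 0 := by rintro rfl; norm_num at ha
    rw [isIrreducible_iff]
    refine ⟨(Submodule.nontrivial_iff_ne_bot).2 (hbot a ha), fun Z hZ => ?_⟩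
    by_cases hZ0 : Z = ⊥
    · exact Or.inl hZ0
    right
    let Z' : Submodule ℂ V := Z.map (E a).subtype
    have hZ'le : Z' ≤ E a := by rintro _ ⟨z, -, rfl⟩; exact z.2
    have hcompl := isCompl_translate χ i hi hρ hτ (Y := Z')
      (by rintro b _ ⟨z, hz, rfl⟩; exact ⟨_, hZ b z hz, rfl⟩)
      (by
        intro h
        apply hZ0
        rw [eq_bot_iff]
        intro z hz
        have : (z : V) ∈ Z' := ⟨z, hz, rfl⟩
        rw [h] at this
        exact Subtype.val_injective this)
      (by
        intro h
        apply hbot (-a) (by simpa using ha)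
        have h2 := hdisj a ha0
        rw [h, top_le_iff] at hZ'le
        rwa [hZ'le, top_inf_eq] at h2)
    rw [eq_top_iff]
    rintro ⟨y, hy⟩ -
    obtain ⟨z, hz, _, ⟨w, hw, rfl⟩, hzw⟩ :=
      Submodule.mem_sup.1 (hcompl.sup_eq_top ▸ Submodule.mem_top : y ∈ Z' ⊔ Z'.map (ρ τ))
    have h1 : ρ τ w ∈ E a ⊓ E (-a) :=
      ⟨by rw [← add_sub_cancel_left z (ρ τ w), hzw]; exact (E a).sub_mem hy (hZ'le hz),
        hEτ a w (hZ'le hw)⟩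
    rw [hdisj a ha0, Submodule.mem_bot] at h1
    rw [h1, add_zero] at hzw
    subst hzw
    obtain ⟨z', hz', hzz⟩ := hz
    have : z' = ⟨z, hy⟩ := Subtype.ext hzz
    rwa [this] at hz'
  have hcompl : IsCompl (E 1) (E (-1)) :=
    ⟨disjoint_iff.2 (hdisj 1 one_ne_zero), codisjoint_iff.2 (hcod 1 (by norm_num))⟩
  refine ⟨![⟨E 1, fun b v hv => hEB 1 b v hv⟩, ⟨E (-1), fun b v hv => hEB (-1) b v hv⟩], ?_, ?_, ?_⟩
  · intro κ
    fin_cases κ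
    · exact hirr 1 (by norm_num)
    · exact hirr (-1) (by norm_num)
  · exact ⟨disjoint_iff.2 (Subrepresentation.toSubmodule_injective hcompl.inf_eq_bot),
      codisjoint_iff.2 (Subrepresentation.toSubmodule_injective hcompl.sup_eq_top)⟩
  · refine ⟨fun f => ?_⟩
    -- an equivalence `E 1 → E (-1)`, extended by zero and averaged, would commute with `S`
    replace f : (⟨E 1, fun b v hv => hEB 1 b v hv⟩ : Subrepresentation
        (ρ.comp i : Representation ℂ B V)).toRepresentation.Equiv
        (⟨E (-1), fun b v hv => hEB (-1) b v hv⟩ : Subrepresentation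
        (ρ.comp i : Representation ℂ B V)).toRepresentation := f
    let F : V →ₗ[ℂ] V := LinearMap.ofIsCompl hcompl ((E (-1)).subtype ∘ₗ f.toLinearMap) 0
    have hF1 : ∀ v (hv : v ∈ E 1), F v = (f ⟨v, hv⟩ : E (-1)) := fun v hv =>
      LinearMap.ofIsCompl_apply_left hcompl ⟨v, hv⟩
    have hF2 : ∀ v, v ∈ E (-1) → F v = 0 := fun v hv =>
      LinearMap.ofIsCompl_apply_right hcompl ⟨v, hv⟩
    have hFB : ∀ b v, F (ρ (i b) v) = ρ (i b) (F v) := by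
      intro b v
      obtain ⟨x, hx, y, hy, rfl⟩ :=
        Submodule.mem_sup.1 (hcompl.sup_eq_top ▸ Submodule.mem_top : v ∈ E 1 ⊔ E (-1))
      rw [map_add, map_add, map_add, hF1 x hx, hF2 y hy, hF1 _ (hEB 1 b x hx),
        hF2 _ (hEB (-1) b y hy), add_zero, add_zero]
      exact congrArg Subtype.val (equiv_map f b ⟨x, hx⟩)
    obtain ⟨F', hF', heven, hodd⟩ := exists_conjugate χ i hi (ρ := ρ) (ρ' := ρ) hτ F hFB
    obtain ⟨c, hcF⟩ := schur_scalar hρ (F + F') (by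
      intro s v
      change F (ρ s v) + F' (ρ s v) = ρ s (F v + F' v)
      rcases Int.units_eq_one_or (χ s) with h | h
      · rw [(heven s h v).1, (heven s h v).2, map_add]
      · rw [(hodd s h v).1, (hodd s h v).2, map_add, add_comm])
    obtain ⟨y, hy, hy0⟩ := (Submodule.ne_bot_iff (E 1)).1 (hbot 1 (by norm_num))
    have h1 : F y + F' y = c • y := hcF y
    rw [hF', hF2 _ (hEτ 1 y hy), map_zero, add_zero, hF1 y hy] at h1
    have h2 : ((f ⟨y, hy⟩ : E (-1)) : V) ∈ E 1 ⊓ E (-1) :=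
      ⟨h1 ▸ (E 1).smul_mem c hy, (f ⟨y, hy⟩ : E (-1)).2⟩
    rw [hdisj 1 one_ne_zero, Submodule.mem_bot] at h2
    have h3 : f ⟨y, hy⟩ = f 0 := by rw [map_zero]; exact Subtype.ext h2
    exact hy0 (congrArg Subtype.val (f.injective h3))

end IndexTwo

/-! ### Dominance order and tableaux -/

section Tableaux

/-- The number of cells of `μ` in its first `i` rows. -/
def cellsAbove (μ : YoungDiagram) (i : ℕ) : ℕ := (μ.cells.filter fun c => c.1 < i).card

theorem eq_of_cellsAbove_eq {μ ν : YoungDiagram} (h : ∀ i, cellsAbove μ i = cellsAbove ν i) :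
    μ = ν := by
  have key : ∀ (μ : YoungDiagram) i, cellsAbove μ (i + 1) = cellsAbove μ i + μ.rowLen i := by
    intro μ i
    rw [YoungDiagram.rowLen_eq_card, YoungDiagram.row, cellsAbove, cellsAbove,
      ← Finset.card_union_of_disjoint]
    · congr 1
      ext c
      simp only [Finset.mem_filter, Finset.mem_union]
      constructor
      · rintro ⟨h1, h2⟩
        rcases Nat.lt_succ_iff_lt_or_eq.1 h2 with h | h
        · exact Or.inl ⟨h1, h⟩
        · exact Or.inr ⟨h1, h⟩
      · rintro (⟨h1, h2⟩ | ⟨h1, h2⟩)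
        · exact ⟨h1, by omega⟩
        · exact ⟨h1, by omega⟩
    · rw [Finset.disjoint_filter]
      intro c _ h1 h2
      omega
  ext ⟨i, j⟩
  rw [YoungDiagram.mem_cells, YoungDiagram.mem_cells, YoungDiagram.mem_iff_lt_rowLen,
    YoungDiagram.mem_iff_lt_rowLen]
  have h1 := key μ i
  have h2 := key ν i
  rw [h, h] at h1
  omega

variable {μ ν : YoungDiagram} (φ : μ.cells ≃ ν.cells)
  (hφ : ∀ x y : μ.cells, x.1.1 = y.1.1 → (φ x).1.2 = (φ y).1.2 → x = y)

theorem card_column_above (ν : YoungDiagram) (i j : ℕ) :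
    ((ν.cells.filter fun c => c.1 < i).filter fun c => c.2 = j).card = min i (ν.colLen j) := by
  rw [← Finset.card_range (min i (ν.colLen j)),
    ← Finset.card_image_of_injective (Finset.range (min i (ν.colLen j)))
      (f := fun r => (r, j)) (fun a b h => (Prod.ext_iff.1 h).1)]
  congr 1
  ext ⟨r, s⟩
  simp only [Finset.mem_filter, Finset.mem_image, Finset.mem_range, Prod.mk.injEq, lt_min_iff,
    YoungDiagram.mem_cells]
  constructor
  · rintro ⟨⟨h1, h2⟩, rfl⟩
    exact ⟨r, ⟨h2, YoungDiagram.mem_iff_lt_colLen.1 h1⟩, rfl, rfl⟩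
  · rintro ⟨r, ⟨h1, h2⟩, rfl, rfl⟩
    exact ⟨⟨YoungDiagram.mem_iff_lt_colLen.2 h2, h1⟩, rfl⟩

theorem card_column (φ : μ.cells ≃ ν.cells) (j : ℕ) :
    (Finset.univ.filter fun x : μ.cells => (φ x).1.2 = j).card = ν.colLen j := by
  rw [YoungDiagram.colLen_eq_card, YoungDiagram.col]
  refine Finset.card_bij (fun x _ => (φ x).1) ?_ ?_ ?_
  · intro x hx
    simp only [Finset.mem_filter, Finset.mem_univ, true_and] at hx
    exact Finset.mem_filter.2 ⟨(φ x).2, hx⟩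
  · intro x _ y _ h
    exact φ.injective (Subtype.ext h)
  · intro c hc
    rw [Finset.mem_filter] at hc
    exact ⟨φ.symm ⟨c, hc.1⟩, by simp [hc.2], by simp⟩

include hφ in
theorem card_above_column_le (i j : ℕ) :
    ((Finset.univ.filter fun x : μ.cells => x.1.1 < i).filter fun x => (φ x).1.2 = j).card ≤
      min i (ν.colLen j) := by
  apply le_min
  · refine (Finset.card_le_card_of_injOn (t := Finset.range i) (fun x => x.1.1) ?_ ?_).trans
      (Finset.card_range i).le
    · intro x hx
      simp only [Finset.coe_filter, Finset.mem_filter, Finset.mem_univ, true_and,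
        Set.mem_ofPred_eq] at hx
      exact Finset.mem_coe.2 (Finset.mem_range.2 hx.1)
    · intro x hx y hy h
      simp only [Finset.coe_filter, Finset.mem_filter, Finset.mem_univ, true_and,
        Set.mem_ofPred_eq] at hx hy
      exact hφ x y h (hx.2.trans hy.2.symm)
  · rw [← card_column φ]
    refine Finset.card_le_card fun x hx => ?_
    simp only [Finset.mem_filter, Finset.mem_univ, true_and] at hx ⊢
    exact hx.2

theorem card_above_univ (μ : YoungDiagram) (i : ℕ) :
    (Finset.univ.filter fun x : μ.cells => x.1.1 < i).card = cellsAbove μ i := by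
  refine Finset.card_bij (fun x _ => x.1) ?_ ?_ ?_
  · intro x hx
    simp only [Finset.mem_filter, Finset.mem_univ, true_and] at hx
    exact Finset.mem_filter.2 ⟨x.2, hx⟩
  · intro x _ y _ h
    exact Subtype.ext h
  · intro c hc
    rw [Finset.mem_filter] at hc
    exact ⟨⟨c, hc.1⟩, by simp [hc.2], rfl⟩

theorem col_lt (c : ν.cells) : c.1.2 < ν.rowLen 0 := by
  have := YoungDiagram.mem_iff_lt_rowLen.1 ((YoungDiagram.mem_cells _).1 c.2)
  exact this.trans_le (YoungDiagram.rowLen_anti _ _ _ (Nat.zero_le _))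

theorem cellsAbove_eq_sum_fiber (φ : μ.cells ≃ ν.cells) (i : ℕ) :
    cellsAbove μ i = ∑ j ∈ Finset.range (ν.rowLen 0),
      ((Finset.univ.filter fun x : μ.cells => x.1.1 < i).filter fun x => (φ x).1.2 = j).card := by
  rw [← card_above_univ]
  exact Finset.card_eq_sum_card_fiberwise fun x _ =>
    Finset.mem_coe.2 (Finset.mem_range.2 (col_lt (φ x)))

theorem cellsAbove_eq_sum (i : ℕ) :
    cellsAbove ν i = ∑ j ∈ Finset.range (ν.rowLen 0), min i (ν.colLen j) := by
  simp only [← card_column_above]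
  exact Finset.card_eq_sum_card_fiberwise fun c hc =>
    Finset.mem_coe.2 (Finset.mem_range.2 (col_lt ⟨c, (Finset.mem_filter.1 hc).1⟩))

include hφ in
/-- If two cells in the same row of `μ` never lie in the same column of `ν`, then `ν` dominates
`μ`. -/
theorem cellsAbove_le (i : ℕ) : cellsAbove μ i ≤ cellsAbove ν i := by
  rw [cellsAbove_eq_sum_fiber φ, cellsAbove_eq_sum]
  exact Finset.sum_le_sum fun j _ => card_above_column_le φ hφ i j

/-- If two cells in the same row of `μ` never lie in the same column of the tableau `φ` of shape
`μ`, then the row of a cell `x` meets the column of `φ x` inside of `μ`. -/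
theorem row_col_mem (φ : μ.cells ≃ μ.cells)
    (hφ : ∀ x y : μ.cells, x.1.1 = y.1.1 → (φ x).1.2 = (φ y).1.2 → x = y) (x : μ.cells) :
    (x.1.1, (φ x).1.2) ∈ μ.cells := by
  by_contra hx
  rw [YoungDiagram.mem_cells, YoungDiagram.mem_iff_lt_colLen, not_lt] at hx
  have hsum := (cellsAbove_eq_sum_fiber φ x.1.1).symm.trans (cellsAbove_eq_sum x.1.1)
  have hj := (Finset.sum_eq_sum_iff_of_le fun j _ => card_above_column_le φ hφ x.1.1 j).1 hsum
    (φ x).1.2 (Finset.mem_range.2 (col_lt (φ x)))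
  rw [min_eq_right hx, ← card_column φ] at hj
  have hsub : (Finset.univ.filter fun y : μ.cells => y.1.1 < x.1.1).filter
      (fun y => (φ y).1.2 = (φ x).1.2) = Finset.univ.filter fun y => (φ y).1.2 = (φ x).1.2 := by
    refine Finset.eq_of_subset_of_card_le (fun y hy => ?_) hj.ge
    exact Finset.mem_filter.2 ⟨Finset.mem_univ _, (Finset.mem_filter.1 hy).2⟩
  have hmem : x ∈ Finset.univ.filter fun y => (φ y).1.2 = (φ x).1.2 := by simp
  rw [← hsub] at hmem
  simp at hmem

/-- A permutation `g` such that cells in the same row never lie in the same column of the tableau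
`g⁻¹` is the product of a row permutation and of a column permutation. -/
theorem exists_row_mul_col (g : Equiv.Perm μ.cells)
    (hg : ∀ x y : μ.cells, x.1.1 = y.1.1 → (g⁻¹ x).1.2 = (g⁻¹ y).1.2 → x = y) :
    ∃ p ∈ rowGroup μ, ∃ q ∈ colGroup μ, g = p * q := by
  let s : μ.cells → μ.cells := fun x => ⟨(x.1.1, (g⁻¹ x).1.2), row_col_mem g⁻¹ hg x⟩
  have hs : Function.Injective s := by
    intro x y h
    have h' := Prod.ext_iff.1 (Subtype.ext_iff.1 h)
    exact hg x y h'.1 h'.2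
  let S : Equiv.Perm μ.cells := Equiv.ofBijective s (Finite.injective_iff_bijective.1 hs)
  have hS : ∀ x, S x = s x := fun _ => rfl
  refine ⟨S⁻¹, (rowGroup μ).inv_mem fun x => rfl, S * g, fun x => ?_, by simp⟩
  rw [Equiv.Perm.mul_apply, hS]
  simp [s]

end Tableaux

/-! ### Signed sums over subgroups -/

section SubgroupSum

variable {G : Type*} [Group G] [Finite G]

/-- The element `∑_{h ∈ H} χ(h) h` of the group algebra. -/
def subgroupSum (H : Subgroup G) (χ : G →* ℤˣ) : MonoidAlgebra ℂ G :=
  letI := Fintype.ofFinite H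
  ∑ h : H, MonoidAlgebra.single (h : G) (((χ h : ℤˣ) : ℤ) : ℂ)

theorem units_cast_mul_self (u : ℤˣ) : (((u : ℤ) : ℂ)) * ((u : ℤ) : ℂ) = 1 := by
  rw [← Int.cast_mul, ← Units.val_mul, Int.units_mul_self]; simp

theorem single_mul_subgroupSum {H : Subgroup G} (χ : G →* ℤˣ) {g : G} (hg : g ∈ H) :
    MonoidAlgebra.single g 1 * subgroupSum H χ = (((χ g : ℤˣ) : ℤ) : ℂ) • subgroupSum H χ := by
  let _ := Fintype.ofFinite H
  rw [subgroupSum, Finset.mul_sum, Finset.smul_sum]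
  refine Fintype.sum_bijective (fun h => ⟨g, hg⟩ * h) (Group.mulLeft_bijective _) _ _ fun h => ?_
  rw [MonoidAlgebra.single_mul_single, MonoidAlgebra.smul_single, one_mul, smul_eq_mul]
  simp only [Subgroup.coe_mul, map_mul, Units.val_mul, Int.cast_mul]
  rw [← mul_assoc, units_cast_mul_self, one_mul]

theorem subgroupSum_mul_single {H : Subgroup G} (χ : G →* ℤˣ) {g : G} (hg : g ∈ H) :
    subgroupSum H χ * MonoidAlgebra.single g 1 = (((χ g : ℤˣ) : ℤ) : ℂ) • subgroupSum H χ := by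
  let _ := Fintype.ofFinite H
  rw [subgroupSum, Finset.sum_mul, Finset.smul_sum]
  refine Fintype.sum_bijective (fun h => h * ⟨g, hg⟩) (Group.mulRight_bijective _) _ _ fun h => ?_
  rw [MonoidAlgebra.single_mul_single, MonoidAlgebra.smul_single, mul_one, smul_eq_mul]
  simp only [Subgroup.coe_mul, map_mul, Units.val_mul, Int.cast_mul]
  rw [mul_comm, mul_assoc, units_cast_mul_self, mul_one]

theorem subgroupSum_mul_self (H : Subgroup G) (χ : G →* ℤˣ) :
    subgroupSum H χ * subgroupSum H χ = (Nat.card H : ℂ) • subgroupSum H χ := by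
  let _ := Fintype.ofFinite H
  conv_lhs => enter [1]; rw [subgroupSum]
  rw [Finset.sum_mul]
  have : ∀ h : H, MonoidAlgebra.single (h : G) (((χ h : ℤˣ) : ℤ) : ℂ) * subgroupSum H χ =
      subgroupSum H χ := by
    intro h
    rw [show MonoidAlgebra.single (h : G) (((χ h : ℤˣ) : ℤ) : ℂ) =
      (((χ h : ℤˣ) : ℤ) : ℂ) • MonoidAlgebra.single (h : G) 1 by
        rw [MonoidAlgebra.smul_single, smul_eq_mul, mul_one], smul_mul_assoc,
      single_mul_subgroupSum χ h.2, smul_smul, units_cast_mul_self, one_smul]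
  simp only [this, Finset.sum_const, Finset.card_univ, Nat.card_eq_fintype_card]
  rw [Nat.cast_smul_eq_nsmul]

/-- The coefficient at the identity. -/
def coeffOne : MonoidAlgebra ℂ G →ₗ[ℂ] ℂ :=
  Finsupp.lapply 1 ∘ₗ (MonoidAlgebra.coeffLinearEquiv ℂ).toLinearMap

omit [Finite G] in
theorem coeffOne_single [DecidableEq G] (g : G) (r : ℂ) :
    coeffOne (MonoidAlgebra.single g r) = if g = 1 then r else 0 := by
  simp [coeffOne, Finsupp.single_apply]

omit [Finite G] in
theorem coeffOne_mul_comm (x y : MonoidAlgebra ℂ G) : coeffOne (x * y) = coeffOne (y * x) := by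
  classical
  induction x using MonoidAlgebra.induction_linear with
  | zero => simp
  | add x x' hx hx' => rw [add_mul, mul_add, map_add, map_add, hx, hx']
  | single g a =>
    induction y using MonoidAlgebra.induction_linear with
    | zero => simp
    | add x x' hx hx' => rw [add_mul, mul_add, map_add, map_add, hx, hx']
    | single h b =>
      rw [MonoidAlgebra.single_mul_single, MonoidAlgebra.single_mul_single, coeffOne_single,
        coeffOne_single, mul_comm a b]
      have : g * h = 1 ↔ h * g = 1 := by
        rw [mul_eq_one_iff_eq_inv, mul_eq_one_iff_inv_eq, eq_comm]
      simp only [this]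

/-- If `H` and `K` only share the identity then so do the products `h k`. -/
theorem coeffOne_mul (H K : Subgroup G) (χ ψ : G →* ℤˣ) (hHK : H ⊓ K = ⊥) :
    coeffOne (subgroupSum H χ * subgroupSum K ψ) = 1 := by
  classical
  let _ := Fintype.ofFinite H
  let _ := Fintype.ofFinite K
  rw [subgroupSum, subgroupSum, Finset.sum_mul, map_sum, Finset.sum_eq_single 1]
  · rw [Finset.mul_sum, map_sum, Finset.sum_eq_single 1]
    · rw [MonoidAlgebra.single_mul_single, coeffOne_single]
      simp
    · intro k _ hk
      rw [MonoidAlgebra.single_mul_single, coeffOne_single, if_neg]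
      simpa using hk
    · simp
  · intro h _ hh
    rw [Finset.mul_sum, map_sum]
    refine Finset.sum_eq_zero fun k _ => ?_
    rw [MonoidAlgebra.single_mul_single, coeffOne_single, if_neg]
    intro hk
    apply hh
    have h1 : (h : G) ∈ H ⊓ K := ⟨h.2, by rw [mul_eq_one_iff_eq_inv.1 hk]; exact K.inv_mem k.2⟩
    rw [hHK, Subgroup.mem_bot] at h1
    exact Subtype.ext h1
  · simp

end SubgroupSum

/-! ### Irreducibility of the Specht modules -/

section Specht

theorem youngSymmetrizer_eq (μ : YoungDiagram) : youngSymmetrizer μ =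
    subgroupSum (rowGroup μ) 1 * subgroupSum (colGroup μ) Equiv.Perm.sign := by
  rw [youngSymmetrizer, subgroupSum, subgroupSum]
  congr 1
  · refine Finset.sum_congr (by ext; simp) fun p _ => by simp
  · refine Finset.sum_congr (by ext; simp) fun p _ => rfl

theorem rowGroup_inf_colGroup (μ : YoungDiagram) : rowGroup μ ⊓ colGroup μ = ⊥ := by
  rw [eq_bot_iff]
  rintro p ⟨h1, h2⟩
  rw [Subgroup.mem_bot]
  ext x
  · exact h1 x
  · exact h2 x

theorem swap_mem_rowGroup {μ : YoungDiagram} {x y : μ.cells} (h : x.1.1 = y.1.1) :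
    Equiv.swap x y ∈ rowGroup μ := by
  intro z
  by_cases hx : z = x
  · subst hx; rw [Equiv.swap_apply_left, h]
  · by_cases hy : z = y
    · subst hy; rw [Equiv.swap_apply_right, h]
    · rw [Equiv.swap_apply_of_ne_of_ne hx hy]

theorem swap_mem_colGroup {μ : YoungDiagram} {x y : μ.cells} (h : x.1.2 = y.1.2) :
    Equiv.swap x y ∈ colGroup μ := by
  intro z
  by_cases hx : z = x
  · subst hx; rw [Equiv.swap_apply_left, h]
  · by_cases hy : z = y
    · subst hy; rw [Equiv.swap_apply_right, h]
    · rw [Equiv.swap_apply_of_ne_of_ne hx hy]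

variable {μ ν : YoungDiagram}

/-- The isomorphism of group algebras attached to a bijection of the sets of cells. -/
def cellsAlgHom (φ : μ.cells ≃ ν.cells) :
    MonoidAlgebra ℂ (Equiv.Perm μ.cells) →ₐ[ℂ] MonoidAlgebra ℂ (Equiv.Perm ν.cells) :=
  MonoidAlgebra.mapDomainAlgHom ℂ ℂ φ.permCongrHom.toMonoidHom

theorem cellsAlgHom_single (φ : μ.cells ≃ ν.cells) (g : Equiv.Perm μ.cells) (r : ℂ) :
    cellsAlgHom φ (MonoidAlgebra.single g r) = MonoidAlgebra.single (φ.permCongr g) r := by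
  simp [cellsAlgHom]

/-- If two cells in the same row of `μ` lie in the same column of the tableau `g⁻¹ φ` of shape `ν`,
then the row symmetrizer of `μ` and the column antisymmetrizer of `ν` cancel around `g`. -/
theorem row_mul_single_mul_col (φ : μ.cells ≃ ν.cells) (g : Equiv.Perm ν.cells) {x y : μ.cells}
    (hxy : x ≠ y) (h1 : x.1.1 = y.1.1) (h2 : (g⁻¹ (φ x)).1.2 = (g⁻¹ (φ y)).1.2) :
    cellsAlgHom φ (subgroupSum (rowGroup μ) 1) * MonoidAlgebra.single g 1 *
      subgroupSum (colGroup ν) Equiv.Perm.sign = 0 := by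
  set a := cellsAlgHom φ (subgroupSum (rowGroup μ) 1) with ha
  set b := subgroupSum (colGroup ν) Equiv.Perm.sign with hb
  have e1 : a * MonoidAlgebra.single (Equiv.swap (φ x) (φ y)) 1 = a := by
    have := congrArg (cellsAlgHom φ)
      (subgroupSum_mul_single (H := rowGroup μ) 1 (swap_mem_rowGroup h1))
    rw [map_mul, cellsAlgHom_single] at this
    simpa [Equiv.permCongr_def, Equiv.symm_trans_swap_trans] using this
  have e2 : MonoidAlgebra.single (Equiv.swap (g⁻¹ (φ x)) (g⁻¹ (φ y))) 1 * b = -b := by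
    rw [hb, single_mul_subgroupSum _ (swap_mem_colGroup h2), Equiv.Perm.sign_swap]
    · simp
    · simpa using hxy
  have e3 : Equiv.swap (φ x) (φ y) * g = g * Equiv.swap (g⁻¹ (φ x)) (g⁻¹ (φ y)) := by
    rw [Equiv.mul_swap_eq_swap_mul]; simp
  have : a * MonoidAlgebra.single g 1 * b = -(a * MonoidAlgebra.single g 1 * b) := by
    conv_lhs => rw [← e1]
    rw [mul_assoc a, MonoidAlgebra.single_mul_single, e3, one_mul, ← mul_one (1 : ℂ),
      ← MonoidAlgebra.single_mul_single, ← mul_assoc, mul_assoc, mul_one, e2, mul_neg]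
  have h2 : ∀ z : MonoidAlgebra ℂ (Equiv.Perm ν.cells), z = -z → z = 0 := by
    intro z hz
    calc z = (1 / 2 : ℂ) • (z + z) := by rw [← two_smul ℂ, smul_smul]; norm_num
      _ = 0 := by nth_rewrite 1 [hz]; rw [neg_add_cancel, smul_zero]
  exact h2 _ this

theorem exists_smul_row_mul_single_mul_col (g : Equiv.Perm μ.cells) :
    ∃ r : ℂ, subgroupSum (rowGroup μ) 1 * MonoidAlgebra.single g 1 *
      subgroupSum (colGroup μ) Equiv.Perm.sign = r • youngSymmetrizer μ := by
  by_cases hg : ∀ x y : μ.cells, x.1.1 = y.1.1 → (g⁻¹ x).1.2 = (g⁻¹ y).1.2 → x = y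
  · obtain ⟨p, hp, q, hq, rfl⟩ := exists_row_mul_col g hg
    refine ⟨((Equiv.Perm.sign q : ℤˣ) : ℤ), ?_⟩
    rw [← mul_one (1 : ℂ), ← MonoidAlgebra.single_mul_single, ← mul_assoc,
      subgroupSum_mul_single 1 hp, mul_assoc, single_mul_subgroupSum _ hq, youngSymmetrizer_eq]
    simp
  · push Not at hg
    obtain ⟨x, y, h1, h2, h3⟩ := hg
    refine ⟨0, ?_⟩
    have := row_mul_single_mul_col (Equiv.refl _) g h3 h1 h2
    have e : cellsAlgHom (Equiv.refl μ.cells) (subgroupSum (rowGroup μ) 1) =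
        subgroupSum (rowGroup μ) 1 := by
      have h : (Equiv.refl μ.cells).permCongrHom.toMonoidHom = MonoidHom.id _ := by
        ext g x : 2; rfl
      rw [cellsAlgHom, h]
      exact DFunLike.congr_fun MonoidAlgebra.mapDomainAlgHom_id _
    rw [e] at this
    rw [this, zero_smul]

/-- The Young symmetrizer is a multiple of a primitive idempotent. -/
theorem exists_smul_youngSymmetrizer (x : MonoidAlgebra ℂ (Equiv.Perm μ.cells)) :
    ∃ r : ℂ, youngSymmetrizer μ * x * youngSymmetrizer μ = r • youngSymmetrizer μ := by
  have key : ∀ y : MonoidAlgebra ℂ (Equiv.Perm μ.cells),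
      ∃ r : ℂ, subgroupSum (rowGroup μ) 1 * y * subgroupSum (colGroup μ) Equiv.Perm.sign =
        r • youngSymmetrizer μ := by
    intro y
    induction y using MonoidAlgebra.induction_linear with
    | zero => exact ⟨0, by simp⟩
    | add y z hy hz =>
      obtain ⟨r, hr⟩ := hy
      obtain ⟨s, hs⟩ := hz
      exact ⟨r + s, by rw [mul_add, add_mul, hr, hs, add_smul]⟩
    | single g a =>
      obtain ⟨r, hr⟩ := exists_smul_row_mul_single_mul_col g
      refine ⟨a * r, ?_⟩
      rw [show MonoidAlgebra.single g a = a • MonoidAlgebra.single g (1 : ℂ) by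
        rw [MonoidAlgebra.smul_single, smul_eq_mul, mul_one], mul_smul_comm, smul_mul_assoc, hr,
        smul_smul]
  obtain ⟨r, hr⟩ := key (subgroupSum (colGroup μ) Equiv.Perm.sign * x * subgroupSum (rowGroup μ) 1)
  refine ⟨r, ?_⟩
  rw [← hr, youngSymmetrizer_eq]
  simp only [mul_assoc]

theorem youngSymmetrizer_ne_zero : youngSymmetrizer μ ≠ 0 := by
  intro h
  have := coeffOne_mul (rowGroup μ) (colGroup μ) 1 Equiv.Perm.sign (rowGroup_inf_colGroup μ)
  rw [← youngSymmetrizer_eq, h, map_zero] at this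
  exact zero_ne_one this

/-- An element of a semisimple ring is von Neumann regular. -/
theorem exists_mul_mul_self {A : Type*} [Ring A] [IsSemisimpleRing A] (c : A) :
    ∃ y, c * y * c = c := by
  obtain ⟨J, hJ⟩ := exists_isCompl (Ideal.span {c} : Ideal A)
  obtain ⟨e, he, f, hf, hef⟩ :=
    Submodule.mem_sup.1 (hJ.sup_eq_top ▸ Submodule.mem_top : (1 : A) ∈ Ideal.span {c} ⊔ J)
  obtain ⟨y, rfl⟩ := Ideal.mem_span_singleton'.1 he
  refine ⟨y, ?_⟩
  have h1 : c * f ∈ Ideal.span {c} ⊓ J := by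
    refine ⟨?_, J.mul_mem_left c hf⟩
    have : c * f = (1 - c * y) * c := by
      rw [eq_sub_of_add_eq' hef]; noncomm_ring
    rw [this]
    exact Ideal.mul_mem_left _ _ (Ideal.mem_span_singleton_self c)
  rw [hJ.inf_eq_bot, Submodule.mem_bot] at h1
  calc c * y * c = c * (y * c + f) - c * f := by noncomm_ring
    _ = c := by rw [hef, h1, mul_one, sub_zero]

theorem specht_asAlgebraHom (e : MonoidAlgebra ℂ (Equiv.Perm μ.cells)) (x : SpechtModule μ) :
    ((specht μ).asAlgebraHom e x : MonoidAlgebra ℂ (Equiv.Perm μ.cells)) = e * x.1 := by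
  induction e using MonoidAlgebra.induction_linear with
  | zero => simp
  | add y z hy hz => rw [map_add, LinearMap.add_apply, Submodule.coe_add, hy, hz, add_mul]
  | single g a =>
    rw [asAlgebraHom_single, LinearMap.smul_apply]
    change a • (MonoidAlgebra.single g 1 * x.1) = _
    rw [← smul_mul_assoc, MonoidAlgebra.smul_single, smul_eq_mul, mul_one]

/-- The Young symmetrizer as an element of the Specht module. -/
def spechtGen (μ : YoungDiagram) : SpechtModule μ :=
  ⟨youngSymmetrizer μ, Ideal.mem_span_singleton_self _⟩

theorem youngSymmetrizer_apply (x : SpechtModule μ) :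
    ∃ r : ℂ, (specht μ).asAlgebraHom (youngSymmetrizer μ) x = r • spechtGen μ := by
  obtain ⟨y, hy⟩ := Ideal.mem_span_singleton'.1 x.2
  obtain ⟨r, hr⟩ := exists_smul_youngSymmetrizer (μ := μ) y
  refine ⟨r, Subtype.ext ?_⟩
  rw [specht_asAlgebraHom, ← hy, ← mul_assoc, hr]
  rfl

theorem youngSymmetrizer_apply_ne_zero :
    ∃ x, (specht μ).asAlgebraHom (youngSymmetrizer μ) x ≠ 0 := by
  have : NeZero (Nat.card (Equiv.Perm μ.cells) : ℂ) := ⟨by exact_mod_cast Nat.card_pos.ne'⟩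
  obtain ⟨y, hy⟩ := exists_mul_mul_self (youngSymmetrizer μ)
  refine ⟨⟨y * youngSymmetrizer μ, Ideal.mul_mem_left _ _ (Ideal.mem_span_singleton_self _)⟩, ?_⟩
  intro h
  have h' := congrArg Subtype.val h
  rw [specht_asAlgebraHom, ← mul_assoc, hy] at h'
  exact youngSymmetrizer_ne_zero h'

theorem spechtGen_cyclic (Y : Submodule ℂ (SpechtModule μ))
    (hY : ∀ g, ∀ v ∈ Y, specht μ g v ∈ Y) (h : spechtGen μ ∈ Y) : Y = ⊤ := by
  rw [eq_top_iff]
  intro x _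
  obtain ⟨y, hy⟩ := Ideal.mem_span_singleton'.1 x.2
  have : x = (specht μ).asAlgebraHom y (spechtGen μ) :=
    Subtype.ext (by rw [specht_asAlgebraHom, ← hy]; rfl)
  rw [this]
  exact asAlgebraHom_mem _ Y hY y h

theorem specht_isIrreducible (μ : YoungDiagram) : (specht μ).IsIrreducible :=
  isIrreducible_of_rank_one _ (youngSymmetrizer μ) (spechtGen μ) youngSymmetrizer_apply
    youngSymmetrizer_apply_ne_zero spechtGen_cyclic

/-- Unless `ν` dominates `μ`, the Young symmetrizer of `μ` acts as zero on the Specht module of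
`ν`. -/
theorem youngSymmetrizer_apply_eq_zero (φ : μ.cells ≃ ν.cells) {i : ℕ}
    (h : cellsAbove ν i < cellsAbove μ i) (x : SpechtModule ν) :
    (specht ν).asAlgebraHom (cellsAlgHom φ (youngSymmetrizer μ)) x = 0 := by
  have key : ∀ y : MonoidAlgebra ℂ (Equiv.Perm ν.cells),
      cellsAlgHom φ (subgroupSum (rowGroup μ) 1) * y *
        subgroupSum (colGroup ν) Equiv.Perm.sign = 0 := by
    intro y
    induction y using MonoidAlgebra.induction_linear with
    | zero => simp
    | add y z hy hz => rw [mul_add, add_mul, hy, hz, add_zero]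
    | single g a =>
      have : ¬ ∀ x y : μ.cells, x.1.1 = y.1.1 →
          ((φ.trans g⁻¹) x).1.2 = ((φ.trans g⁻¹) y).1.2 → x = y := fun hg =>
        absurd (cellsAbove_le _ hg i) (not_le.2 h)
      push Not at this
      obtain ⟨x, y, h1, h2, h3⟩ := this
      rw [show MonoidAlgebra.single g a = a • MonoidAlgebra.single g (1 : ℂ) by
        rw [MonoidAlgebra.smul_single, smul_eq_mul, mul_one], mul_smul_comm, smul_mul_assoc,
        row_mul_single_mul_col φ g h3 h1 h2, smul_zero]
  obtain ⟨y, hy⟩ := Ideal.mem_span_singleton'.1 x.2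
  apply Subtype.ext
  rw [specht_asAlgebraHom, ← hy]
  change _ = (0 : MonoidAlgebra ℂ (Equiv.Perm ν.cells))
  rw [youngSymmetrizer_eq, youngSymmetrizer_eq, map_mul]
  simp only [← mul_assoc]
  rw [mul_assoc _ _ y, mul_assoc _ _ (subgroupSum (rowGroup ν) 1)]
  exact key _

/-- For different diagrams of the same size, one of the Young symmetrizers acts as zero on the
Specht module of the other diagram. -/
theorem exists_cellsAbove_lt (h : μ ≠ ν) :
    ∃ i, cellsAbove ν i < cellsAbove μ i ∨ cellsAbove μ i < cellsAbove ν i := by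
  by_contra hcon
  push Not at hcon
  exact h (eq_of_cellsAbove_eq fun i => le_antisymm (hcon i).1 (hcon i).2)

end Specht

/-! ### Sign twist and transposition -/

section Twist

theorem IsIrreducible.exists_asAlgebraHom {G : Type*} [Group G] {V : Type*} [AddCommGroup V]
    [Module ℂ V] {ρ : Representation ℂ G V} (hρ : ρ.IsIrreducible) {v : V} (hv : v ≠ 0) (u : V) :
    ∃ x, ρ.asAlgebraHom x v = u := by
  let Y : Submodule ℂ V := LinearMap.range
    ((LinearMap.applyₗ v).comp ρ.asAlgebraHom.toLinearMap)
  have hY : Y = ⊤ := by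
    refine IsIrreducible.eq_top hρ Y ?_ (v := v) ⟨1, by simp⟩ hv
    rintro g _ ⟨x, rfl⟩
    exact ⟨MonoidAlgebra.single g 1 * x, by simp⟩
  exact (hY ▸ Submodule.mem_top : u ∈ Y)

/-- Let `e` be such that `e x e` is always a multiple of `e`. There is at most one irreducible
representation on which `e` does not vanish. -/
theorem nonempty_equiv_of_rank_one {G : Type*} [Group G] {V W : Type*} [AddCommGroup V]
    [Module ℂ V] [AddCommGroup W] [Module ℂ W] {ρ : Representation ℂ G V}
    {σ : Representation ℂ G W} (hρ : ρ.IsIrreducible) (hσ : σ.IsIrreducible)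
    (e : MonoidAlgebra ℂ G) (he : ∀ x, ∃ r : ℂ, e * x * e = r • e)
    (h1 : ∃ v, ρ.asAlgebraHom e v ≠ 0) (h2 : ∃ w, σ.asAlgebraHom e w ≠ 0) :
    Nonempty (ρ.Equiv σ) := by
  obtain ⟨v, hv⟩ := h1
  obtain ⟨w, hw⟩ := h2
  set v₀ := ρ.asAlgebraHom e v with hv₀
  set w₀ := σ.asAlgebraHom e w with hw₀
  -- elements killing `v₀` kill `w₀`, so that `x v₀ ↦ x w₀` is well defined
  have hker : ∀ x, ρ.asAlgebraHom x v₀ = 0 → σ.asAlgebraHom x w₀ = 0 := by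
    intro x hx
    by_contra hne
    obtain ⟨y, hy⟩ := IsIrreducible.exists_asAlgebraHom hσ hne w
    obtain ⟨r, hr⟩ := he (y * x)
    have h3 : r = 0 := by
      have := congrArg (fun z => ρ.asAlgebraHom z v) hr
      simp only [map_mul, Module.End.mul_apply, map_smul, LinearMap.smul_apply, ← hv₀, hx,
        map_zero] at this
      exact (smul_eq_zero.1 this.symm).resolve_right hv
    have := congrArg (fun z => σ.asAlgebraHom z w) hr
    simp only [map_mul, Module.End.mul_apply, ← hw₀, hy, h3, zero_smul, map_zero,
      LinearMap.zero_apply] at this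
    exact hw this
  choose x hx using IsIrreducible.exists_asAlgebraHom hρ hv
  have hx' : ∀ y, σ.asAlgebraHom (x (ρ.asAlgebraHom y v₀)) w₀ = σ.asAlgebraHom y w₀ := by
    intro y
    have := hker (x (ρ.asAlgebraHom y v₀) - y) (by
      rw [map_sub, LinearMap.sub_apply, hx, sub_self])
    rwa [map_sub, LinearMap.sub_apply, sub_eq_zero] at this
  let f : V →ₗ[ℂ] W :=
    { toFun := fun u => σ.asAlgebraHom (x u) w₀
      map_add' := fun u u' => by
        have := hx' (x u + x u')
        rwa [map_add, LinearMap.add_apply, hx, hx, map_add, LinearMap.add_apply] at this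
      map_smul' := fun c u => by
        have := hx' (c • x u)
        rwa [map_smul, LinearMap.smul_apply, hx, map_smul, LinearMap.smul_apply] at this }
  refine nonempty_equiv_of_ne_zero hρ hσ ⟨f, fun g => LinearMap.ext fun u => ?_⟩ ?_
  · have := hx' (MonoidAlgebra.single g 1 * x u)
    rw [map_mul, Module.End.mul_apply, hx, map_mul, Module.End.mul_apply,
      asAlgebraHom_single_one, asAlgebraHom_single_one] at this
    exact this
  · intro h
    have h4 : f v₀ = 0 := DFunLike.congr_fun h v₀
    have h5 := hx' 1
    rw [map_one, map_one, Module.End.one_apply, Module.End.one_apply] at h5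
    exact hw (h5.symm.trans h4)

theorem cellsAlgHom_subgroupSum {μ ν : YoungDiagram} (φ : μ.cells ≃ ν.cells)
    {H : Subgroup (Equiv.Perm μ.cells)} {K : Subgroup (Equiv.Perm ν.cells)}
    {χ : Equiv.Perm μ.cells →* ℤˣ} {ψ : Equiv.Perm ν.cells →* ℤˣ}
    (hH : ∀ g, φ.permCongr g ∈ K ↔ g ∈ H) (hχ : ∀ g, ψ (φ.permCongr g) = χ g) :
    cellsAlgHom φ (subgroupSum H χ) = subgroupSum K ψ := by
  let _ := Fintype.ofFinite H
  let _ := Fintype.ofFinite K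
  rw [subgroupSum, subgroupSum, map_sum]
  refine Fintype.sum_equiv (φ.permCongr.subtypeEquiv fun g => (hH g).symm) _ _ fun h => ?_
  rw [cellsAlgHom_single, ← hχ]
  rfl

/-- The transposition of cells. -/
def transposeCells (μ : YoungDiagram) : μ.transpose.cells ≃ μ.cells :=
  (Equiv.prodComm ℕ ℕ).subtypeEquiv fun c => by
    simp [YoungDiagram.mem_transpose, Equiv.prodComm_apply]

theorem signTwist_asAlgebraHom {G : Type*} [Group G] {V : Type*} [AddCommGroup V] [Module ℂ V]
    [Finite G] (χ ψ : G →* ℤˣ) (ρ : Representation ℂ G V) (H : Subgroup G) :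
    (signTwist χ ρ).asAlgebraHom (subgroupSum H ψ) = ρ.asAlgebraHom (subgroupSum H (χ * ψ)) := by
  simp only [subgroupSum, map_sum, asAlgebraHom_single]
  refine Finset.sum_congr rfl fun h _ => ?_
  ext v
  rw [LinearMap.smul_apply, signTwist_apply, LinearMap.smul_apply, smul_smul]
  simp only [MonoidHom.mul_apply, Units.val_mul, Int.cast_mul]
  rw [mul_comm]

theorem asAlgebraHom_comp_permCongr {μ ν : YoungDiagram} (φ : μ.cells ≃ ν.cells) {V : Type*}
    [AddCommGroup V] [Module ℂ V] (ρ : Representation ℂ (Equiv.Perm ν.cells) V)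
    (e : MonoidAlgebra ℂ (Equiv.Perm μ.cells)) :
    asAlgebraHom (ρ.comp φ.permCongrHom.toMonoidHom : Representation ℂ (Equiv.Perm μ.cells) V) e =
      ρ.asAlgebraHom (cellsAlgHom φ e) := by
  induction e using MonoidAlgebra.induction_linear with
  | zero => simp
  | add y z hy hz => rw [map_add, hy, hz, map_add, map_add]
  | single g a =>
    rw [asAlgebraHom_single, cellsAlgHom_single, asAlgebraHom_single]
    rfl

/-- Representations pulled back along different bijections are equivalent. -/
theorem nonempty_equiv_permCongr {α β : Type*} {V : Type*} [AddCommGroup V]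
    [Module ℂ V] (ρ : Representation ℂ (Equiv.Perm β) V) (T T' : α ≃ β) :
    Nonempty (Representation.Equiv (ρ.comp T.permCongrHom.toMonoidHom)
      (ρ.comp T'.permCongrHom.toMonoidHom)) := by
  let h : Equiv.Perm β := T.symm.trans T'
  refine ⟨Representation.Equiv.mk (LinearEquiv.ofLinearMap (ρ h) (ρ h⁻¹) ?_ ?_) fun g => ?_⟩
  · rw [← Module.End.mul_eq_comp, ← map_mul, mul_inv_cancel, map_one]; rfl
  · rw [← Module.End.mul_eq_comp, ← map_mul, inv_mul_cancel, map_one]; rfl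
  · change ρ h * ρ (T.permCongr g) = ρ (T'.permCongr g) * ρ h
    rw [← map_mul, ← map_mul]
    congr 1
    ext x
    simp [h]

theorem comp_isIrreducible {G H V : Type*} [Group G] [Group H] [AddCommGroup V]
    [Module ℂ V] {ρ : Representation ℂ G V} (hρ : ρ.IsIrreducible) (f : H →* G)
    (hf : Function.Surjective f) :
    Representation.IsIrreducible (ρ.comp f : Representation ℂ H V) := by
  rw [isIrreducible_iff] at hρ ⊢
  refine ⟨hρ.1, fun Y hY => hρ.2 Y fun g v hv => ?_⟩
  obtain ⟨h, rfl⟩ := hf g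
  exact hY h v hv

/-- The sign twist of the Specht module of `μ` is the Specht module of the transposed diagram: the
Young symmetrizer of the transposed diagram acts on the twist of the Specht module of `μ`, generated
by `ab`, as `ba`, and `ba · ab` does not vanish. -/
theorem specht_signTwist {α : Type*} [DecidableEq α] [Fintype α] {μ : YoungDiagram}
    (T : α ≃ μ.cells) (T' : α ≃ μ.transpose.cells) :
    Nonempty (Representation.Equiv
      (signTwist Equiv.Perm.sign ((specht μ).comp T.permCongrHom.toMonoidHom))
      ((specht μ.transpose).comp T'.permCongrHom.toMonoidHom)) := by
  let φ := transposeCells μ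
  set a := subgroupSum (rowGroup μ) 1 with ha
  set b := subgroupSum (colGroup μ) Equiv.Perm.sign with hb
  have hrow : ∀ g, φ.permCongr g ∈ colGroup μ ↔ g ∈ rowGroup μ.transpose := by
    intro g
    refine ⟨fun h x => ?_, fun h x => ?_⟩
    · have := h (φ x)
      rw [Equiv.permCongr_apply, Equiv.symm_apply_apply] at this
      exact this
    · have := h (φ.symm x)
      rw [Equiv.permCongr_apply]
      exact this
  have hcol : ∀ g, φ.permCongr g ∈ rowGroup μ ↔ g ∈ colGroup μ.transpose := by
    intro g
    refine ⟨fun h x => ?_, fun h x => ?_⟩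
    · have := h (φ x)
      rw [Equiv.permCongr_apply, Equiv.symm_apply_apply] at this
      exact this
    · have := h (φ.symm x)
      rw [Equiv.permCongr_apply]
      exact this
  have key : Nonempty (Representation.Equiv
      ((signTwist Equiv.Perm.sign (specht μ)).comp φ.permCongrHom.toMonoidHom)
      (specht μ.transpose)) := by
    refine nonempty_equiv_of_rank_one (comp_isIrreducible
      (IsIrreducible.signTwist (specht_isIrreducible μ)) _ φ.permCongrHom.surjective)
      (specht_isIrreducible _) (youngSymmetrizer μ.transpose)
      exists_smul_youngSymmetrizer ⟨spechtGen μ, ?_⟩ youngSymmetrizer_apply_ne_zero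
    rw [asAlgebraHom_comp_permCongr, youngSymmetrizer_eq μ.transpose, map_mul,
      cellsAlgHom_subgroupSum φ (K := colGroup μ) (ψ := 1) hrow (fun g => rfl),
      cellsAlgHom_subgroupSum φ (K := rowGroup μ) (ψ := Equiv.Perm.sign) hcol
        (fun g => Equiv.Perm.sign_permCongr φ g), map_mul, signTwist_asAlgebraHom,
      signTwist_asAlgebraHom, mul_one, ← hb]
    have hss : Equiv.Perm.sign * Equiv.Perm.sign = (1 : Equiv.Perm μ.cells →* ℤˣ) := by
      ext1 g; exact Int.units_mul_self _
    rw [hss, ← ha, ← map_mul]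
    intro h
    have h' := congrArg Subtype.val h
    rw [specht_asAlgebraHom] at h'
    change b * a * youngSymmetrizer μ = (0 : MonoidAlgebra ℂ (Equiv.Perm μ.cells)) at h'
    have h2 := congrArg coeffOne h'
    have haa : a * a = (Nat.card (rowGroup μ) : ℂ) • a := subgroupSum_mul_self _ _
    have hbb : b * b = (Nat.card (colGroup μ) : ℂ) • b := subgroupSum_mul_self _ _
    rw [youngSymmetrizer_eq, ← ha, ← hb, mul_assoc, ← mul_assoc a, haa, smul_mul_assoc,
      mul_smul_comm, map_smul, coeffOne_mul_comm, mul_assoc, hbb, mul_smul_comm, map_smul, ha, hb,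
      coeffOne_mul _ _ _ _ (rowGroup_inf_colGroup μ), map_zero] at h2
    simp [Nat.card_pos.ne'] at h2
  obtain ⟨f⟩ := key
  obtain ⟨f'⟩ := nonempty_equiv_permCongr (specht μ) T (T'.trans φ)
  refine ⟨Representation.Equiv.mk (f'.toLinearEquiv.trans f.toLinearEquiv) fun g => ?_⟩
  ext1 x
  change f (f' (signTwist Equiv.Perm.sign ((specht μ).comp T.permCongrHom.toMonoidHom) g x)) =
    specht μ.transpose (T'.permCongr g) (f (f' x))
  have h1 : f' (specht μ (T.permCongr g) x) = specht μ ((T'.trans φ).permCongr g) (f' x) :=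
    equiv_map f' g x
  have h2 := equiv_map f (T'.permCongr g) (f' x)
  rw [← h2, signTwist_apply, map_smul]
  change f (_ • f' (specht μ (T.permCongr g) x)) =
    f (signTwist Equiv.Perm.sign (specht μ) (φ.permCongr (T'.permCongr g)) (f' x))
  rw [h1, signTwist_apply, Equiv.Perm.sign_permCongr, Equiv.Perm.sign_permCongr]
  rfl

end Twist

/-! ### Outer tensor products -/

section OuterTensor

variable {ι : Type*} [Fintype ι] {G : Type*} [Group G] {H : ι → Type*} [∀ a, Group (H a)]
  {V : ι → Type*} [∀ a, AddCommGroup (V a)] [∀ a, Module ℂ (V a)]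
  {V' : ι → Type*} [∀ a, AddCommGroup (V' a)] [∀ a, Module ℂ (V' a)]

/-- The outer tensor product of representations of the groups `H a`, for a group `G` with
projections to these groups. -/
def outerTensor (p : ∀ a, G →* H a) (ρ : ∀ a, Representation ℂ (H a) (V a)) :
    Representation ℂ G (⨂[ℂ] a, V a) :=
  PiTensorProduct.mapMonoidHom.comp (MonoidHom.pi fun a => (ρ a).comp (p a))

theorem outerTensor_tprod (p : ∀ a, G →* H a) (ρ : ∀ a, Representation ℂ (H a) (V a)) (g : G)
    (v : ∀ a, V a) : outerTensor p ρ g (PiTensorProduct.tprod ℂ v) =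
      PiTensorProduct.tprod ℂ fun a => ρ a (p a g) (v a) :=
  PiTensorProduct.map_tprod _ _

theorem tprod_ne_zero {v : ∀ a, V a} (hv : ∀ a, v a ≠ 0) : PiTensorProduct.tprod ℂ v ≠ 0 := by
  have : ∀ a, ∃ f : Module.Dual ℂ (V a), f (v a) = 1 := fun a =>
    Module.Projective.exists_dual_eq_one ℂ (hv a)
  choose f hf using this
  intro h
  have h1 := congrArg (PiTensorProduct.lift
    ((MultilinearMap.mkPiAlgebra ℂ ι ℂ).compLinearMap f)) h
  rw [PiTensorProduct.lift.tprod, map_zero] at h1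
  simp [hf] at h1

variable [∀ a, Finite (H a)] (p : ∀ a, G →* H a) (s : (∀ a, H a) → G)
  (hs : ∀ g a, p a (s g) = g a)

/-- The element of the group algebra of `G` acting on outer tensor products by the tensor product of
the actions of the `e a`; here `s` is a section of the projections. -/
def outerElement [DecidableEq ι] (s : (∀ a, H a) → G) (e : ∀ a, MonoidAlgebra ℂ (H a)) :
    MonoidAlgebra ℂ G :=
  letI := fun a => Fintype.ofFinite (H a)
  ∑ g : ∀ a, H a, MonoidAlgebra.single (s g) (∏ a, (e a).coeff (g a))

theorem asAlgebraHom_eq_sum {H V : Type*} [Group H] [Fintype H] [AddCommGroup V] [Module ℂ V]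
    (ρ : Representation ℂ H V) (e : MonoidAlgebra ℂ H) (v : V) :
    ρ.asAlgebraHom e v = ∑ h, e.coeff h • ρ h v := by
  classical
  induction e using MonoidAlgebra.induction_linear with
  | zero => simp
  | add x y hx hy => simp [hx, hy, add_smul, Finset.sum_add_distrib]
  | single g a =>
    rw [asAlgebraHom_single, LinearMap.smul_apply, Finset.sum_eq_single g]
    · simp
    · intro h _ hg
      simp [Ne.symm hg]
    · simp

include hs in
theorem outerTensor_outerElement [DecidableEq ι] (ρ : ∀ a, Representation ℂ (H a) (V a))
    (e : ∀ a, MonoidAlgebra ℂ (H a)) (v : ∀ a, V a) :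
    (outerTensor p ρ).asAlgebraHom (outerElement s e) (PiTensorProduct.tprod ℂ v) =
      PiTensorProduct.tprod ℂ fun a => (ρ a).asAlgebraHom (e a) (v a) := by
  let _ := fun a => Fintype.ofFinite (H a)
  simp only [asAlgebraHom_eq_sum]
  rw [MultilinearMap.map_sum, outerElement, map_sum, LinearMap.sum_apply]
  refine Finset.sum_congr rfl fun g _ => ?_
  rw [asAlgebraHom_single, LinearMap.smul_apply, outerTensor_tprod, MultilinearMap.map_smul_univ]
  simp only [hs]

include hs in
/-- The outer tensor product of irreducible representations is irreducible, provided that each factor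
has an element of the group algebra acting by a rank one operator. -/
theorem outerTensor_isIrreducible [Finite G] (ρ : ∀ a, Representation ℂ (H a) (V a))
    (hρ : ∀ a, (ρ a).IsIrreducible) (e : ∀ a, MonoidAlgebra ℂ (H a)) (w : ∀ a, V a)
    (h1 : ∀ a v, ∃ c : ℂ, (ρ a).asAlgebraHom (e a) v = c • w a)
    (h2 : ∀ a, ∃ v, (ρ a).asAlgebraHom (e a) v ≠ 0) : (outerTensor p ρ).IsIrreducible := by
  classical
  have hw : ∀ a, w a ≠ 0 := by
    intro a ha
    obtain ⟨v, hv⟩ := h2 a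
    obtain ⟨c, hc⟩ := h1 a v
    rw [hc, ha, smul_zero] at hv
    exact hv rfl
  refine isIrreducible_of_rank_one _ (outerElement s e) (PiTensorProduct.tprod ℂ w) ?_ ?_ ?_
  · intro v
    induction v using PiTensorProduct.induction_on with
    | smul_tprod r f =>
      choose c hc using fun a => h1 a (f a)
      refine ⟨r * ∏ a, c a, ?_⟩
      rw [map_smul, outerTensor_outerElement p s hs]
      simp only [hc]
      rw [MultilinearMap.map_smul_univ, smul_smul]
    | add x y hx hy =>
      obtain ⟨c, hc⟩ := hx
      obtain ⟨d, hd⟩ := hy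
      exact ⟨c + d, by rw [map_add, hc, hd, add_smul]⟩
  · choose v hv using h2
    refine ⟨PiTensorProduct.tprod ℂ v, ?_⟩
    rw [outerTensor_outerElement p s hs]
    exact tprod_ne_zero hv
  · intro Y hY hwY
    rw [eq_top_iff]
    intro v _
    induction v using PiTensorProduct.induction_on with
    | smul_tprod r f =>
      choose x hx using fun a => IsIrreducible.exists_asAlgebraHom (hρ a) (hw a) (f a)
      refine Y.smul_mem r ?_
      have := asAlgebraHom_mem _ Y hY (outerElement s x) hwY
      rw [outerTensor_outerElement p s hs] at this
      simpa only [hx] using this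
    | add x y hx hy => exact Y.add_mem (hx trivial) (hy trivial)

include hs in
/-- Equivalent outer tensor products have factors with the same annihilators. -/
theorem outerTensor_not_equiv {ρ : ∀ a, Representation ℂ (H a) (V a)}
    {ρ' : ∀ a, Representation ℂ (H a) (V' a)} (hV : ∀ a, Nontrivial (V a)) (b : ι)
    (x : MonoidAlgebra ℂ (H b)) (h1 : ∃ v, (ρ b).asAlgebraHom x v ≠ 0)
    (h2 : ∀ v, (ρ' b).asAlgebraHom x v = 0) :
    ¬ Nonempty ((outerTensor p ρ).Equiv (outerTensor p ρ')) := by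
  classical
  rintro ⟨f⟩
  let e : ∀ a, MonoidAlgebra ℂ (H a) := Function.update 1 b x
  obtain ⟨v, hv⟩ := h1
  choose u hu using fun a => @exists_ne (V a) (hV a) 0
  have hzero : ∀ z, (outerTensor p ρ').asAlgebraHom (outerElement s e) z = 0 := by
    intro z
    induction z using PiTensorProduct.induction_on with
    | smul_tprod r f =>
      rw [map_smul, outerTensor_outerElement p s hs,
        MultilinearMap.map_coord_zero _ b (by simp [e, h2]), smul_zero]
    | add x y hx hy => rw [map_add, hx, hy, add_zero]
  have := intertwining_asAlgebraHom f.toIntertwiningMap (outerElement s e)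
    (PiTensorProduct.tprod ℂ (Function.update u b v))
  rw [hzero, outerTensor_outerElement p s hs] at this
  have h3 := f.injective (this.trans (map_zero f).symm)
  refine tprod_ne_zero (fun a => ?_) h3
  by_cases hab : a = b
  · subst hab; simpa [e] using hv
  · simpa [e, hab] using hu a

omit [∀ a, Finite (H a)] in
/-- Sign twists of the factors multiply. -/
theorem outerTensor_signTwist (ρ : ∀ a, Representation ℂ (H a) (V a))
    (ρ' : ∀ a, Representation ℂ (H a) (V' a)) (χ : ∀ a, H a →* ℤˣ) (χ' : G →* ℤˣ)
    (hχ : ∀ g, χ' g = ∏ a, χ a (p a g))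
    (h : ∀ a, Nonempty ((signTwist (χ a) (ρ a)).Equiv (ρ' a))) :
    Nonempty ((signTwist χ' (outerTensor p ρ)).Equiv (outerTensor p ρ')) := by
  have f := fun a => (h a).some
  refine ⟨Representation.Equiv.mk (PiTensorProduct.congr fun a => (f a).toLinearEquiv) fun g => ?_⟩
  refine PiTensorProduct.ext (MultilinearMap.ext fun v => ?_)
  change PiTensorProduct.congr _ (signTwist χ' (outerTensor p ρ) g (PiTensorProduct.tprod ℂ v)) =
    outerTensor p ρ' g (PiTensorProduct.congr _ (PiTensorProduct.tprod ℂ v))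
  rw [signTwist_apply, outerTensor_tprod, PiTensorProduct.congr_tprod, outerTensor_tprod, hχ]
  have h1 : ∀ a, ρ' a (p a g) ((f a).toLinearEquiv (v a)) =
      ((χ a (p a g) : ℤ) : ℂ) • (f a).toLinearEquiv (ρ a (p a g) (v a)) := by
    intro a
    change ρ' a (p a g) (f a (v a)) = _ • f a (ρ a (p a g) (v a))
    rw [← equiv_map (f a), signTwist_apply, map_smul]
  simp only [h1]
  rw [MultilinearMap.map_smul_univ, map_smul, PiTensorProduct.congr_tprod]
  push_cast
  rfl

end OuterTensor

/-! ### Young subgroups -/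

section YoungSubgroup

variable {n m : ℕ} (blk : Fin n → Fin m)

/-- The permutations preserving each fibre of `blk`. -/
def youngSub : Subgroup (Equiv.Perm (Fin n)) where
  carrier := {σ | ∀ j, blk (σ j) = blk j}
  one_mem' := fun _ => rfl
  mul_mem' := fun {σ τ} hσ hτ j => (hσ (τ j)).trans (hτ j)
  inv_mem' := fun {σ} hσ j => by simpa using (hσ (σ⁻¹ j)).symm

/-- The projection of the Young subgroup to the symmetric group of a fibre. -/
def blkPerm (a : Fin m) : youngSub blk →* Equiv.Perm {j : Fin n // blk j = a} where
  toFun σ := σ.1.subtypePerm (fun j => by rw [σ.2 j])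
  map_one' := rfl
  map_mul' _ _ := rfl

/-- The permutation with prescribed restrictions to the fibres of `blk`. -/
def combinePerm : (∀ a, Equiv.Perm {j : Fin n // blk j = a}) →* youngSub blk :=
  (((Equiv.sigmaFiberEquiv blk).permCongrHom.toMonoidHom.comp
    (Equiv.Perm.sigmaCongrRightHom _))).codRestrict _ fun g j => (g (blk j) ⟨j, rfl⟩).2

theorem blkPerm_combinePerm (g : ∀ a, Equiv.Perm {j : Fin n // blk j = a}) (a : Fin m) :
    blkPerm blk a (combinePerm blk g) = g a := by
  ext ⟨j, rfl⟩
  rfl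

theorem blkPerm_ext {σ τ : youngSub blk} (h : ∀ a, blkPerm blk a σ = blkPerm blk a τ) : σ = τ := by
  ext j : 2
  exact congrArg Subtype.val (DFunLike.congr_fun (h (blk j)) ⟨j, rfl⟩)

theorem combinePerm_mulSingle (a : Fin m) (g : Equiv.Perm {j : Fin n // blk j = a}) :
    (combinePerm blk (Pi.mulSingle a g) : Equiv.Perm (Fin n)) = Equiv.Perm.ofSubtype g := by
  ext j : 1
  change (Pi.mulSingle (M := fun a => Equiv.Perm {j : Fin n // blk j = a}) a g (blk j)
    ⟨j, rfl⟩).1 = _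
  by_cases h : blk j = a
  · subst h
    rw [Pi.mulSingle_eq_same, Equiv.Perm.ofSubtype_apply_of_mem g (a := j) rfl]
  · rw [Pi.mulSingle_eq_of_ne h, Equiv.Perm.ofSubtype_apply_of_not_mem g h]
    rfl

/-- The sign of an element of a Young subgroup is the product of the signs of its restrictions. -/
theorem sign_eq_prod (σ : youngSub blk) :
    Equiv.Perm.sign (σ : Equiv.Perm (Fin n)) = ∏ a, Equiv.Perm.sign (blkPerm blk a σ) := by
  have key : (Equiv.Perm.sign.comp (youngSub blk).subtype).comp (combinePerm blk) =
      ∏ a, (Equiv.Perm.sign.comp (blkPerm blk a)).comp (combinePerm blk) := by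
    refine MonoidHom.ext fun x => Subgroup.pi_mem_of_mulSingle_mem (H := MonoidHom.eqLocus _ _) x
      fun a => ?_
    change MonoidHom.comp _ _ _ = (∏ a, _ : _ →* ℤˣ) _
    generalize x a = g
    rw [MonoidHom.finsetProd_apply]
    simp only [MonoidHom.comp_apply, Subgroup.coe_subtype, combinePerm_mulSingle,
      blkPerm_combinePerm, Equiv.Perm.sign_ofSubtype]
    rw [Finset.prod_eq_single a]
    · simp
    · intro b _ hb
      simp [Pi.mulSingle_eq_of_ne hb]
    · simp
  have h := DFunLike.congr_fun key fun a => blkPerm blk a σ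
  rw [MonoidHom.finsetProd_apply] at h
  have e : combinePerm blk (fun a => blkPerm blk a σ) = σ :=
    blkPerm_ext blk fun a => blkPerm_combinePerm ..
  simpa only [MonoidHom.comp_apply, e, Subgroup.coe_subtype] using h

/-- The list of the parts of a partition, in decreasing order. -/
def sortedParts {k : ℕ} (p : k.Partition) : List ℕ := p.parts.sort (· ≥ ·)

/-- The Young diagram with rows the parts of a partition. -/
def partitionDiagram {k : ℕ} (p : k.Partition) : YoungDiagram :=
  YoungDiagram.ofRowLens (sortedParts p) (Multiset.pairwise_sort _ _).sortedGE

theorem partitionDiagram_injective {k : ℕ} :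
    Function.Injective (partitionDiagram : k.Partition → YoungDiagram) := by
  intro p q h
  have key : ∀ p : k.Partition, (partitionDiagram p).rowLens = sortedParts p := fun p =>
    YoungDiagram.rowLens_ofRowLens_eq_self fun x hx =>
      p.parts_pos ((Multiset.mem_sort _).1 hx)
  have h1 := (key p).symm.trans ((congrArg _ h).trans (key q))
  refine Nat.Partition.ext ?_
  have := congrArg (fun l : List ℕ => (l : Multiset ℕ)) h1
  simpa [sortedParts] using this

theorem card_cellsOfRowLens (w : List ℕ) : (YoungDiagram.cellsOfRowLens w).card = w.sum := by
  induction w with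
  | nil => rfl
  | cons x w ih =>
    rw [YoungDiagram.cellsOfRowLens, Finset.card_union_of_disjoint, Finset.card_map, ih,
      Finset.card_product]
    · simp
    · rw [Finset.disjoint_left]
      rintro ⟨i, j⟩ h1 h2
      simp only [Finset.mem_product, Finset.mem_singleton] at h1
      simp only [Finset.mem_map] at h2
      obtain ⟨c, -, hc⟩ := h2
      have := congrArg Prod.fst hc
      simp [h1.1] at this

theorem card_partitionDiagram {k : ℕ} (p : k.Partition) : (partitionDiagram p).card = k := by
  refine (card_cellsOfRowLens _).trans ?_
  rw [← Multiset.sum_coe, sortedParts, Multiset.sort_eq, p.parts_sum]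

/-- The Young diagrams of the cycle types of the restrictions to the fibres. -/
def cycleDiagrams (σ : youngSub blk) (a : Fin m) : YoungDiagram :=
  partitionDiagram (blkPerm blk a σ).partition

theorem card_cycleDiagrams (σ : youngSub blk) (a : Fin m) :
    (cycleDiagrams blk σ a).card = Fintype.card {j // blk j = a} := card_partitionDiagram _

theorem cycleDiagrams_eq_iff (σ τ : youngSub blk) :
    cycleDiagrams blk σ = cycleDiagrams blk τ ↔ IsConj σ τ := by
  constructor
  · intro h
    have h1 : ∀ a, ∃ c, c * blkPerm blk a σ * c⁻¹ = blkPerm blk a τ := fun a =>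
      isConj_iff.1 (Equiv.Perm.partition_eq_of_isConj.2
        (partitionDiagram_injective (congrFun h a)))
    choose c hc using h1
    refine isConj_iff.2 ⟨combinePerm blk c, blkPerm_ext blk fun a => ?_⟩
    rw [map_mul, map_mul, map_inv, blkPerm_combinePerm, hc]
  · intro h
    funext a
    exact congrArg partitionDiagram
      (Equiv.Perm.partition_eq_of_isConj.1 ((blkPerm blk a).map_isConj h))

end YoungSubgroup

namespace MultiDiagram

variable {m₀ n : ℕ}

/-- The blocks of a family of Young diagrams only depend on the numbers of cells. -/
theorem block_eq_of_card {Λ Λ' : MultiDiagram m₀ n} (h : ∀ a, (Λ.1 a).card = (Λ'.1 a).card) :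
    Λ.block = Λ'.block := by
  have key : ∀ (c c' : Fin m₀ → ℕ) (hc : ∑ a, c a = n) (hc' : ∑ a, c' a = n), c = c' →
      ∀ j, ((finCongr hc.symm).trans finSigmaFinEquiv.symm j).1 =
        ((finCongr hc'.symm).trans finSigmaFinEquiv.symm j).1 := by
    rintro c _ _ _ rfl _
    rfl
  funext j
  exact key _ _ Λ.2 Λ'.2 (funext h) j

theorem card_block (Λ : MultiDiagram m₀ n) (a : Fin m₀) :
    Fintype.card {j // Λ.block j = a} = (Λ.1 a).card := by
  rw [Fintype.card_congr (Λ.tableau a)]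
  simp

theorem block_transpose (Λ : MultiDiagram m₀ n) : Λ.transpose.block = Λ.block :=
  block_eq_of_card fun _ => card_transpose _

theorem transpose_transpose (Λ : MultiDiagram m₀ n) : Λ.transpose.transpose = Λ :=
  Subtype.ext (funext fun _ => YoungDiagram.transpose_transpose _)

variable {blk : Fin n → Fin m₀} {Λ Λ' : MultiDiagram m₀ n}

theorem youngSubgroup_eq (h : Λ.block = blk) : youngSub blk = Λ.youngSubgroup := by
  subst h; rfl

/-- The representation `π_Λ`, as a representation of the Young subgroup of a given function `blk`. -/
def outerOn (h : Λ.block = blk) : Representation ℂ (youngSub blk) Λ.OuterModule :=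
  Λ.outer.comp (Subgroup.inclusion (youngSubgroup_eq h).le)

/-- The tableaux of `Λ`, as numberings of the cells by the fibres of a given function `blk`. -/
def tableauOn (h : Λ.block = blk) (a : Fin m₀) : {j // blk j = a} ≃ (Λ.1 a).cells :=
  (Equiv.subtypeEquivRight fun j => by rw [h]).trans (Λ.tableau a)

/-- The irreducible representation with diagram `Λ a` of the symmetric group of a fibre. -/
def factorOn (h : Λ.block = blk) (a : Fin m₀) :
    Representation ℂ (Equiv.Perm {j // blk j = a}) (SpechtModule (Λ.1 a)) :=
  (specht (Λ.1 a)).comp (tableauOn h a).permCongrHom.toMonoidHom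

theorem outerOn_eq (h : Λ.block = blk) : outerOn h = outerTensor (blkPerm blk) (factorOn h) := by
  subst h; rfl

/-- An element of the group algebra of `Perm μ.cells`, transported along a tableau. -/
def pullElement {α : Type*} {μ : YoungDiagram} (T : α ≃ μ.cells)
    (x : MonoidAlgebra ℂ (Equiv.Perm μ.cells)) : MonoidAlgebra ℂ (Equiv.Perm α) :=
  MonoidAlgebra.mapDomainAlgHom ℂ ℂ T.symm.permCongrHom.toMonoidHom x

theorem asAlgebraHom_pullElement {α : Type*} {μ ν : YoungDiagram} (T : α ≃ μ.cells)
    (T' : α ≃ ν.cells) {V : Type*} [AddCommGroup V] [Module ℂ V]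
    (ρ : Representation ℂ (Equiv.Perm ν.cells) V) (x : MonoidAlgebra ℂ (Equiv.Perm μ.cells)) :
    asAlgebraHom (ρ.comp T'.permCongrHom.toMonoidHom : Representation ℂ (Equiv.Perm α) V)
      (pullElement T x) = ρ.asAlgebraHom (cellsAlgHom (T.symm.trans T') x) := by
  induction x using MonoidAlgebra.induction_linear with
  | zero => simp [pullElement]
  | add x y hx hy =>
    simp only [pullElement, map_add] at hx hy ⊢
    rw [hx, hy]
  | single g a =>
    rw [cellsAlgHom_single, pullElement, MonoidAlgebra.mapDomainAlgHom_apply,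
      MonoidAlgebra.mapDomain_single, asAlgebraHom_single, asAlgebraHom_single]
    rfl

theorem asAlgebraHom_pullElement_self {α : Type*} {μ : YoungDiagram} (T : α ≃ μ.cells)
    {V : Type*} [AddCommGroup V] [Module ℂ V] (ρ : Representation ℂ (Equiv.Perm μ.cells) V)
    (x : MonoidAlgebra ℂ (Equiv.Perm μ.cells)) :
    asAlgebraHom (ρ.comp T.permCongrHom.toMonoidHom : Representation ℂ (Equiv.Perm α) V)
      (pullElement T x) = ρ.asAlgebraHom x := by
  rw [asAlgebraHom_pullElement, Equiv.symm_trans_self]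
  congr 1
  induction x using MonoidAlgebra.induction_linear with
  | zero => simp
  | add x y hx hy => rw [map_add, hx, hy]
  | single g a => rw [cellsAlgHom_single]; rfl

theorem factorOn_isIrreducible (h : Λ.block = blk) (a : Fin m₀) :
    (factorOn h a).IsIrreducible :=
  comp_isIrreducible (specht_isIrreducible _) _ (tableauOn h a).permCongrHom.surjective

theorem outerOn_isIrreducible (h : Λ.block = blk) : (outerOn h).IsIrreducible := by
  rw [outerOn_eq]
  refine outerTensor_isIrreducible _ (combinePerm blk) (blkPerm_combinePerm blk) _
    (factorOn_isIrreducible h) (fun a => pullElement (tableauOn h a) (youngSymmetrizer (Λ.1 a)))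
    (fun a => spechtGen (Λ.1 a)) (fun a v => ?_) (fun a => ?_)
  · rw [factorOn, asAlgebraHom_pullElement_self]
    exact youngSymmetrizer_apply v
  · obtain ⟨v, hv⟩ := youngSymmetrizer_apply_ne_zero (μ := Λ.1 a)
    exact ⟨v, by rwa [factorOn, asAlgebraHom_pullElement_self]⟩

theorem eq_of_outerOn_equiv (h : Λ.block = blk) (h' : Λ'.block = blk)
    (e : Nonempty ((outerOn h).Equiv (outerOn h'))) : Λ = Λ' := by
  have key : ∀ {Λ Λ' : MultiDiagram m₀ n} (h : Λ.block = blk) (h' : Λ'.block = blk)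
      (a : Fin m₀) (i : ℕ), cellsAbove (Λ'.1 a) i < cellsAbove (Λ.1 a) i →
      ¬ Nonempty ((outerOn h).Equiv (outerOn h')) := by
    intro Λ Λ' h h' a i hi
    rw [outerOn_eq, outerOn_eq]
    refine outerTensor_not_equiv _ (combinePerm blk) (blkPerm_combinePerm blk)
      (fun b => IsIrreducible.nontrivial (specht_isIrreducible (Λ.1 b))) a
      (pullElement (tableauOn h a) (youngSymmetrizer (Λ.1 a))) ?_ fun v => ?_
    · obtain ⟨v, hv⟩ := youngSymmetrizer_apply_ne_zero (μ := Λ.1 a)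
      exact ⟨v, by rwa [factorOn, asAlgebraHom_pullElement_self]⟩
    · rw [factorOn, asAlgebraHom_pullElement]
      exact youngSymmetrizer_apply_eq_zero _ hi v
  by_contra hne
  obtain ⟨a, ha⟩ := Function.ne_iff.1 fun h => hne (Subtype.ext h)
  obtain ⟨i, hi | hi⟩ := exists_cellsAbove_lt ha
  · exact key h h' a i hi e
  · exact key h' h a i hi ⟨e.some.symm⟩

/-- The sign character of a Young subgroup. -/
def youngSign (blk : Fin n → Fin m₀) : youngSub blk →* ℤˣ :=
  Equiv.Perm.sign.comp (youngSub blk).subtype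

/-- The sign twist transposes the diagrams. -/
theorem outerOn_signTwist (h : Λ.block = blk) : Nonempty ((signTwist (youngSign blk)
    (outerOn h)).Equiv (outerOn (Λ := Λ.transpose) ((block_transpose Λ).trans h))) := by
  rw [outerOn_eq, outerOn_eq]
  exact outerTensor_signTwist _ _ _ (fun _ => Equiv.Perm.sign) _ (sign_eq_prod blk)
    fun a => specht_signTwist _ _

/-- The representations `π_Λ` exhaust the irreducible representations of a Young subgroup. -/
theorem outerOn_isExhausting.{w} (hblk : ∃ Λ : MultiDiagram m₀ n, Λ.block = blk) :
    IsExhausting.{w} fun x : {Λ : MultiDiagram m₀ n // Λ.block = blk} => outerOn x.2 := by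
  obtain ⟨Λ₀, h₀⟩ := hblk
  have hcard : ∀ σ a, (cycleDiagrams blk σ a).card = (Λ₀.1 a).card := by
    intro σ a
    rw [card_cycleDiagrams, ← card_block]
    subst h₀; rfl
  refine isExhausting_of_conjClasses _ (fun x => outerOn_isIrreducible x.2)
    (fun x y e => Subtype.ext (eq_of_outerOn_equiv x.2 y.2 e))
    ⟨Quotient.lift (fun σ => ⟨⟨cycleDiagrams blk σ, ?_⟩, ?_⟩) ?_, ?_⟩
  · exact (Finset.sum_congr rfl fun a _ => hcard σ a).trans Λ₀.2
  · exact (block_eq_of_card (hcard σ)).trans h₀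
  · intro σ τ hστ
    simp only [Subtype.mk.injEq]
    exact (cycleDiagrams_eq_iff blk σ τ).2 hστ
  · intro c d
    induction c using Quotient.inductionOn with | _ σ
    induction d using Quotient.inductionOn with | _ τ
    intro h
    simp only [Quotient.lift_mk, Subtype.mk.injEq] at h
    exact Quotient.sound ((cycleDiagrams_eq_iff blk σ τ).1 h)

end MultiDiagram

/-! ### Restriction to the alternating group -/

theorem exists_retraction {G V : Type*} [Group G] [Finite G] [AddCommGroup V] [Module ℂ V]
    {ρ : Representation ℂ G V} (W : Subrepresentation ρ) :
    ∃ p : ρ.IntertwiningMap W.toRepresentation, ∀ w : W.toSubmodule, p w = w := by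
  obtain ⟨Z, hZ, hc⟩ := exists_stable_compl ρ W.toSubmodule fun g v hv => W.apply_mem_toSubmodule g hv
  let p : V →ₗ[ℂ] W.toSubmodule := LinearMap.ofIsCompl hc LinearMap.id 0
  have h1 : ∀ w : W.toSubmodule, p w = w := fun w => LinearMap.ofIsCompl_apply_left hc w
  have h2 : ∀ z ∈ Z, p z = 0 := fun z hz => LinearMap.ofIsCompl_apply_right hc ⟨z, hz⟩
  refine ⟨⟨p, fun g => LinearMap.ext fun v => ?_⟩, h1⟩
  obtain ⟨x, hx, y, hy, rfl⟩ :=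
    Submodule.mem_sup.1 (hc.sup_eq_top ▸ Submodule.mem_top : v ∈ W.toSubmodule ⊔ Z)
  change p (ρ g (x + y)) = W.toRepresentation g (p (x + y))
  rw [map_add, map_add, map_add, h2 _ (hZ g y hy), h2 y hy, h1 ⟨x, hx⟩, add_zero, add_zero]
  exact h1 (W.toRepresentation g ⟨x, hx⟩)

section AltSub

variable {n m : ℕ} (blk : Fin n → Fin m)

/-- The even permutations preserving each fibre of `blk`. -/
def altSub : Subgroup (Equiv.Perm (Fin n)) := alternatingGroup (Fin n) ⊓ youngSub blk

/-- The inclusion of the even part of a Young subgroup. -/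
def altIncl : altSub blk →* youngSub blk := Subgroup.inclusion inf_le_right

end AltSub

namespace MultiDiagram

variable {m₀ n : ℕ} {blk : Fin n → Fin m₀} {Λ Λ' : MultiDiagram m₀ n}

theorem youngSign_eq_one_iff (s : youngSub blk) :
    youngSign blk s = 1 ↔ ∃ b, altIncl blk b = s :=
  ⟨fun h => ⟨⟨s.1, h, s.2⟩, rfl⟩, by rintro ⟨b, rfl⟩; exact b.2.1⟩

theorem altYoung_eq (h : Λ.block = blk) : altSub blk = Λ.altYoung := by
  subst h; rfl

/-- The restriction of `π_Λ` to the even part of the Young subgroup of a given function `blk`. -/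
def outerAltOn (h : Λ.block = blk) : Representation ℂ (altSub blk) Λ.OuterModule :=
  Λ.outerAlt.comp (Subgroup.inclusion (altYoung_eq h).le)

/-- The constituents of the restriction of `π_Λ`, as representations of the even part of the Young
subgroup of a given function `blk`. -/
def constituentOn (h : Λ.block = blk) (κ : Fin 2) :
    Representation ℂ (altSub blk) (Λ.constituent κ).toSubmodule :=
  (Λ.constituent κ).toRepresentation.comp (Subgroup.inclusion (altYoung_eq h).le)

/-- Some interval of a family which is not quasi-trivial has two elements, hence the Young subgroup
contains a transposition. -/
theorem exists_youngSign_eq (hΛ : ¬ Λ.QuasiTrivial) (h : Λ.block = blk) :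
    ∃ τ, youngSign blk τ = -1 := by
  unfold QuasiTrivial at hΛ
  push Not at hΛ
  obtain ⟨a, ha⟩ := hΛ
  rw [← card_block, h] at ha
  obtain ⟨⟨x, hx⟩, ⟨y, hy⟩, hxy⟩ := Fintype.one_lt_card_iff.1 ha
  have hxy' : x ≠ y := fun e => hxy (Subtype.ext e)
  refine ⟨⟨Equiv.swap x y, fun j => ?_⟩, Equiv.Perm.sign_swap hxy'⟩
  by_cases h1 : j = x
  · subst h1; rw [Equiv.swap_apply_left, hx, hy]
  · by_cases h2 : j = y
    · subst h2; rw [Equiv.swap_apply_right, hx, hy]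
    · rw [Equiv.swap_apply_of_ne_of_ne h1 h2]

/-- A quasi-trivial family is determined by its numbers of cells. -/
theorem QuasiTrivial.eq_of_card (h : Λ.QuasiTrivial) (hc : ∀ a, (Λ.1 a).card = (Λ'.1 a).card) :
    Λ = Λ' := by
  have key : ∀ μ ν : YoungDiagram, μ.card ≤ 1 → μ.card = ν.card → μ ≤ ν := by
    intro μ ν hμ hμν c hc
    have h1 : ∀ μ : YoungDiagram, μ.card ≤ 1 → ∀ c ∈ μ.cells, c = (0, 0) := by
      intro μ hμ c hc
      have h0 : ((0, 0) : ℕ × ℕ) ∈ μ.cells :=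
        μ.isLowerSet (show ((0, 0) : ℕ × ℕ) ≤ c from ⟨Nat.zero_le _, Nat.zero_le _⟩) hc
      exact Finset.card_le_one.1 hμ c hc _ h0
    obtain ⟨d, hd⟩ := Finset.card_pos.1 ((Finset.card_pos.2 ⟨c, hc⟩).trans_eq hμν)
    rw [h1 μ hμ c hc, ← h1 ν (hμν ▸ hμ) d hd]
    exact hd
  exact Subtype.ext (funext fun a => le_antisymm (key _ _ (h a) (hc a))
    (key _ _ (hc a ▸ h a) (hc a).symm))

theorem quasiTrivial_transpose (h : Λ.QuasiTrivial) : Λ.transpose = Λ :=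
  (h.eq_of_card fun _ => (card_transpose _).symm).symm

/-- The restrictions of `π_Λ` and `π_Λ'` to the alternating group have no common constituent unless
`Λ'` is `Λ` or its transpose. -/
theorem eq_or_transpose_eq (hτ : ∃ τ, youngSign blk τ = -1) (h : Λ.block = blk)
    (h' : Λ'.block = blk) (f : (outerAltOn h).IntertwiningMap (outerAltOn h')) (hf : f ≠ 0) :
    Λ = Λ' ∨ Λ.transpose = Λ' := by
  obtain ⟨τ, hτ⟩ := hτ
  rcases equiv_or_equiv_signTwist (youngSign blk) (altIncl blk) youngSign_eq_one_iff
    (outerOn_isIrreducible h) (outerOn_isIrreducible h') hτ f.toLinearMap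
    (fun b v => f.isIntertwining _ _ b v) (fun e => hf (by ext v; exact LinearMap.congr_fun e v))
    with e | e
  · exact Or.inl (eq_of_outerOn_equiv h h' e)
  · obtain ⟨e'⟩ := outerOn_signTwist h
    exact Or.inr (eq_of_outerOn_equiv _ h' ⟨e'.symm.trans e.some⟩)

theorem outerAltOn_isIrreducible (hτ : ∃ τ, youngSign blk τ = -1) (h : Λ.block = blk)
    (hΛ : Λ.transpose ≠ Λ) : (outerAltOn h).IsIrreducible := by
  obtain ⟨τ, hτ⟩ := hτ
  refine isIrreducible_restrict (youngSign blk) (altIncl blk) youngSign_eq_one_iff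
    (outerOn_isIrreducible h) hτ fun ⟨e⟩ => hΛ ?_
  obtain ⟨e'⟩ := outerOn_signTwist h
  exact eq_of_outerOn_equiv _ h ⟨e'.symm.trans e⟩

/-- `Λ` and its transpose have equivalent restrictions to the alternating group. -/
theorem outerAltOn_transpose (h : Λ.block = blk) (h' : Λ.transpose.block = blk) :
    Nonempty ((outerAltOn h).Equiv (outerAltOn h')) := by
  obtain ⟨e⟩ := outerOn_signTwist h
  refine ⟨Representation.Equiv.mk e.toLinearEquiv fun b => LinearMap.ext fun v => ?_⟩
  have := equiv_map e (altIncl blk b) v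
  rw [signTwist_pos ((youngSign_eq_one_iff _).2 ⟨b, rfl⟩)] at this
  exact this

theorem constituent_isSplitting (hΛ : Λ.transpose = Λ) (hq : ¬ Λ.QuasiTrivial) :
    IsSplitting Λ.outerAlt Λ.constituent := by
  obtain ⟨τ, hτ⟩ := exists_youngSign_eq (blk := Λ.block) hq rfl
  have key : ∀ (Λ' : MultiDiagram m₀ n) (h' : Λ'.block = Λ.block), Λ' = Λ →
      Nonempty ((signTwist (youngSign Λ.block) (outerOn (Λ := Λ) rfl)).Equiv (outerOn h')) →
      Nonempty ((signTwist (youngSign Λ.block) (outerOn (Λ := Λ) rfl)).Equiv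
        (outerOn (Λ := Λ) rfl)) := by
    rintro _ _ rfl e
    exact e
  exact Classical.epsilon_spec (exists_isSplitting (youngSign Λ.block) (altIncl Λ.block)
    youngSign_eq_one_iff (outerOn_isIrreducible (Λ := Λ) rfl) hτ
    (key _ _ hΛ (outerOn_signTwist rfl)))

theorem constituentOn_isIrreducible (hs : IsSplitting Λ.outerAlt Λ.constituent)
    (h : Λ.block = blk) (κ : Fin 2) : (constituentOn h κ).IsIrreducible := by
  subst h
  exact hs.1 κ

/-- The inclusion of a constituent. -/
def constituentIncl (h : Λ.block = blk) (κ : Fin 2) :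
    (constituentOn h κ).IntertwiningMap (outerAltOn h) :=
  ⟨(Λ.constituent κ).toSubmodule.subtype, fun _ => rfl⟩

theorem exists_constituent_retraction (h : Λ.block = blk) (κ : Fin 2) :
    ∃ p : (outerAltOn h).IntertwiningMap (constituentOn h κ),
      ∀ w : (Λ.constituent κ).toSubmodule, p w = w := by
  subst h
  exact exists_retraction (Λ.constituent κ)

theorem constituentOn_equiv (hτ : ∃ τ, youngSign blk τ = -1) (h : Λ.block = blk)
    (h' : Λ'.block = blk) (hΛ : Λ.transpose = Λ) (hs : IsSplitting Λ.outerAlt Λ.constituent)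
    {κ κ' : Fin 2} (e : (constituentOn h κ).Equiv (constituentOn h' κ')) :
    Λ = Λ' ∧ κ = κ' := by
  obtain ⟨p, hp⟩ := exists_constituent_retraction h κ
  have hne : ((constituentIncl h' κ').comp (e.toIntertwiningMap.comp p)) ≠ 0 := by
    intro h0
    obtain ⟨w, hw⟩ := @exists_ne _ (IsIrreducible.nontrivial (constituentOn_isIrreducible hs h κ)) 0
    have h1 : ((e (p w) : (Λ'.constituent κ').toSubmodule) : Λ'.OuterModule) = 0 :=
      DFunLike.congr_fun h0 (w : Λ.OuterModule)
    rw [hp] at h1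
    exact hw (e.injective ((Subtype.ext h1).trans (map_zero e).symm))
  have hΛΛ : Λ = Λ' := by
    rcases eq_or_transpose_eq hτ h h' _ hne with h | h
    · exact h
    · rwa [hΛ] at h
  subst hΛΛ
  refine ⟨rfl, ?_⟩
  subst h
  by_contra hκ
  have h01 : IsEmpty ((constituentOn (Λ := Λ) rfl 0).Equiv (constituentOn (Λ := Λ) rfl 1)) :=
    hs.2.2
  match κ, κ' with
  | 0, 0 => exact hκ rfl
  | 1, 1 => exact hκ rfl
  | 0, 1 => exact h01.false e
  | 1, 0 => exact h01.false e.symm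

theorem outerAltOn_not_equiv_constituentOn (hτ : ∃ τ, youngSign blk τ = -1) (h : Λ.block = blk)
    (h' : Λ'.block = blk) (hΛ : Λ.transpose ≠ Λ) (hΛ' : Λ'.transpose = Λ') {κ : Fin 2} :
    ¬ Nonempty ((outerAltOn h).Equiv (constituentOn h' κ)) := by
  rintro ⟨e⟩
  have hne : (constituentIncl h' κ).comp e.toIntertwiningMap ≠ 0 := by
    intro h0
    obtain ⟨w, hw⟩ := @exists_ne _ (IsIrreducible.nontrivial (outerAltOn_isIrreducible hτ h hΛ)) 0
    have h1 : ((e w : (Λ'.constituent κ).toSubmodule) : Λ'.OuterModule) = 0 :=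
      DFunLike.congr_fun h0 w
    exact hw (e.injective ((Subtype.ext h1).trans (map_zero e).symm))
  rcases eq_or_transpose_eq hτ h h' _ hne with h | h
  · subst h; exact hΛ hΛ'
  · rw [← h, transpose_transpose] at hΛ'
    exact hΛ hΛ'.symm

/-- A nonzero map from the restriction of `π_Λ` is nonzero on one of its constituents. -/
theorem exists_constituentOn_ne_zero (hs : IsSplitting Λ.outerAlt Λ.constituent)
    (h : Λ.block = blk) {M : Type*} [AddCommGroup M] [Module ℂ M]
    {σ : Representation ℂ (altSub blk) M} (f : (outerAltOn h).IntertwiningMap σ) (hf : f ≠ 0) :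
    ∃ κ, f.comp (constituentIncl h κ) ≠ 0 := by
  by_contra hcon
  push Not at hcon
  apply hf
  have hz : ∀ κ, ∀ v ∈ (Λ.constituent κ).toSubmodule, f v = 0 := fun κ v hv =>
    DFunLike.congr_fun (hcon κ) (⟨v, hv⟩ : (Λ.constituent κ).toSubmodule)
  ext v
  have htop : (Λ.constituent 0).toSubmodule ⊔ (Λ.constituent 1).toSubmodule = ⊤ :=
    congrArg Subrepresentation.toSubmodule hs.2.1.sup_eq_top
  obtain ⟨x, hx, y, hy, rfl⟩ : ∃ x ∈ (Λ.constituent 0).toSubmodule,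
      ∃ y ∈ (Λ.constituent 1).toSubmodule, x + y = v :=
    Submodule.mem_sup.1 (htop ▸ Submodule.mem_top)
  change f (x + y) = 0
  rw [map_add, hz 0 x hx, hz 1 y hy, add_zero]

theorem outerAltOn_isExhausting.{w} (hblk : ∃ Λ : MultiDiagram m₀ n, Λ.block = blk) :
    IsExhausting.{w} fun x : {Λ : MultiDiagram m₀ n // Λ.block = blk} => outerAltOn x.2 :=
  IsExhausting.restrict (altIncl blk) (Subgroup.inclusion_injective _) (outerOn_isExhausting hblk)

end MultiDiagram

/-! ### Generators and relations -/

section Coxeter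

variable {G : Type*} [Group G]

/-- The coset representative `s_j s_{j+1} ⋯ s_{j+d-1}`. -/
def cosetRep (s : ℕ → G) : ℕ → ℕ → G
  | _, 0 => 1
  | j, d + 1 => s j * cosetRep s (j + 1) d

variable {s : ℕ → G} {N : ℕ} (h1 : ∀ i < N, s i * s i = 1)
  (h2 : ∀ i, i + 1 < N → s (i + 1) * s i * s (i + 1) = s i * s (i + 1) * s i)
  (h3 : ∀ i j, i + 2 ≤ j → j < N → s i * s j = s j * s i)

include h3 in
theorem cosetRep_comm {i j d : ℕ} (hij : i + 2 ≤ j) (hd : j + d ≤ N) :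
    s i * cosetRep s j d = cosetRep s j d * s i := by
  induction d generalizing j with
  | zero => simp [cosetRep]
  | succ d ih =>
    rw [cosetRep, ← mul_assoc, h3 i j hij (by omega), mul_assoc,
      ih (by omega) (by omega), mul_assoc]

include h2 h3 in
theorem cosetRep_shift {i j d : ℕ} (hij : j < i + 1) (hi : i + 1 < j + d) (hd : j + d ≤ N) :
    s (i + 1) * cosetRep s j d = cosetRep s j d * s i := by
  induction d generalizing j with
  | zero => omega
  | succ d ih =>
    rw [cosetRep]
    rcases Nat.lt_or_ge j i with h | h
    · rw [← mul_assoc, ← h3 j (i + 1) (by omega) (by omega), mul_assoc,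
        ih (by omega) (by omega) (by omega), mul_assoc]
    · obtain rfl : i = j := by omega
      obtain ⟨d, rfl⟩ : ∃ e, d = e + 1 := ⟨d - 1, by omega⟩
      rw [cosetRep, mul_assoc, mul_assoc, ← cosetRep_comm h3 le_rfl (by omega), ← mul_assoc,
        ← mul_assoc, h2 i (by omega)]
      simp only [mul_assoc]

include h1 h2 h3 in
/-- The elements `s_j ⋯ s_{m-1}` represent the left cosets of the group generated by the first
`m - 1` generators in the group generated by the first `m` ones. -/
theorem exists_cosetRep {m : ℕ} (hm : m + 1 ≤ N) {g : G}
    (hg : g ∈ Subgroup.closure (s '' {i | i < m + 1})) :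
    ∃ j d, j + d = m + 1 ∧ ∃ h ∈ Subgroup.closure (s '' {i | i < m}),
      g = cosetRep s j d * h := by
  have key : ∀ i < m + 1, ∀ y, (∃ j d, j + d = m + 1 ∧ ∃ h ∈ Subgroup.closure (s '' {i | i < m}),
      y = cosetRep s j d * h) → ∃ j d, j + d = m + 1 ∧
      ∃ h ∈ Subgroup.closure (s '' {i | i < m}), s i * y = cosetRep s j d * h := by
    rintro i hi _ ⟨j, d, hjd, h, hh, rfl⟩
    have hmem : ∀ i < m, s i ∈ Subgroup.closure (s '' {i | i < m}) := fun i hi =>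
      Subgroup.subset_closure ⟨i, hi, rfl⟩
    rcases lt_trichotomy i j with hij | rfl | hij
    · rcases Nat.lt_or_ge (i + 1) j with hij' | hij'
      · exact ⟨j, d, hjd, s i * h, Subgroup.mul_mem _ (hmem i (by omega)) hh, by
          rw [← mul_assoc, cosetRep_comm h3 hij' (by omega), mul_assoc]⟩
      · obtain rfl : i + 1 = j := by omega
        exact ⟨i, d + 1, by omega, h, hh, by rw [cosetRep, mul_assoc]⟩
    · obtain ⟨d, rfl⟩ : ∃ e, d = e + 1 := ⟨d - 1, by omega⟩
      exact ⟨i + 1, d, by omega, h, hh, by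
        rw [cosetRep, mul_assoc, ← mul_assoc, h1 i (by omega), one_mul]⟩
    · obtain ⟨i, rfl⟩ : ∃ e, i = e + 1 := ⟨i - 1, by omega⟩
      exact ⟨j, d, hjd, s i * h, Subgroup.mul_mem _ (hmem i (by omega)) hh, by
        rw [← mul_assoc, cosetRep_shift h2 h3 hij (by omega) (by omega), mul_assoc]⟩
  induction hg using Subgroup.closure_induction_left with
  | one => exact ⟨m + 1, 0, rfl, 1, Subgroup.one_mem _, by simp [cosetRep]⟩
  | mul_left x hx y _ ih =>
    obtain ⟨i, hi, rfl⟩ := hx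
    exact key i hi y ih
  | inv_mul_cancel x hx y _ ih =>
    obtain ⟨i, hi, rfl⟩ := hx
    have hi' : i < m + 1 := hi
    rw [inv_eq_of_mul_eq_one_left (h1 i (by omega))]
    exact key i hi y ih

include h1 h2 h3 in
/-- A homomorphism to a group of permutations, sending `s_i` to a permutation exchanging `p i` and
`p (i + 1)` and fixing `p k` for `k > i + 1`, is injective on the group generated by the `s_i`. -/
theorem eq_one_of_perm {α : Type*} (φ : G →* Equiv.Perm α) (p : ℕ → α)
    (hp : ∀ i j, i ≤ N → j ≤ N → p i = p j → i = j)
    (hs : ∀ i < N, φ (s i) (p (i + 1)) = p i)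
    (hs' : ∀ i m, i + 1 < m → m ≤ N → φ (s i) (p m) = p m) {m : ℕ} (hm : m ≤ N) {g : G}
    (hg : g ∈ Subgroup.closure (s '' {i | i < m})) (hφ : φ g = 1) : g = 1 := by
  induction m generalizing g with
  | zero => simpa using hg
  | succ m ih =>
    obtain ⟨j, d, hjd, h, hh, rfl⟩ := exists_cosetRep h1 h2 h3 hm hg
    have hw : ∀ d j, j + d ≤ N → φ (cosetRep s j d) (p (j + d)) = p j := by
      intro d
      induction d with
      | zero => intro j _; simp [cosetRep]
      | succ d ih =>
        intro j hj
        rw [cosetRep, map_mul, Equiv.Perm.mul_apply, show j + (d + 1) = j + 1 + d by omega,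
          ih (j + 1) (by omega), hs j (by omega)]
    have hfix : φ h (p (m + 1)) = p (m + 1) := by
      have : h ∈ (MulAction.stabilizer (Equiv.Perm α) (p (m + 1))).comap φ := by
        refine (Subgroup.closure_le _).2 ?_ hh
        rintro _ ⟨i, hi, rfl⟩
        exact hs' i (m + 1) (Nat.succ_lt_succ hi) hm
      exact this
    have h4 : φ (cosetRep s j d * h) (p (m + 1)) = p j := by
      rw [map_mul, Equiv.Perm.mul_apply, hfix, ← hjd, hw d j (by omega)]
    rw [hφ, Equiv.Perm.one_apply] at h4
    have hj := hp _ _ hm (by omega) h4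
    obtain rfl : d = 0 := by omega
    rw [cosetRep, one_mul] at hφ ⊢
    exact ih (by omega) hh hφ

end Coxeter

section STilde

variable {n : ℕ}

/-- The central element `z₁` of the double cover of `𝔖ₙ`. -/
abbrev sz (n : ℕ) : STilde n := .of .z

/-- The generator `rᵢ` of the double cover of `𝔖ₙ`. -/
abbrev sr (i : Fin (n - 1)) : STilde n := .of (.r i)

theorem sz_mul_self : sz n * sz n = 1 := by
  have := PresentedGroup.one_of_mem (rels := sRels n) (x := (FreeGroup.of SGen.z) ^ 2) (Or.inl rfl)
  rwa [map_pow, sq] at this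

theorem sz_comm_sr (i : Fin (n - 1)) : sz n * sr i = sr i * sz n :=
  PresentedGroup.mk_eq_mk_of_mul_inv_mem (rels := sRels n)
    (x := FreeGroup.of .z * FreeGroup.of (.r i)) (y := FreeGroup.of (.r i) * FreeGroup.of .z)
    (Or.inr (Or.inl ⟨i, rfl⟩))

theorem sr_mul_self (i : Fin (n - 1)) : sr i * sr i = 1 := by
  have := PresentedGroup.one_of_mem (rels := sRels n) (x := (FreeGroup.of (SGen.r i)) ^ 2)
    (Or.inr (Or.inr (Or.inl ⟨i, rfl⟩)))
  rwa [map_pow, sq] at this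

theorem sr_cube (i j : Fin (n - 1)) (h : (i : ℕ) + 1 = j) : (sr i * sr j) ^ 3 = 1 :=
  PresentedGroup.one_of_mem (rels := sRels n)
    (x := (FreeGroup.of (SGen.r i) * FreeGroup.of (SGen.r j)) ^ 3)
    (Or.inr (Or.inr (Or.inr (Or.inl ⟨i, j, h, rfl⟩))))

theorem sr_comm (i j : Fin (n - 1)) (h : (i : ℕ) + 2 ≤ j ∨ (j : ℕ) + 2 ≤ i) :
    sr i * sr j = sz n * sr j * sr i :=
  PresentedGroup.mk_eq_mk_of_mul_inv_mem (rels := sRels n)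
    (x := FreeGroup.of (.r i) * FreeGroup.of (.r j))
    (y := FreeGroup.of .z * FreeGroup.of (.r j) * FreeGroup.of (.r i))
    (Or.inr (Or.inr (Or.inr (Or.inr ⟨i, j, h, rfl⟩))))

theorem sz_comm (s : STilde n) : sz n * s = s * sz n := by
  have := PresentedGroup.generated_by (sRels n) (Subgroup.centralizer {sz n}) (by
    rintro (_ | i)
    · exact Subgroup.mem_centralizer_singleton_iff.2 rfl
    · exact Subgroup.mem_centralizer_singleton_iff.2 (sz_comm_sr i).symm) s
  exact (Subgroup.mem_centralizer_singleton_iff.1 this).symm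

theorem eq_one_or_of_mem_zpowers {g : STilde n} (h : g ∈ Subgroup.zpowers (sz n)) :
    g = 1 ∨ g = sz n := by
  obtain ⟨k, rfl⟩ := Subgroup.mem_zpowers_iff.1 h
  rcases Int.even_or_odd' k with ⟨l, rfl | rfl⟩
  · left; rw [zpow_mul, zpow_two, sz_mul_self, one_zpow]
  · right; rw [zpow_add, zpow_mul, zpow_two, sz_mul_self, one_zpow, one_mul, zpow_one]

theorem braid_of_cube {G : Type*} [Group G] {a b : G} (ha : a * a = 1) (hb : b * b = 1)
    (h : (a * b) ^ 3 = 1) : b * a * b = a * b * a := by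
  have e : (a * b * a) * (b * a * b) = 1 := by
    rw [← h, pow_succ, pow_two]; simp only [mul_assoc]
  have e2 : (a * b * a) * (a * b * a) = 1 := by
    calc (a * b * a) * (a * b * a) = a * (b * (a * a) * b) * a := by simp only [mul_assoc]
      _ = 1 := by rw [ha, mul_one, hb, mul_one, ha]
  exact mul_left_cancel (e.trans e2.symm)

/-- The kernel of the covering map is generated by `z₁`: modulo `z₁` the relations are the Coxeter
relations of the symmetric group. -/
theorem eq_one_or_of_PhiS (g : STilde n) (hg : PhiS n g = 1) : g = 1 ∨ g = sz n := by
  apply eq_one_or_of_mem_zpowers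
  have hnorm : (Subgroup.zpowers (sz n)).Normal := by
    refine ⟨fun a ha s => ?_⟩
    rcases eq_one_or_of_mem_zpowers ha with rfl | rfl
    · simp
    · rw [← sz_comm, mul_inv_cancel_right]; exact Subgroup.mem_zpowers _
  let q := QuotientGroup.mk' (Subgroup.zpowers (sz n))
  have hq : ∀ g, q g = 1 ↔ g ∈ Subgroup.zpowers (sz n) := fun g => QuotientGroup.eq_one_iff g
  have hqz : q (sz n) = 1 := (hq _).2 (Subgroup.mem_zpowers _)
  let φ : STilde n ⧸ Subgroup.zpowers (sz n) →* Equiv.Perm (Fin n) :=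
    QuotientGroup.lift _ (PhiS n) (by
      rw [Subgroup.zpowers_le]
      exact PhiS_z)
  have hφ : ∀ s, φ (q s) = PhiS n s := fun s => rfl
  rw [← hq]
  rcases Nat.eq_zero_or_pos n with rfl | hn
  · refine (hq g).2 (PresentedGroup.generated_by (sRels 0) _ ?_ g)
    rintro (_ | i)
    · exact Subgroup.mem_zpowers _
    · exact i.elim0
  let s : ℕ → STilde n ⧸ Subgroup.zpowers (sz n) := fun i =>
    if h : i < n - 1 then q (sr ⟨i, h⟩) else 1
  have hs : ∀ i (h : i < n - 1), s i = q (sr ⟨i, h⟩) := fun i h => dif_pos h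
  let p : ℕ → Fin n := fun i => if h : i < n then ⟨i, h⟩ else ⟨0, hn⟩
  have hp : ∀ i (h : i < n), p i = ⟨i, h⟩ := fun i h => dif_pos h
  refine eq_one_of_perm (s := s) (N := n - 1) ?_ ?_ ?_ φ p ?_ ?_ ?_ le_rfl ?_ (by rw [hφ, hg])
  · intro i hi
    rw [hs i hi, ← map_mul, sr_mul_self, map_one]
  · intro i hi
    rw [hs i (by omega), hs (i + 1) hi]
    refine braid_of_cube ?_ ?_ ?_
    · rw [← map_mul, sr_mul_self, map_one]
    · rw [← map_mul, sr_mul_self, map_one]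
    · rw [← map_mul, ← map_pow, sr_cube _ _ rfl, map_one]
  · intro i j hij hj
    rw [hs i (by omega), hs j hj, ← map_mul, sr_comm _ _ (Or.inl hij), mul_assoc, map_mul, hqz,
      one_mul, map_mul]
  · intro i j hi hj h
    rw [hp i (by omega), hp j (by omega)] at h
    exact Fin.mk.inj h
  · intro i hi
    rw [hs i hi, hφ, PhiS_r, hp i (by omega), hp (i + 1) (by omega)]
    exact Equiv.swap_apply_right _ _
  · intro i m hi hm
    rw [hs i (by omega), hφ, PhiS_r, hp m (by omega)]
    apply Equiv.swap_apply_of_ne_of_ne <;> simp [lo, SpinGSG.hi, Fin.ext_iff] <;> omega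
  · refine PresentedGroup.generated_by (sRels n)
      ((Subgroup.closure (s '' {i | i < n - 1})).comap q) ?_ g
    rintro (_ | i)
    · rw [Subgroup.mem_comap, hqz]; exact Subgroup.one_mem _
    · exact Subgroup.subset_closure ⟨i, i.2, hs i i.2⟩

theorem PhiS_surjective : Function.Surjective (PhiS n) := by
  obtain _ | n := n
  · intro σ; exact ⟨1, Subsingleton.elim _ _⟩
  intro σ
  have h := Equiv.Perm.mclosure_swap_castSucc_succ n
  have hle : Submonoid.closure (Set.range fun i : Fin n ↦ Equiv.swap i.castSucc i.succ) ≤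
      (PhiS (n + 1)).range.toSubmonoid := by
    rw [Submonoid.closure_le]
    rintro _ ⟨i, rfl⟩
    exact ⟨sr (n := n + 1) i, PhiS_r (n := n + 1) i⟩
  exact hle (h ▸ Submonoid.mem_top σ)

instance : Finite (STilde n) := by
  refine Finite.of_surjective (fun x : Equiv.Perm (Fin n) × Bool =>
    Function.surjInv PhiS_surjective x.1 * if x.2 then sz n else 1) fun s => ?_
  have h := Function.surjInv_eq (PhiS_surjective (n := n)) (PhiS n s)
  rcases eq_one_or_of_PhiS ((Function.surjInv PhiS_surjective (PhiS n s))⁻¹ * s)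
    (by rw [map_mul, map_inv, h, inv_mul_cancel]) with h | h
  · exact ⟨(PhiS n s, false), by simpa using inv_mul_eq_one.1 h⟩
  · exact ⟨(PhiS n s, true), by simpa using (inv_mul_eq_iff_eq_mul.1 h).symm⟩

end STilde

section DHat

variable {m₀ n : ℕ}

theorem dz_central (x : DHat m₀ n) : .of .z * x = x * .of .z := by
  have := PresentedGroup.generated_by (dRels m₀ n) (Subgroup.centralizer {.of .z}) (by
    rintro (_ | i)
    · exact Subgroup.mem_centralizer_singleton_iff.2 rfl
    · exact Subgroup.mem_centralizer_singleton_iff.2 (dz_comm i).symm) x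
  exact (Subgroup.mem_centralizer_singleton_iff.1 this).symm

/-- Modulo its central subgroup, `D^∧_n` is a finitely generated abelian torsion group. -/
theorem finite_DHat (hm : 0 < m₀) : Finite (DHat m₀ n) := by
  let Z : Subgroup (DHat m₀ n) := Subgroup.zpowers (.of .z)
  have hnorm : Z.Normal := by
    refine ⟨fun a ha s => ?_⟩
    obtain ⟨k, rfl⟩ := Subgroup.mem_zpowers_iff.1 ha
    have h : Commute (.of .z : DHat m₀ n) s := dz_central s
    rw [← (h.zpow_left k).eq, mul_inv_cancel_right]
    exact ha
  have hZ : Finite Z := by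
    have : IsOfFinOrder (.of .z : DHat m₀ n) := isOfFinOrder_iff_pow_eq_one.2 ⟨2, by norm_num, dz_sq⟩
    exact this.finite_zpowers
  let q := QuotientGroup.mk' Z
  have hqs : Function.Surjective q := QuotientGroup.mk'_surjective Z
  have hqz : q (.of .z) = 1 := (QuotientGroup.eq_one_iff _).2 (Subgroup.mem_zpowers _)
  have hgen : ∀ (H : Subgroup (DHat m₀ n ⧸ Z)), (∀ j, q (.of (.eta j)) ∈ H) → ∀ x, x ∈ H := by
    intro H h x
    obtain ⟨x, rfl⟩ := hqs x
    refine PresentedGroup.generated_by (dRels m₀ n) (H.comap q) ?_ x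
    rintro (_ | j)
    · rw [Subgroup.mem_comap, hqz]; exact H.one_mem
    · exact h j
  have hcomm : ∀ x y : DHat m₀ n ⧸ Z, x * y = y * x := by
    intro x y
    have h1 : ∀ j, ∀ y, y ∈ Subgroup.centralizer {q (.of (.eta j))} := fun j => hgen _ fun k => by
      rw [Subgroup.mem_centralizer_singleton_iff]
      by_cases hjk : j = k
      · rw [hjk]
      · rw [← map_mul, ← map_mul, eta_comm j k hjk, mul_assoc, map_mul q (.of .z), hqz, one_mul]
    refine (Subgroup.mem_centralizer_singleton_iff.1
      (hgen (Subgroup.centralizer {y}) (fun j => ?_) x))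
    exact Subgroup.mem_centralizer_singleton_iff.2
      (Subgroup.mem_centralizer_singleton_iff.1 (h1 j y)).symm
  let _ : CommGroup (DHat m₀ n ⧸ Z) := { mul_comm := hcomm }
  have hfg : Group.FG (DHat m₀ n ⧸ Z) := by
    refine Group.fg_iff.2 ⟨Set.range fun j : Fin n => q (.of (.eta j)), ?_, Set.finite_range _⟩
    refine eq_top_iff.2 fun x _ => hgen _ (fun j => Subgroup.subset_closure ?_) x
    exact Set.mem_range_self j
  have htors : ∀ x : DHat m₀ n ⧸ Z, x ^ (2 * m₀) = 1 :=
    hgen (powMonoidHom (2 * m₀) : DHat m₀ n ⧸ Z →* DHat m₀ n ⧸ Z).ker fun j => by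
      rw [MonoidHom.mem_ker, powMonoidHom_apply, ← map_pow, eta_pow, map_one]
  have hfin : Finite (DHat m₀ n ⧸ Z) := CommGroup.finite_of_fg_isMulTorsion _
    fun x => isOfFinOrder_iff_pow_eq_one.2 ⟨2 * m₀, by omega, htors x⟩
  exact Finite.of_equiv _ (Subgroup.groupEquivQuotientProdSubgroup (s := Z)).symm

theorem finite_RGroup (hm : 0 < m₀) : Finite (RGroup m₀ n) := by
  have := finite_DHat (n := n) hm
  exact Finite.of_equiv _ (SemidirectProduct.equivProd (φ := act m₀ n)).symm

end DHat

/-! ### Clifford algebras -/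

section Kron

variable {k : ℕ}

theorem site_apply (i : Fin k) (A : Matrix (Fin 2) (Fin 2) ℂ) (x y : Fin k → Fin 2) :
    kron (fun l : Fin k => if (l : ℕ) = i then A else 1) x y = A (x i) (y i) *
      ∏ l ∈ Finset.univ.erase i, (1 : Matrix (Fin 2) (Fin 2) ℂ) (x l) (y l) := by
  rw [kron, Matrix.of_apply, ← Finset.mul_prod_erase _ _ (Finset.mem_univ i), if_pos rfl]
  congr 1
  refine Finset.prod_congr rfl fun l hl => ?_
  rw [if_neg fun h => Finset.ne_of_mem_erase hl (Fin.ext h)]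

/-- The matrix `A` in the `i`-th tensor factor, the identity in the other ones. -/
def site (i : Fin k) : Matrix (Fin 2) (Fin 2) ℂ →ₗ[ℂ] Mat k where
  toFun A := kron fun l : Fin k => if (l : ℕ) = i then A else 1
  map_add' A B := by
    ext x y
    simp only [site_apply, Matrix.add_apply, add_mul]
  map_smul' c A := by
    ext x y
    simp only [site_apply, Matrix.smul_apply, smul_eq_mul, RingHom.id_apply, mul_assoc]

theorem site_eq (i : Fin k) (A : Matrix (Fin 2) (Fin 2) ℂ) :
    site i A = kron fun l : Fin k => if (l : ℕ) = i then A else 1 := rfl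

theorem kron_prefix_mem {B : Subalgebra ℂ (Mat k)} (A : Fin k → Matrix (Fin 2) (Fin 2) ℂ)
    (hB : ∀ i, site i (A i) ∈ B) (i : ℕ) (hi : i ≤ k) :
    kron (fun l : Fin k => if (l : ℕ) < i then A l else 1) ∈ B := by
  induction i with
  | zero => simp [kron_one]
  | succ i ih =>
    have := B.mul_mem (ih (by omega)) (hB ⟨i, by omega⟩)
    rw [site_eq, kron_mul] at this
    convert this using 1
    refine congrArg kron (funext fun l => ?_)
    rcases lt_trichotomy (l : ℕ) i with h | h | h
    · simp [h, h.ne, Nat.lt_succ_of_lt h]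
    · subst h; simp
    · rw [if_neg (by omega), if_neg (by omega), if_neg (by simp; omega), one_mul]

theorem eq_top_of_site_mem {B : Subalgebra ℂ (Mat k)} (hB : ∀ i A, site i A ∈ B) : B = ⊤ := by
  rw [eq_top_iff]
  intro M _
  rw [Matrix.matrix_eq_sum_single M]
  refine B.sum_mem fun x _ => B.sum_mem fun y _ => ?_
  have : Matrix.single x y (M x y) = M x y • kron fun l => Matrix.single (x l) (y l) 1 := by
    ext x' y'
    simp only [kron, Matrix.smul_apply, Matrix.of_apply, smul_eq_mul, Matrix.single_apply]
    by_cases h : x = x' ∧ y = y'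
    · obtain ⟨rfl, rfl⟩ := h
      simp
    · rw [if_neg h]
      have : ∃ l, ¬ (x l = x' l ∧ y l = y' l) := by
        by_contra hcon
        push Not at hcon
        exact h ⟨funext fun l => (hcon l).1, funext fun l => (hcon l).2⟩
      obtain ⟨l, hl⟩ := this
      rw [Finset.prod_eq_zero (Finset.mem_univ l) (if_neg hl), mul_zero]
  rw [this]
  refine B.smul_mem ?_ _
  simpa using kron_prefix_mem _ (fun i => hB i _) k le_rfl

/-- The matrices `Y_1, …, Y_{2k}` generate the full matrix algebra. -/
theorem adjoin_Y (k : ℕ) : Algebra.adjoin ℂ (Y k '' {j | j < 2 * k}) = ⊤ := by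
  set B := Algebra.adjoin ℂ (Y k '' {j | j < 2 * k}) with hB
  have hY : ∀ j < 2 * k, Y k j ∈ B := fun j hj => Algebra.subset_adjoin ⟨j, hj, rfl⟩
  have hAB : matA * matB = Complex.I • matC := by
    ext i j; fin_cases i <;> fin_cases j <;> simp [matA, matB, matC]
  -- `Y_{2i-1} Y_{2i}` is the matrix `ab = √-1 c` in the `i`-th factor
  have h2 : ∀ i : Fin k, site i matC ∈ B := by
    intro i
    have h1 := B.mul_mem (hY (2 * i) (by omega)) (hY (2 * i + 1) (by omega))
    have h1' : Y k (2 * i) * Y k (2 * i + 1) = site i (matA * matB) := by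
      rw [Y, Y, kron_mul, site_eq]
      refine congrArg kron (funext fun l => ?_)
      have e1 : 2 * (i : ℕ) / 2 = i := by omega
      have e2 : (2 * (i : ℕ) + 1) / 2 = i := by omega
      have e3 : 2 * (i : ℕ) % 2 = 0 := by omega
      have e4 : (2 * (i : ℕ) + 1) % 2 = 1 := by omega
      simp only [yFactor, e1, e2, e3, e4]
      rcases lt_trichotomy (l : ℕ) i with h | h | h
      · simp [h, h.ne, matC_sq]
      · simp [h]
      · simp [h.ne', h.not_gt]
    rw [h1'] at h1
    have := B.smul_mem h1 (-Complex.I)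
    rwa [hAB, map_smul, smul_smul, neg_mul, Complex.I_mul_I, neg_neg, one_smul] at this
  have h4 : ∀ (i : Fin k) (p : ℕ), p / 2 = i → site i (if p % 2 = 0 then matA else matB) ∈ B := by
    intro i p hp
    have := B.mul_mem (kron_prefix_mem (fun _ => matC) h2 i i.2.le) (hY p (by omega))
    rw [Y, kron_mul] at this
    convert this using 1
    refine congrArg kron (funext fun l => ?_)
    simp only [yFactor, hp]
    rcases lt_trichotomy (l : ℕ) i with h | h | h
    · simp [h, h.ne, matC_sq]
    · simp [h]
    · simp [h.ne', h.not_gt]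
  refine eq_top_of_site_mem fun i A => ?_
  have hA : A = ((A 0 0 + A 1 1) / 2) • (1 : Matrix (Fin 2) (Fin 2) ℂ) +
      ((A 0 1 + A 1 0) / 2) • matA + (Complex.I * (A 0 1 - A 1 0) / 2) • matB +
      ((A 0 0 - A 1 1) / 2) • matC := by
    have hI := Complex.I_mul_I
    ext i j
    fin_cases i <;> fin_cases j <;> simp [matA, matB, matC]
    · ring
    · linear_combination (A 0 1 - A 1 0) / 2 * hI
    · linear_combination (A 1 0 - A 0 1) / 2 * hI
    · ring
  rw [hA, map_add, map_add, map_add, map_smul, map_smul, map_smul, map_smul]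
  refine B.add_mem (B.add_mem (B.add_mem (B.smul_mem ?_ _) (B.smul_mem ?_ _)) (B.smul_mem ?_ _))
    (B.smul_mem (h2 i) _)
  · have : site i 1 = 1 := by simp [site_eq, kron_one]
    rw [this]; exact B.one_mem
  · simpa using h4 i (2 * i) (by omega)
  · have := h4 i (2 * i + 1) (by omega)
    rwa [if_neg (by omega)] at this

end Kron

section Clifford

variable {R : Type*} [Ring R] [Algebra ℂ R]

/-- The span of the ordered monomials in `x 0, …, x (m - 1)`. -/
def monomialSpan (x : ℕ → R) : ℕ → Submodule ℂ R
  | 0 => ℂ ∙ 1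
  | m + 1 => monomialSpan x m ⊔ (monomialSpan x m).map (LinearMap.mulRight ℂ (x m))

theorem finrank_monomialSpan (x : ℕ → R) (m : ℕ) :
    FiniteDimensional ℂ (monomialSpan x m) ∧ Module.finrank ℂ (monomialSpan x m) ≤ 2 ^ m := by
  induction m with
  | zero => exact ⟨inferInstanceAs (FiniteDimensional ℂ (ℂ ∙ (1 : R))),
      (finrank_span_le_card (R := ℂ) ({1} : Set R)).trans (by simp)⟩
  | succ m ih =>
    obtain ⟨h1, h2⟩ := ih
    refine ⟨inferInstanceAs (FiniteDimensional ℂ (_ ⊔ _ : Submodule ℂ R)), ?_⟩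
    rw [monomialSpan]
    refine (Submodule.finrank_add_le_finrank_add_finrank _ _).trans ?_
    have := Submodule.finrank_map_le (LinearMap.mulRight ℂ (x m)) (monomialSpan x m)
    rw [pow_succ]
    omega

variable {x : ℕ → R} {N : ℕ} (h1 : ∀ i < N, x i * x i = 1)
  (h2 : ∀ i j, i < N → j < N → i ≠ j → x i * x j = -(x j * x i))

theorem one_mem_monomialSpan (x : ℕ → R) (m : ℕ) : 1 ∈ monomialSpan x m := by
  induction m with
  | zero => exact Submodule.mem_span_singleton_self _
  | succ m ih => exact Submodule.mem_sup_left ih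

include h1 h2 in
theorem mul_mem_monomialSpan {m : ℕ} (hm : m ≤ N) {i : ℕ} (hi : i < m) {a : R}
    (ha : a ∈ monomialSpan x m) : a * x i ∈ monomialSpan x m := by
  induction m generalizing i a with
  | zero => omega
  | succ m ih =>
    obtain ⟨b, hb, _, ⟨c, hc, rfl⟩, rfl⟩ := Submodule.mem_sup.1 ha
    rw [LinearMap.mulRight_apply, add_mul, mul_assoc]
    rcases Nat.lt_succ_iff_lt_or_eq.1 hi with h | rfl
    · rw [h2 m i (by omega) (by omega) (by omega), mul_neg, ← mul_assoc]
      exact Submodule.add_mem _ (Submodule.mem_sup_left (ih (by omega) h hb))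
        (Submodule.neg_mem _ (Submodule.mem_sup_right ⟨_, ih (by omega) h hc, rfl⟩))
    · rw [h1 i (by omega), mul_one, add_comm (b * x i)]
      exact Submodule.add_mem_sup (T := (monomialSpan x i).map (LinearMap.mulRight ℂ (x i))) hc
        (Submodule.mem_map_of_mem (f := LinearMap.mulRight ℂ (x i)) hb)

include h1 h2 in
theorem adjoin_le_monomialSpan {a : R} (ha : a ∈ Algebra.adjoin ℂ (x '' {j | j < N})) :
    a ∈ monomialSpan x N := by
  have key : ∀ b ∈ monomialSpan x N, b * a ∈ monomialSpan x N := by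
    induction ha using Algebra.adjoin_induction with
    | mem a ha =>
      obtain ⟨i, hi, rfl⟩ := ha
      exact fun b hb => mul_mem_monomialSpan h1 h2 le_rfl hi hb
    | algebraMap r =>
      intro b hb
      rw [← Algebra.commutes, ← Algebra.smul_def]
      exact Submodule.smul_mem _ _ hb
    | add a c _ _ ha hc =>
      intro b hb
      rw [mul_add]
      exact Submodule.add_mem _ (ha b hb) (hc b hb)
    | mul a c _ _ ha hc =>
      intro b hb
      rw [← mul_assoc]
      exact hc _ (ha b hb)
  simpa using key 1 (one_mem_monomialSpan x N)

/-- Anticommuting involutions `x 0, …, x (2k - 1)` define a homomorphism from the full matrix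
algebra: the algebra generated by the pairs `(Y_j, x_j)` has dimension at most `2 ^ (2k)`, so that
its projection to the matrix algebra is an isomorphism. -/
theorem exists_algHom_of_anticomm {k : ℕ} (x : ℕ → R) (h1 : ∀ i < 2 * k, x i * x i = 1)
    (h2 : ∀ i j, i < 2 * k → j < 2 * k → i ≠ j → x i * x j = -(x j * x i)) :
    ∃ θ : Mat k →ₐ[ℂ] R, ∀ j < 2 * k, θ (Y k j) = x j := by
  let y : ℕ → Mat k × R := fun j => (Y k j, x j)
  let B := Algebra.adjoin ℂ (y '' {j | j < 2 * k})
  have hyB : ∀ j < 2 * k, y j ∈ B := fun j hj => Algebra.subset_adjoin ⟨j, hj, rfl⟩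
  have hle : Subalgebra.toSubmodule B ≤ monomialSpan y (2 * k) := fun a ha =>
    adjoin_le_monomialSpan (fun i hi => Prod.ext (Y_sq k i) (h1 i hi))
      (fun i j hi hj hij => Prod.ext (Y_anti k i j hij hi.le hj.le) (h2 i j hi hj hij)) ha
  obtain ⟨hfin, hcard⟩ := finrank_monomialSpan y (2 * k)
  have hBfin : FiniteDimensional ℂ B := Submodule.finiteDimensional_of_le hle
  have hBcard : Module.finrank ℂ B ≤ 2 ^ (2 * k) := (Submodule.finrank_mono hle).trans hcard
  let π : B →ₐ[ℂ] Mat k := (AlgHom.fst ℂ (Mat k) R).comp B.val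
  have hsurj : Function.Surjective π := by
    rw [← AlgHom.range_eq_top, eq_top_iff, ← adjoin_Y k, Algebra.adjoin_le_iff]
    rintro _ ⟨j, hj, rfl⟩
    exact ⟨⟨y j, hyB j hj⟩, rfl⟩
  have hinj : Function.Injective π := by
    have hd : Module.finrank ℂ B = Module.finrank ℂ (Mat k) := by
      refine le_antisymm (hBcard.trans ?_) (LinearMap.finrank_le_finrank_of_surjective
        (f := π.toLinearMap) hsurj)
      rw [Module.finrank_matrix]
      simp [pow_mul, pow_two, ← mul_pow]
    exact (LinearMap.injective_iff_surjective_of_finrank_eq_finrank (f := π.toLinearMap) hd).2 hsurj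
  let e : B ≃ₐ[ℂ] Mat k := AlgEquiv.ofBijective π ⟨hinj, hsurj⟩
  refine ⟨((AlgHom.snd ℂ (Mat k) R).comp B.val).comp e.symm.toAlgHom, fun j hj => ?_⟩
  have : e.symm (Y k j) = ⟨y j, hyB j hj⟩ := by
    rw [AlgEquiv.symm_apply_eq]; rfl
  change (e.symm (Y k j)).1.2 = x j
  rw [this]

end Clifford

section OrderedProduct

variable {R : Type*} [Ring R]

/-- The ordered product `x 0 * ⋯ * x (m - 1)`. -/
def orderedProd (x : ℕ → R) (m : ℕ) : R := ((List.range m).map x).prod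

theorem orderedProd_succ (x : ℕ → R) (m : ℕ) :
    orderedProd x (m + 1) = orderedProd x m * x m := List.prod_range_succ x m

theorem mul_orderedProd_of_anticomm {x : ℕ → R} {y : R} {m : ℕ}
    (h : ∀ j < m, y * x j = -(x j * y)) :
    y * orderedProd x m = (-1) ^ m * (orderedProd x m * y) := by
  induction m with
  | zero => simp [orderedProd]
  | succ m ih =>
    rw [orderedProd_succ, ← mul_assoc, ih fun j hj => h j (by omega), mul_assoc, mul_assoc,
      h m (by omega), pow_succ]
    simp [mul_assoc]

variable {x : ℕ → R} {N : ℕ} (h1 : ∀ i < N, x i * x i = 1)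
  (h2 : ∀ i j, i < N → j < N → i ≠ j → x i * x j = -(x j * x i))

include h2 in
/-- The product of all generators commutes up to sign with each of them. -/
theorem mul_orderedProd {i m : ℕ} (hm : m + 1 ≤ N) (hi : i < m + 1) :
    x i * orderedProd x (m + 1) = (-1) ^ m * (orderedProd x (m + 1) * x i) := by
  induction m with
  | zero =>
    obtain rfl : i = 0 := by omega
    simp [orderedProd]
  | succ m ih =>
    rcases Nat.lt_succ_iff_lt_or_eq.1 hi with h | rfl
    · rw [orderedProd_succ, ← mul_assoc, ih (by omega) h, mul_assoc, mul_assoc,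
        h2 i (m + 1) (by omega) (by omega) (by omega), pow_succ]
      simp [mul_assoc]
    · rw [orderedProd_succ, ← mul_assoc, mul_orderedProd_of_anticomm
        fun j hj => h2 _ _ (by omega) (by omega) (by omega)]
      simp only [mul_assoc]

include h2 in
/-- The product of an odd number of generators commutes with each of them. -/
theorem commute_orderedProd {i k : ℕ} (hk : 2 * k + 1 ≤ N) (hi : i < 2 * k + 1) :
    x i * orderedProd x (2 * k + 1) = orderedProd x (2 * k + 1) * x i := by
  rw [mul_orderedProd h2 hk hi, pow_mul, neg_one_sq, one_pow, one_mul]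

include h1 in
theorem isUnit_orderedProd {m : ℕ} (hm : m ≤ N) : IsUnit (orderedProd x m) := by
  induction m with
  | zero => simp [orderedProd]
  | succ m ih =>
    rw [orderedProd_succ]
    have hx := h1 m (by omega)
    exact (ih (by omega)).mul ⟨⟨x m, x m, hx, hx⟩, rfl⟩

theorem map_orderedProd {R' : Type*} [Ring R'] (f : R →+* R') (x : ℕ → R) (m : ℕ) :
    f (orderedProd x m) = orderedProd (fun j => f (x j)) m := by
  rw [orderedProd, map_list_prod, List.map_map]; rfl

/-- The product `Y_1 ⋯ Y_{2k+1}` is a scalar. -/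
theorem orderedProd_Y (k : ℕ) : ∃ s : ℂ, s ≠ 0 ∧ orderedProd (Y k) (2 * k + 1) = s • 1 := by
  have hanti : ∀ i j, i < 2 * k + 1 → j < 2 * k + 1 → i ≠ j →
      Y k i * Y k j = -(Y k j * Y k i) := fun i j hi hj hij =>
    Y_anti k i j hij (by omega) (by omega)
  have hc : ∀ A : Mat k, Commute A (orderedProd (Y k) (2 * k + 1)) := by
    intro A
    have hA : A ∈ Algebra.adjoin ℂ (Y k '' {j | j < 2 * k}) := adjoin_Y k ▸ Algebra.mem_top
    induction hA using Algebra.adjoin_induction with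
    | mem A hA =>
      obtain ⟨i, hi, rfl⟩ := hA
      have hi' : i < 2 * k := hi
      exact commute_orderedProd hanti le_rfl (by omega)
    | algebraMap r => exact Algebra.commutes r _
    | add A B _ _ hA hB => exact hA.add_left hB
    | mul A B _ _ hA hB => exact hA.mul_left hB
  obtain ⟨s, hs⟩ := Matrix.mem_range_scalar_of_commute_single
    (M := orderedProd (Y k) (2 * k + 1)) fun i j _ => hc _
  have hs' : orderedProd (Y k) (2 * k + 1) = s • 1 := by
    rw [← hs, Matrix.scalar_apply, Matrix.smul_one_eq_diagonal]
  refine ⟨s, ?_, hs'⟩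
  rintro rfl
  have := isUnit_orderedProd (x := Y k) (N := 2 * k + 1) (fun i _ => Y_sq k i) le_rfl
  rw [hs', zero_smul] at this
  exact not_isUnit_zero this

end OrderedProduct

/-! ### Induced representations -/

section Isotypic

theorem asAlgebraHom_sum_single {N M : Type*} [Group N] [Fintype N] [AddCommGroup M] [Module ℂ M]
    (σ : Representation ℂ N M) (c : N → ℂ) (m : M) :
    σ.asAlgebraHom (∑ n, MonoidAlgebra.single n (c n)) m = ∑ n, c n • σ n m := by
  simp [asAlgebraHom_single, LinearMap.sum_apply]

/-- Some element of the group algebra acts as the identity on an irreducible representation `P`, and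
as zero on all representations without nonzero intertwining map from `P`. -/
theorem exists_isotypic_element {N V : Type*} [Group N] [Finite N] [AddCommGroup V] [Module ℂ V]
    {P : Representation ℂ N V} (hP : P.IsIrreducible) :
    ∃ e : MonoidAlgebra ℂ N, (∀ v, P.asAlgebraHom e v = v) ∧
      ∀ {M : Type} [AddCommGroup M] [Module ℂ M] (σ : Representation ℂ N M),
        (∀ f : P.IntertwiningMap σ, f = 0) → ∀ m, σ.asAlgebraHom e m = 0 := by
  classical
  have := Fintype.ofFinite N
  have : Invertible (Nat.card N : ℂ) :=
    invertibleOfNonzero (by exact_mod_cast Nat.card_pos.ne')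
  have := IsIrreducible.finiteDimensional hP
  let e₀ : MonoidAlgebra ℂ N := ∑ n, MonoidAlgebra.single n (P.character n⁻¹)
  have hcomm : ∀ g v, P.asAlgebraHom e₀ (P g v) = P g (P.asAlgebraHom e₀ v) := by
    intro g v
    rw [asAlgebraHom_sum_single, asAlgebraHom_sum_single, map_sum]
    refine Fintype.sum_bijective (fun n => g⁻¹ * n * g)
      ((Group.mulRight_bijective g).comp (Group.mulLeft_bijective g⁻¹)) _ _ fun n => ?_
    have h1 : P.character (g⁻¹ * n * g)⁻¹ = P.character n⁻¹ := by
      have := P.char_conj n⁻¹ g⁻¹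
      rwa [inv_inv, show g⁻¹ * n⁻¹ * g = (g⁻¹ * n * g)⁻¹ by group] at this
    rw [h1, map_smul, ← Module.End.mul_apply, ← Module.End.mul_apply, ← map_mul, ← map_mul]
    congr 3
    group
  obtain ⟨c, hc⟩ := schur_scalar hP _ hcomm
  have hc0 : c ≠ 0 := by
    rintro rfl
    have h0 : P.asAlgebraHom e₀ = 0 := LinearMap.ext fun v => by rw [hc, zero_smul]; rfl
    have htr := congrArg (LinearMap.trace ℂ V) h0
    have horth := char_orthonormal P P
    rw [if_pos ⟨Representation.Equiv.refl _⟩] at horth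
    have : LinearMap.trace ℂ V (P.asAlgebraHom e₀) = ∑ n, P.character n * P.character n⁻¹ := by
      simp [e₀, asAlgebraHom_single, character, mul_comm]
    rw [this, map_zero] at htr
    rw [htr, mul_zero] at horth
    exact zero_ne_one horth
  refine ⟨c⁻¹ • e₀, fun v => ?_, fun σ hσ m => ?_⟩
  · rw [map_smul, LinearMap.smul_apply, hc, smul_smul, inv_mul_cancel₀ hc0, one_smul]
  · rw [map_smul, LinearMap.smul_apply, asAlgebraHom_sum_single,
      sum_character_smul_eq_zero P σ hσ, smul_zero]

end Isotypic

section Induced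

variable {G H N : Type*} [Group G] [Group H] [Group N] (φ : H →* G)
  {X : Type*} [AddCommGroup X] [Module ℂ X] (τ : Representation ℂ H X)

theorem ind_mk_mul (h : H) (g : G) (x : X) :
    IndV.mk φ τ (φ h * g) (τ h x) = IndV.mk φ τ g x := by
  have := Coinvariants.mk_self_apply (Representation.tprod ((leftRegular ℂ G).comp φ) τ) h
    (MonoidAlgebra.single g 1 ⊗ₜ[ℂ] x)
  simpa using this

/-- Linear maps out of an induced representation. -/
def indLift {V : Type*} [AddCommGroup V] [Module ℂ V] (f : G → X →ₗ[ℂ] V)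
    (hf : ∀ h g x, f (φ h * g) (τ h x) = f g x) : IndV φ τ →ₗ[ℂ] V :=
  Coinvariants.lift _ (TensorProduct.lift
    ((Finsupp.lsum ℂ fun g => LinearMap.toSpanSingleton ℂ (X →ₗ[ℂ] V) (f g)) ∘ₗ
      (MonoidAlgebra.coeffLinearEquiv ℂ).toLinearMap)) fun h => by
    refine TensorProduct.ext (MonoidAlgebra.lhom_ext' fun g => LinearMap.ext_ring ?_)
    ext x
    simpa using hf h g x

theorem indLift_mk {V : Type*} [AddCommGroup V] [Module ℂ V] (f : G → X →ₗ[ℂ] V)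
    (hf : ∀ h g x, f (φ h * g) (τ h x) = f g x) (g : G) (x : X) :
    indLift φ τ f hf (IndV.mk φ τ g x) = f g x := by
  simp [indLift]

theorem ind_induction {p : IndV φ τ → Prop} (hadd : ∀ a b, p a → p b → p (a + b))
    (hmk : ∀ g x, p (IndV.mk φ τ g x)) (a : IndV φ τ) : p a := by
  have h0 : p 0 := by simpa using hmk 1 0
  obtain ⟨a, rfl⟩ := Coinvariants.mk_surjective _ a
  induction a using TensorProduct.induction_on with
  | zero => simpa using h0
  | add a b ha hb => rw [map_add]; exact hadd _ _ ha hb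
  | tmul y x =>
    induction y using MonoidAlgebra.induction_linear with
    | zero => simpa using h0
    | add y z hy hz => rw [TensorProduct.add_tmul, map_add]; exact hadd _ _ hy hz
    | single g r =>
      have := hmk g (r • x)
      rw [← mul_one r, ← smul_eq_mul, ← MonoidAlgebra.smul_single, TensorProduct.smul_tmul]
      exact this

variable {φ} in
theorem indMk_injective (hφ : Function.Injective φ) :
    Function.Injective (IndV.mk φ τ 1) := by
  classical
  let f : G → X →ₗ[ℂ] X := fun g => if h : ∃ h, φ h = g then τ h.choose⁻¹ else 0
  have hf1 : ∀ h, f (φ h) = τ h⁻¹ := by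
    intro h
    have hex : ∃ h', φ h' = φ h := ⟨h, rfl⟩
    simp only [f, dif_pos hex, hφ hex.choose_spec]
  have hf : ∀ h g x, f (φ h * g) (τ h x) = f g x := by
    intro h g x
    by_cases hg : ∃ h, φ h = g
    · obtain ⟨h', rfl⟩ := hg
      rw [← map_mul, hf1, hf1, mul_inv_rev, map_mul, Module.End.mul_apply, ← Module.End.mul_apply,
        ← Module.End.mul_apply, mul_assoc, ← map_mul τ h⁻¹, inv_mul_cancel, map_one, mul_one]
    · have hg' : ¬ ∃ h', φ h' = φ h * g := by
        rintro ⟨h', hh⟩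
        exact hg ⟨h⁻¹ * h', by rw [map_mul, hh, map_inv, inv_mul_cancel_left]⟩
      simp only [f, dif_neg hg, dif_neg hg', LinearMap.zero_apply]
  intro x y hxy
  have h := congrArg (indLift φ τ f hf) hxy
  rw [indLift_mk, indLift_mk, ← map_one φ, hf1] at h
  simpa using h

theorem ind_apply_mk (g k : G) (x : X) :
    ind φ τ g (IndV.mk φ τ k x) = IndV.mk φ τ (k * g⁻¹) x := ind_mk φ τ g k x

theorem ind_apply_mk_one (h : H) (x : X) :
    ind φ τ (φ h) (IndV.mk φ τ 1 x) = IndV.mk φ τ 1 (τ h x) := by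
  rw [ind_apply_mk, one_mul, ← ind_mk_mul φ τ h, mul_inv_cancel]

/-- Frobenius reciprocity. -/
theorem exists_ind_intertwining {V : Type*} [AddCommGroup V] [Module ℂ V]
    (σ : Representation ℂ G V) (f : X →ₗ[ℂ] V) (hf : ∀ h x, f (τ h x) = σ (φ h) (f x))
    (hf0 : f ≠ 0) : ∃ F : (ind φ τ).IntertwiningMap σ, F ≠ 0 := by
  let F : IndV φ τ →ₗ[ℂ] V := indLift φ τ (fun g => σ g⁻¹ ∘ₗ f) fun h g x => by
    rw [LinearMap.comp_apply, hf, mul_inv_rev, map_mul, Module.End.mul_apply,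
      ← Module.End.mul_apply (σ _) (σ (φ h)), ← map_mul, inv_mul_cancel, map_one]
    rfl
  have hF : ∀ g x, F (IndV.mk φ τ g x) = σ g⁻¹ (f x) := fun g x => indLift_mk φ τ _ _ g x
  refine ⟨⟨F, fun g => LinearMap.ext fun a => ?_⟩, fun h0 => hf0 (LinearMap.ext fun x => ?_)⟩
  · induction a using ind_induction with
    | hadd a b ha hb =>
      rw [map_add, map_add, ha, hb]
    | hmk k x =>
      rw [LinearMap.comp_apply, ind_apply_mk, hF, LinearMap.comp_apply, hF, mul_inv_rev, inv_inv,
        map_mul]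
      rfl
  · have := DFunLike.congr_fun h0 (IndV.mk φ τ 1 x)
    have h1 : F (IndV.mk φ τ 1 x) = 0 := this
    rwa [hF, inv_one, map_one] at h1

variable (j : N →* H) (α : G → N →* N) (hα : ∀ g n, g * φ (j n) = φ (j (α g n)) * g)

include hα in
/-- The action on an induced representation of the group algebra of a normal subgroup. -/
theorem ind_asAlgebraHom_mk (e : MonoidAlgebra ℂ N) (g : G) (x : X) :
    asAlgebraHom ((ind φ τ).comp (φ.comp j) : Representation ℂ N _) e (IndV.mk φ τ g x) =
      IndV.mk φ τ g (asAlgebraHom (τ.comp (j.comp (α g)) : Representation ℂ N X) e x) := by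
  induction e using MonoidAlgebra.induction_linear with
  | zero => simp
  | add a b ha hb => rw [map_add, LinearMap.add_apply, ha, hb, map_add, LinearMap.add_apply, map_add]
  | single n r =>
    rw [asAlgebraHom_single, asAlgebraHom_single, LinearMap.smul_apply, LinearMap.smul_apply, map_smul]
    congr 1
    change ind φ τ (φ (j n)) (IndV.mk φ τ g x) = IndV.mk φ τ g (τ (j (α g n)) x)
    rw [ind_apply_mk, ← ind_mk_mul φ τ (j (α g n)), ← map_inv, ← map_inv]
    congr 1
    have := hα g n⁻¹
    rw [map_inv, map_inv] at this ⊢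
    rw [this]
    simp

variable {e : MonoidAlgebra ℂ N}
  (he : ∀ x, asAlgebraHom (τ.comp j : Representation ℂ N X) e x = x)
  (he' : ∀ g, (∀ h, φ h ≠ g) → ∀ x,
    asAlgebraHom (τ.comp (j.comp (α g)) : Representation ℂ N X) e x = 0)

include he in
theorem ind_element_mk_one (x : X) :
    asAlgebraHom ((ind φ τ).comp (φ.comp j) : Representation ℂ N _) e (IndV.mk φ τ 1 x) =
      IndV.mk φ τ 1 x := by
  let F : Representation.IntertwiningMap (τ.comp j : Representation ℂ N X)
      ((ind φ τ).comp (φ.comp j) : Representation ℂ N _) :=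
    ⟨IndV.mk φ τ 1, fun n => LinearMap.ext fun v => (ind_apply_mk_one φ τ (j n) v).symm⟩
  have := intertwining_asAlgebraHom F e x
  rw [he] at this
  exact this.symm

include hα he he' in
theorem ind_element_mem_range (a : IndV φ τ) :
    ∃ x, asAlgebraHom ((ind φ τ).comp (φ.comp j) : Representation ℂ N _) e a =
      IndV.mk φ τ 1 x := by
  induction a using ind_induction with
  | hadd a b ha hb =>
    obtain ⟨x, hx⟩ := ha
    obtain ⟨y, hy⟩ := hb
    exact ⟨x + y, by rw [map_add, hx, hy, map_add]⟩
  | hmk g x =>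
    by_cases hg : ∃ h, φ h = g
    · obtain ⟨h, rfl⟩ := hg
      have h1 : IndV.mk φ τ (φ h) x = IndV.mk φ τ 1 (τ h⁻¹ x) := by
        rw [← ind_mk_mul φ τ h 1 (τ h⁻¹ x), mul_one, ← Module.End.mul_apply, ← map_mul,
          mul_inv_cancel, map_one, Module.End.one_apply]
      exact ⟨_, by rw [h1, ind_element_mk_one φ τ j he]⟩
    · push Not at hg
      exact ⟨0, by rw [ind_asAlgebraHom_mk φ τ j α hα, he' g hg, map_zero, map_zero]⟩

include hα he he' in
/-- Clifford theory: if the group algebra of a normal subgroup projects the induced representation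
to the inducing one, then irreducibility is preserved. -/
theorem ind_isIrreducible [Finite G] (hφ : Function.Injective φ) (hτ : τ.IsIrreducible) :
    (ind φ τ).IsIrreducible := by
  have hinj := indMk_injective τ hφ
  have hne := IsIrreducible.nontrivial hτ
  rw [isIrreducible_iff]
  refine ⟨hinj.nontrivial, fun Y hY => ?_⟩
  obtain ⟨Z, hZ, hYZ⟩ := exists_stable_compl (ind φ τ) Y hY
  have htop : ∀ W : Submodule ℂ (IndV φ τ), (∀ g, ∀ v ∈ W, ind φ τ g v ∈ W) →
      (∀ x, IndV.mk φ τ 1 x ∈ W) → W = ⊤ := by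
    intro W hW h1
    rw [eq_top_iff]
    intro a _
    induction a using ind_induction with
    | hadd a b ha hb => exact W.add_mem (ha trivial) (hb trivial)
    | hmk g x =>
      have := hW g⁻¹ _ (h1 x)
      rwa [ind_apply_mk, one_mul, inv_inv] at this
  rcases ((isIrreducible_iff τ).1 hτ).2 (Y.comap (IndV.mk φ τ 1)) (by
    intro h x hx
    rw [Submodule.mem_comap] at hx ⊢
    rw [← ind_apply_mk_one]
    exact hY _ _ hx) with h | h
  · left
    have hZtop : Z = ⊤ := htop Z hZ fun x => by
      obtain ⟨y, hy, z, hz, hyz⟩ :=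
        Submodule.mem_sup.1 (hYZ.sup_eq_top ▸ Submodule.mem_top : IndV.mk φ τ 1 x ∈ Y ⊔ Z)
      have hE : ∀ W : Submodule ℂ (IndV φ τ), (∀ g, ∀ v ∈ W, ind φ τ g v ∈ W) → ∀ w ∈ W,
          asAlgebraHom ((ind φ τ).comp (φ.comp j) : Representation ℂ N _) e w ∈ W :=
        fun W hW w hw => asAlgebraHom_mem ((ind φ τ).comp (φ.comp j) : Representation ℂ N _) W
          (fun n => hW _) e hw
      have hEy : asAlgebraHom ((ind φ τ).comp (φ.comp j) : Representation ℂ N _) e y = 0 := by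
        obtain ⟨x', hx'⟩ := ind_element_mem_range φ τ j α hα he he' y
        have : x' ∈ Y.comap (IndV.mk φ τ 1) := by
          rw [Submodule.mem_comap, ← hx']
          exact hE Y hY y hy
        rw [h, Submodule.mem_bot] at this
        rw [hx', this, map_zero]
      have := ind_element_mk_one φ τ j he x
      rw [← hyz, map_add, hEy, zero_add, hyz] at this
      rw [← this]
      exact hE Z hZ z hz
    have := hYZ.inf_eq_bot
    rwa [hZtop, inf_top_eq] at this
  · right
    exact htop Y hY fun x => (h ▸ Submodule.mem_top : x ∈ Y.comap (IndV.mk φ τ 1))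

include hα he in
/-- An equivalence of induced representations restricts to the inducing representations. -/
theorem nonempty_equiv_of_ind_equiv (hφ : Function.Injective φ) {X' : Type*} [AddCommGroup X']
    [Module ℂ X'] (τ' : Representation ℂ H X')
    (he₁ : ∀ x, asAlgebraHom (τ'.comp j : Representation ℂ N X') e x = x)
    (he₁' : ∀ g, (∀ h, φ h ≠ g) → ∀ x,
      asAlgebraHom (τ'.comp (j.comp (α g)) : Representation ℂ N X') e x = 0)
    [Nontrivial X] (f : (ind φ τ).Equiv (ind φ τ')) :
    ∃ F : τ.IntertwiningMap τ', F ≠ 0 := by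
  have hinj := indMk_injective τ hφ
  have hinj' := indMk_injective τ' hφ
  have hmem : ∀ x, ∃ x', f (IndV.mk φ τ 1 x) = IndV.mk φ τ' 1 x' := by
    intro x
    obtain ⟨x', hx'⟩ := ind_element_mem_range φ τ' j α hα he₁ he₁' (f (IndV.mk φ τ 1 x))
    refine ⟨x', ?_⟩
    rw [← hx']
    let fN : Representation.IntertwiningMap ((ind φ τ).comp (φ.comp j) : Representation ℂ N _)
        ((ind φ τ').comp (φ.comp j) : Representation ℂ N _) :=
      ⟨f.toLinearMap, fun n => LinearMap.ext fun v => equiv_map f _ v⟩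
    have := intertwining_asAlgebraHom fN e (IndV.mk φ τ 1 x)
    rw [ind_element_mk_one φ τ j he] at this
    exact this
  choose F hF using hmem
  let F' : X →ₗ[ℂ] X' :=
    { toFun := F
      map_add' := fun x y => hinj' (by rw [map_add, ← hF, ← hF, ← hF, map_add, map_add])
      map_smul' := fun c x => hinj' (by
        rw [RingHom.id_apply, map_smul, ← hF, ← hF, map_smul, map_smul]) }
  refine ⟨⟨F', fun h => LinearMap.ext fun x => hinj' ?_⟩, fun h0 => ?_⟩
  · change IndV.mk φ τ' 1 (F (τ h x)) = IndV.mk φ τ' 1 (τ' h (F x))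
    rw [← hF, ← ind_apply_mk_one, ← ind_apply_mk_one, ← hF, equiv_map]
  · obtain ⟨x, hx⟩ := exists_ne (0 : X)
    have h1 : F x = 0 := DFunLike.congr_fun h0 x
    have h2 := hF x
    rw [h1, map_zero] at h2
    exact hx (hinj ((f.injective (h2.trans (map_zero f).symm)).trans (map_zero _).symm))

end Induced

/-! ### Representations of the inducing subgroups -/

section Inducing

variable {m₀ n : ℕ}

/-- The representation `P_γ` of `U'`, acting on column vectors. -/
def PRep (m₀ : ℕ) {n : ℕ} (γ : Fin n → ℕ) :
    Representation ℂ (U m₀ n) ((Fin (n / 2) → Fin 2) → ℂ) :=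
  ((Matrix.toLinAlgEquiv' (R := ℂ) (n := Fin (n / 2) → Fin 2)).toMulEquiv.toMonoidHom.comp
    (Units.coeHom _)).comp (PU m₀ γ)

theorem PRep_apply (γ : Fin n → ℕ) (u : U m₀ n) (x : (Fin (n / 2) → Fin 2) → ℂ) :
    PRep m₀ γ u x = (PU m₀ γ u : Mat (n / 2)).mulVec x := rfl

theorem PRep_asAlgebraHom_eta (γ : Fin n → ℕ) (j : Fin n) :
    (PRep m₀ γ).asAlgebraHom (MonoidAlgebra.single (.of (.eta j), 1) (omega m₀ ^ γ j)⁻¹) =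
      Matrix.toLinAlgEquiv' (Y (n / 2) j) := by
  rw [asAlgebraHom_single]
  change _ • Matrix.toLinAlgEquiv' (P m₀ γ (.of (.eta j)) : Mat (n / 2)) = _
  rw [P_eta, ← map_smul, scaledY, smul_smul, inv_mul_cancel₀ (pow_ne_zero _ (omega_ne_zero _)),
    one_smul]

/-- The operators `P_γ(u)` span all matrices. -/
theorem exists_PRep_asAlgebraHom (γ : Fin n → ℕ) (A : Mat (n / 2)) :
    ∃ e, (PRep m₀ γ).asAlgebraHom e = Matrix.toLinAlgEquiv' A := by
  let θ : Mat (n / 2) →ₐ[ℂ] _ := (Matrix.toLinAlgEquiv' (R := ℂ) (n := Fin (n / 2) → Fin 2)).toAlgHom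
  have h : Algebra.adjoin ℂ (Y (n / 2) '' {j | j < 2 * (n / 2)}) ≤
      ((PRep m₀ γ).asAlgebraHom.range).comap θ := by
    rw [Algebra.adjoin_le_iff]
    rintro _ ⟨j, hj, rfl⟩
    have hj' : j < 2 * (n / 2) := hj
    exact ⟨_, PRep_asAlgebraHom_eta γ ⟨j, by omega⟩⟩
  rw [adjoin_Y] at h
  exact h (Algebra.mem_top (x := A))

theorem PRep_isIrreducible (γ : Fin n → ℕ) : (PRep m₀ γ).IsIrreducible := by
  rw [isIrreducible_iff]
  refine ⟨inferInstance, fun Q hQ => ?_⟩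
  rw [or_iff_not_imp_left]
  intro h
  obtain ⟨x, hx, hx0⟩ := (Submodule.ne_bot_iff Q).1 h
  obtain ⟨b, hb⟩ := Function.ne_iff.1 hx0
  rw [eq_top_iff]
  intro y _
  obtain ⟨e, he⟩ := exists_PRep_asAlgebraHom (m₀ := m₀) γ
    (Matrix.vecMulVec y (Pi.single b (x b)⁻¹))
  have := asAlgebraHom_mem _ Q hQ e hx
  rw [he, Matrix.toLinAlgEquiv'_apply, Matrix.vecMulVec_mulVec] at this
  simpa [inv_mul_cancel₀ hb] using this

variable {W W' : Type} [AddCommGroup W] [Module ℂ W] [AddCommGroup W'] [Module ℂ W']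

/-- The `b`-th coordinate of an element of `ℂ^I ⊗ W`. -/
def tensorCoord {I : Type} (b : I) : (I → ℂ) ⊗[ℂ] W →ₗ[ℂ] W :=
  (TensorProduct.lid ℂ W).toLinearMap ∘ₗ LinearMap.rTensor W (LinearMap.proj b)

theorem tensorCoord_tmul {I : Type} (b : I) (x : I → ℂ) (w : W) :
    tensorCoord b (x ⊗ₜ[ℂ] w) = x b • w := by
  simp [tensorCoord]

theorem sum_tensorCoord {I : Type} [Fintype I] [DecidableEq I] (z : (I → ℂ) ⊗[ℂ] W) :
    ∑ b, Pi.single b 1 ⊗ₜ[ℂ] tensorCoord b z = z := by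
  induction z using TensorProduct.induction_on with
  | zero => simp
  | add y z hy hz =>
    conv_rhs => rw [← hy, ← hz]
    simp only [map_add, TensorProduct.tmul_add, Finset.sum_add_distrib]
  | tmul x w =>
    simp only [tensorCoord_tmul, TensorProduct.tmul_smul, TensorProduct.smul_tmul']
    rw [← TensorProduct.sum_tmul]
    congr 1
    funext b
    simp [Finset.sum_apply, Pi.single_apply]

theorem exists_tensorCoord_ne_zero {I : Type} [Fintype I] {z : (I → ℂ) ⊗[ℂ] W} (hz : z ≠ 0) :
    ∃ b, tensorCoord b z ≠ 0 := by
  classical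
  by_contra h
  push Not at h
  apply hz
  rw [← sum_tensorCoord z]
  simp [h]

variable {γ : Fin n → ℕ} {S : Subgroup (Equiv.Perm (Fin n))} {J : STilde n →* (Mat (n / 2))ˣ}
  (hJ : ∀ s ∈ S.comap (PhiS n), (PU m₀ γ).comp (act m₀ n s).toMonoidHom =
    (MulAut.conj (J s)).toMonoidHom.comp (PU m₀ γ))
  (ρ : Representation ℂ S W) (ρ' : Representation ℂ S W')

/-- The representation `π⁰ ⊠ π¹` of `U' ⋊ Φ⁻¹(S)`, where `π⁰ = P_γ · J` and `π¹ = ρ`. -/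
def tensorRep : Representation ℂ (HGroup m₀ (S.comap (PhiS n)))
    (((Fin (n / 2) → Fin 2) → ℂ) ⊗[ℂ] W) :=
  (piZero γ (S.comap (PhiS n)) J hJ).tprod
    ((ρ.comp ((PhiS n).subgroupComap S)).comp SemidirectProduct.rightHom)

theorem tensorRep_inl (u : U m₀ n) (x : (Fin (n / 2) → Fin 2) → ℂ) (w : W) :
    tensorRep hJ ρ (SemidirectProduct.inl u) (x ⊗ₜ[ℂ] w) = PRep m₀ γ u x ⊗ₜ[ℂ] w := by
  have h : piZero γ (S.comap (PhiS n)) J hJ (SemidirectProduct.inl u) = PRep m₀ γ u :=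
    congrArg (fun A : (Mat (n / 2))ˣ => Matrix.toLinAlgEquiv' (A : Mat (n / 2)))
      (SemidirectProduct.lift_inl (PU m₀ γ) (J.comp (S.comap (PhiS n)).subtype)
        (fun s => hJ s s.2) u)
  simp [tensorRep, h]

theorem tensorRep_inr (s : S.comap (PhiS n)) (x : (Fin (n / 2) → Fin 2) → ℂ) (w : W) :
    tensorRep hJ ρ (SemidirectProduct.inr s) (x ⊗ₜ[ℂ] w) =
      ((J s : Mat (n / 2)).mulVec x) ⊗ₜ[ℂ] ρ ((PhiS n).subgroupComap S s) w := by
  have h : piZero γ (S.comap (PhiS n)) J hJ (SemidirectProduct.inr s) =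
      Matrix.toLinAlgEquiv' (J s : Mat (n / 2)) :=
    congrArg (fun A : (Mat (n / 2))ˣ => Matrix.toLinAlgEquiv' (A : Mat (n / 2)))
      (SemidirectProduct.lift_inr (PU m₀ γ) (J.comp (S.comap (PhiS n)).subtype)
        (fun s => hJ s s.2) s)
  simp [tensorRep, h]

theorem tensorRep_asAlgebraHom (f : U m₀ n →* U m₀ n) (e : MonoidAlgebra ℂ (U m₀ n))
    (z : ((Fin (n / 2) → Fin 2) → ℂ) ⊗[ℂ] W) :
    asAlgebraHom ((tensorRep hJ ρ).comp (SemidirectProduct.inl.comp f) :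
      Representation ℂ (U m₀ n) _) e z =
      LinearMap.rTensor W (asAlgebraHom ((PRep m₀ γ).comp f : Representation ℂ (U m₀ n) _) e) z := by
  induction e using MonoidAlgebra.induction_linear with
  | zero => simp
  | add a b ha hb =>
    rw [map_add, map_add, LinearMap.rTensor_add, LinearMap.add_apply, LinearMap.add_apply, ha, hb]
  | single u r =>
    rw [asAlgebraHom_single, asAlgebraHom_single, LinearMap.rTensor_smul, LinearMap.smul_apply,
      LinearMap.smul_apply]
    congr 1
    induction z using TensorProduct.induction_on with
    | zero => simp
    | add y z hy hz => rw [map_add, map_add, hy, hz]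
    | tmul x w => exact tensorRep_inl hJ ρ (f u) x w

theorem tensorRep_asAlgebraHom_inl (e : MonoidAlgebra ℂ (U m₀ n))
    (z : ((Fin (n / 2) → Fin 2) → ℂ) ⊗[ℂ] W) :
    asAlgebraHom ((tensorRep hJ ρ).comp SemidirectProduct.inl : Representation ℂ (U m₀ n) _) e z =
      LinearMap.rTensor W ((PRep m₀ γ).asAlgebraHom e) z :=
  tensorRep_asAlgebraHom hJ ρ (MonoidHom.id _) e z

/-- Operators `A ⊗ 1` preserve stable subspaces. -/
theorem rTensor_mem (Q : Submodule ℂ (((Fin (n / 2) → Fin 2) → ℂ) ⊗[ℂ] W))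
    (hQ : ∀ h, ∀ z ∈ Q, tensorRep hJ ρ h z ∈ Q) (A : Mat (n / 2))
    {z : ((Fin (n / 2) → Fin 2) → ℂ) ⊗[ℂ] W} (hz : z ∈ Q) :
    LinearMap.rTensor W (Matrix.toLinAlgEquiv' A : _ →ₗ[ℂ] _) z ∈ Q := by
  obtain ⟨e, he⟩ := exists_PRep_asAlgebraHom (m₀ := m₀) γ A
  rw [← he, ← tensorRep_asAlgebraHom_inl hJ ρ]
  exact asAlgebraHom_mem ((tensorRep hJ ρ).comp SemidirectProduct.inl : Representation ℂ (U m₀ n) _)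
    Q (fun u => hQ _) e hz

/-- Intertwining maps commute with the operators `A ⊗ 1`. -/
theorem intertwining_rTensor (T : (tensorRep hJ ρ).IntertwiningMap (tensorRep hJ ρ'))
    (A : Mat (n / 2)) (z : ((Fin (n / 2) → Fin 2) → ℂ) ⊗[ℂ] W) :
    T (LinearMap.rTensor W (Matrix.toLinAlgEquiv' A : _ →ₗ[ℂ] _) z) =
      LinearMap.rTensor W' (Matrix.toLinAlgEquiv' A : _ →ₗ[ℂ] _) (T z) := by
  obtain ⟨e, he⟩ := exists_PRep_asAlgebraHom (m₀ := m₀) γ A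
  rw [← he, ← tensorRep_asAlgebraHom_inl hJ ρ, ← tensorRep_asAlgebraHom_inl hJ ρ']
  let T' : Representation.IntertwiningMap
      ((tensorRep hJ ρ).comp SemidirectProduct.inl : Representation ℂ (U m₀ n) _)
      ((tensorRep hJ ρ').comp SemidirectProduct.inl : Representation ℂ (U m₀ n) _) :=
    ⟨T.toLinearMap, fun u => LinearMap.ext fun v => T.isIntertwining _ _ (SemidirectProduct.inl u) v⟩
  exact intertwining_asAlgebraHom T' e z

/-- The action of `S` on the second factor. -/
theorem tmul_eq_rTensor_inr (s : S.comap (PhiS n)) (x : (Fin (n / 2) → Fin 2) → ℂ) (w : W) :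
    x ⊗ₜ[ℂ] ρ ((PhiS n).subgroupComap S s) w =
      LinearMap.rTensor W (Matrix.toLinAlgEquiv' (((J s)⁻¹ : (Mat (n / 2))ˣ) : Mat (n / 2)) : _ →ₗ[ℂ] _)
        (tensorRep hJ ρ (SemidirectProduct.inr s) (x ⊗ₜ[ℂ] w)) := by
  rw [tensorRep_inr, LinearMap.rTensor_tmul, Matrix.toLinAlgEquiv'_apply, Matrix.mulVec_mulVec,
    Units.inv_mul, Matrix.one_mulVec]

theorem subgroupComap_PhiS_surjective (S : Subgroup (Equiv.Perm (Fin n))) :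
    Function.Surjective ((PhiS n).subgroupComap S) := by
  rintro ⟨σ, hσ⟩
  obtain ⟨s, rfl⟩ := PhiS_surjective σ
  exact ⟨⟨s, hσ⟩, rfl⟩

theorem tensorRep_isIrreducible (hρ : ρ.IsIrreducible) : (tensorRep hJ ρ).IsIrreducible := by
  classical
  have hne := IsIrreducible.nontrivial hρ
  rw [isIrreducible_iff]
  constructor
  · obtain ⟨w, hw⟩ := exists_ne (0 : W)
    refine ⟨(Pi.single 0 1) ⊗ₜ[ℂ] w, 0, fun h => hw ?_⟩
    have := congrArg (tensorCoord (0 : Fin (n / 2) → Fin 2)) h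
    rwa [tensorCoord_tmul, Pi.single_eq_same, one_smul, map_zero] at this
  intro Q hQ
  rw [or_iff_not_imp_left]
  intro h
  obtain ⟨z, hz, hz0⟩ := (Submodule.ne_bot_iff Q).1 h
  obtain ⟨b, hb⟩ := exists_tensorCoord_ne_zero hz0
  -- the `w` with `ℂ^I ⊗ w ⊆ Q` form a stable subspace
  let Q' : Submodule ℂ W := ⨅ x, Q.comap (TensorProduct.mk ℂ _ W x)
  have hQ' : ∀ w, w ∈ Q' ↔ ∀ x : (Fin (n / 2) → Fin 2) → ℂ, x ⊗ₜ[ℂ] w ∈ Q := by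
    intro w; simp [Q']
  have htop := IsIrreducible.eq_top hρ Q' (by
    intro s w hw
    obtain ⟨s, rfl⟩ := subgroupComap_PhiS_surjective S s
    rw [hQ'] at hw ⊢
    intro x
    rw [tmul_eq_rTensor_inr hJ]
    exact rTensor_mem hJ ρ Q hQ _ (hQ _ _ (hw x))) (v := tensorCoord b z) (by
    rw [hQ']
    intro x
    have := rTensor_mem hJ ρ Q hQ (Matrix.vecMulVec x (Pi.single b 1)) hz
    convert this using 1
    conv_rhs => rw [← sum_tensorCoord z]
    rw [map_sum, Finset.sum_eq_single b]
    · rw [LinearMap.rTensor_tmul, Matrix.toLinAlgEquiv'_apply, Matrix.vecMulVec_mulVec]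
      simp
    · intro c _ hc
      rw [LinearMap.rTensor_tmul, Matrix.toLinAlgEquiv'_apply, Matrix.vecMulVec_mulVec]
      simp [hc.symm]
    · simp) hb
  rw [eq_top_iff]
  intro z _
  rw [← sum_tensorCoord z]
  exact Q.sum_mem fun b _ => (hQ' _).1 (htop ▸ Submodule.mem_top) _

theorem nonempty_equiv_of_tensorRep (hρ : ρ.IsIrreducible) (hρ' : ρ'.IsIrreducible)
    (T : (tensorRep hJ ρ).IntertwiningMap (tensorRep hJ ρ')) (hT : T ≠ 0) :
    Nonempty (ρ.Equiv ρ') := by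
  have : ∃ x w, T (x ⊗ₜ[ℂ] w) ≠ 0 := by
    by_contra h
    push Not at h
    apply hT
    refine DFunLike.ext _ _ fun z => ?_
    change T z = 0
    induction z using TensorProduct.induction_on with
    | zero => exact map_zero T
    | add y z hy hz => rw [map_add, hy, hz, add_zero]
    | tmul x w => exact h x w
  obtain ⟨x, w, hxw⟩ := this
  obtain ⟨b, hb⟩ := exists_tensorCoord_ne_zero hxw
  let t : W →ₗ[ℂ] W' := tensorCoord b ∘ₗ T.toLinearMap ∘ₗ TensorProduct.mk ℂ _ W x
  have ht : ∀ w, t w = tensorCoord b (T (x ⊗ₜ[ℂ] w)) := fun _ => rfl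
  refine nonempty_equiv_of_ne_zero hρ hρ' ⟨t, fun s => LinearMap.ext fun w => ?_⟩ fun h0 => hb ?_
  · obtain ⟨s, rfl⟩ := subgroupComap_PhiS_surjective S s
    change t (ρ _ w) = ρ' _ (t w)
    rw [ht, ht, tmul_eq_rTensor_inr hJ,
      intertwining_rTensor hJ, T.isIntertwining]
    generalize T (x ⊗ₜ[ℂ] w) = z
    induction z using TensorProduct.induction_on with
    | zero => simp
    | add y z hy hz => simp only [map_add, hy, hz]
    | tmul x w =>
      rw [← tmul_eq_rTensor_inr, tensorCoord_tmul, tensorCoord_tmul, map_smul]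
  · exact DFunLike.congr_fun h0 w

end Inducing

/-! ### The Mackey machine for `U' ⋊ 𝔖̃ₙ` -/

section Central

variable {m₀ n : ℕ}

/-- The automorphism of `U'` induced by conjugation with an element of `R(G(m,1,n))`. -/
def conjU (g : RGroup m₀ n) : U m₀ n →* U m₀ n :=
  (MulAut.conj g.left * act m₀ n g.right).toMonoidHom

theorem mul_inl (g : RGroup m₀ n) (u : U m₀ n) :
    g * SemidirectProduct.inl u = SemidirectProduct.inl (conjU g u) * g := by
  ext1 <;> simp [conjU]

theorem conjU_surjective (g : RGroup m₀ n) : Function.Surjective (conjU g) :=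
  (MulAut.conj g.left * act m₀ n g.right).surjective

theorem z₁_comm (g : RGroup m₀ n) : g * z₁ m₀ n = z₁ m₀ n * g := by
  have h : act m₀ n (sz n) = 1 := by rw [act, MonoidHom.comp_apply, PhiS_z, map_one]
  refine SemidirectProduct.ext ?_ (sz_comm g.right).symm
  change g.left * act m₀ n g.right 1 = 1 * act m₀ n (sz n) g.left
  rw [h, map_one, mul_one, one_mul]; rfl

theorem z₂_comm (g : RGroup m₀ n) : g * z₂ m₀ n = z₂ m₀ n * g := by
  refine SemidirectProduct.ext ?_ (by simp [z₂])
  change g.left * actU m₀ (PhiS n g.right) (.of .z, 1) = (.of .z, 1) * act m₀ n 1 g.left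
  rw [map_one]
  refine Prod.ext ?_ ?_
  · simp [actU, permD_z, dz_central]
  · simp [actU, signD, dLift_z]

theorem z₃_comm (g : RGroup m₀ n) : g * z₃ m₀ n = z₃ m₀ n * g := by
  refine SemidirectProduct.ext ?_ (by simp [z₃])
  change g.left * actU m₀ (PhiS n g.right) (1, -1) = (1, -1) * act m₀ n 1 g.left
  rw [map_one]
  refine Prod.ext ?_ ?_
  · simp [actU]
  · simp [actU]

end Central

/-- A homomorphism which is trivial on the kernel of a surjection factors through it. -/
theorem exists_descend {K S M : Type*} [Group K] [Group S] [Monoid M] (p : K →* S)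
    (hp : Function.Surjective p) (f : K →* M) (hf : ∀ k, p k = 1 → f k = 1) :
    ∃ f' : S →* M, ∀ k, f' (p k) = f k := by
  have key : ∀ k k', p k = p k' → f k = f k' := by
    intro k k' h
    have h1 := hf (k * k'⁻¹) (by rw [map_mul, map_inv, h, mul_inv_cancel])
    have h2 : k = k * k'⁻¹ * k' := by group
    rw [h2, map_mul, h1, one_mul]
  have hs := Function.surjInv_eq hp
  refine ⟨{ toFun := fun s => f (Function.surjInv hp s), map_one' := ?_, map_mul' := ?_ },
    fun k => key _ _ (hs _)⟩
  · exact hf _ (hs _)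
  · intro s t
    rw [← map_mul]
    exact key _ _ (by rw [map_mul, hs, hs, hs])

/-- The data for the construction of `Π(π⁰, π¹)`: a parameter `γ`, a subgroup `S` of `𝔖ₙ` and a
matrix representation `J` of `𝔖̃ₙ` with `J(z₁) = -1` which intertwines the translates of `P_γ` under
the preimage of `S`. -/
structure SpinDatum (m₀ n : ℕ) where
  γ : Fin n → ℕ
  S : Subgroup (Equiv.Perm (Fin n))
  J : STilde n →* (Mat (n / 2))ˣ
  intertwines : ∀ s ∈ S.comap (PhiS n), (PU m₀ γ).comp (act m₀ n s).toMonoidHom =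
    (MulAut.conj (J s)).toMonoidHom.comp (PU m₀ γ)
  J_z : (J (sz n) : Mat (n / 2)) = -1

namespace SpinDatum

variable {m₀ n : ℕ} (D D' : SpinDatum m₀ n) {W W' : Type} [AddCommGroup W] [Module ℂ W]
  [AddCommGroup W'] [Module ℂ W'] (ρ : Representation ℂ D.S W) (ρ' : Representation ℂ D.S W')

/-- The induced representation `Π(P_γ · J, ρ)`. -/
def induce : Rep.{0} ℂ (RGroup m₀ n) :=
  induced (piZero D.γ (D.S.comap (PhiS n)) D.J D.intertwines)
    (ρ.comp ((PhiS n).subgroupComap D.S))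

theorem induce_congr {D D' : SpinDatum m₀ n} (h : D = D') (ρ : Representation ℂ D.S W) :
    D.induce ρ = D'.induce (ρ.comp (Subgroup.inclusion (h ▸ le_rfl : D'.S ≤ D.S))) := by
  subst h; rfl

theorem inclH_injective (K : Subgroup (STilde n)) : Function.Injective (inclH m₀ K) := by
  intro x y h
  have h1 : x.left = y.left := congrArg (fun g : RGroup m₀ n => g.left) h
  have h2 : (x.right : STilde n) = y.right := congrArg (fun g : RGroup m₀ n => g.right) h
  exact SemidirectProduct.ext h1 (Subtype.ext h2)

theorem mul_inclH_inl (K : Subgroup (STilde n)) (g : RGroup m₀ n) (u : U m₀ n) :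
    g * inclH m₀ K (SemidirectProduct.inl u) =
      inclH m₀ K (SemidirectProduct.inl (conjU g u)) * g := by
  have h : ∀ u, inclH m₀ K (SemidirectProduct.inl u) = SemidirectProduct.inl u := fun u =>
    SemidirectProduct.map_inl _ _ _ u
  rw [h, h, mul_inl]

theorem ne_inclH {S : Subgroup (Equiv.Perm (Fin n))} {g : RGroup m₀ n}
    (hg : ∀ h, inclH m₀ (S.comap (PhiS n)) h ≠ g) : PhiS n g.right ∉ S :=
  fun h => hg ⟨g.left, ⟨g.right, h⟩⟩ rfl

/-- The two parameters are separated: `P_γ` is not equivalent to any translate of `P_γ'`, except for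
the translates under `S` in case the data agree. -/
def Separated : Prop :=
  ∀ g : RGroup m₀ n, Nonempty ((PRep m₀ D.γ).Equiv
    ((PRep m₀ D'.γ).comp (conjU g) : Representation ℂ (U m₀ n) _)) →
      D = D' ∧ PhiS n g.right ∈ D'.S

variable {D D'}

section Isotypic

variable {e : MonoidAlgebra ℂ (U m₀ n)} (he : ∀ v, (PRep m₀ D.γ).asAlgebraHom e v = v)
  (he' : ∀ {M : Type} [AddCommGroup M] [Module ℂ M] (σ : Representation ℂ (U m₀ n) M),
    (∀ f : (PRep m₀ D.γ).IntertwiningMap σ, f = 0) → ∀ m, σ.asAlgebraHom e m = 0)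

include he in
theorem isotypic_apply (x : ((Fin (n / 2) → Fin 2) → ℂ) ⊗[ℂ] W) :
    asAlgebraHom ((tensorRep D.intertwines ρ).comp SemidirectProduct.inl :
      Representation ℂ (U m₀ n) _) e x = x := by
  rw [tensorRep_asAlgebraHom_inl, show (PRep m₀ D.γ).asAlgebraHom e = LinearMap.id from
    LinearMap.ext he, LinearMap.rTensor_id, LinearMap.id_apply]

include he' in
theorem isotypic_apply_eq_zero (hs : D.Separated D') {g : RGroup m₀ n}
    (hg : ¬(D = D' ∧ PhiS n g.right ∈ D'.S)) (σ : Representation ℂ D'.S W)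
    (x : ((Fin (n / 2) → Fin 2) → ℂ) ⊗[ℂ] W) :
    asAlgebraHom ((tensorRep D'.intertwines σ).comp (SemidirectProduct.inl.comp (conjU g)) :
      Representation ℂ (U m₀ n) _) e x = 0 := by
  rw [tensorRep_asAlgebraHom]
  have : asAlgebraHom ((PRep m₀ D'.γ).comp (conjU g) : Representation ℂ (U m₀ n) _) e = 0 := by
    refine LinearMap.ext fun m => he' _ (fun f => ?_) m
    by_contra hf
    exact hg (hs g (nonempty_equiv_of_ne_zero (PRep_isIrreducible _)
      (comp_isIrreducible (PRep_isIrreducible _) _ (conjU_surjective g)) f hf))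
  rw [this, LinearMap.rTensor_zero, LinearMap.zero_apply]

end Isotypic

theorem finite_U (hm : 0 < m₀) : Finite (U m₀ n) := by
  have := finite_DHat (n := n) hm
  infer_instance

theorem induce_isIrreducible (hm : 0 < m₀) (hs : D.Separated D) (hρ : ρ.IsIrreducible) :
    (D.induce ρ).ρ.IsIrreducible := by
  have := finite_RGroup (n := n) hm
  have := finite_U (n := n) hm
  obtain ⟨e, he, he'⟩ := exists_isotypic_element (PRep_isIrreducible (m₀ := m₀) D.γ)
  exact ind_isIrreducible (inclH m₀ _) (tensorRep D.intertwines ρ) SemidirectProduct.inl conjU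
    (mul_inclH_inl _) (isotypic_apply ρ he)
    (fun g hg => isotypic_apply_eq_zero he' hs (fun h => ne_inclH hg h.2) ρ)
    (inclH_injective _) (tensorRep_isIrreducible _ ρ hρ)

theorem nonempty_equiv_of_induce (hm : 0 < m₀) (hs : D.Separated D) (hρ : ρ.IsIrreducible)
    (hρ' : ρ'.IsIrreducible) (f : (D.induce ρ).ρ.Equiv (D.induce ρ').ρ) :
    Nonempty (ρ.Equiv ρ') := by
  have := finite_U (n := n) hm
  obtain ⟨e, he, he'⟩ := exists_isotypic_element (PRep_isIrreducible (m₀ := m₀) D.γ)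
  have := IsIrreducible.nontrivial (tensorRep_isIrreducible D.intertwines ρ hρ)
  obtain ⟨F, hF⟩ := nonempty_equiv_of_ind_equiv (inclH m₀ _) (tensorRep D.intertwines ρ)
    SemidirectProduct.inl conjU (mul_inclH_inl _) (isotypic_apply ρ he)
    (inclH_injective _) (tensorRep D.intertwines ρ') (isotypic_apply ρ' he)
    (fun g hg => isotypic_apply_eq_zero he' hs (fun h => ne_inclH hg h.2) ρ') f
  exact nonempty_equiv_of_tensorRep D.intertwines ρ ρ' hρ hρ' F hF

theorem eq_of_induce_equiv (hm : 0 < m₀) (hs : D.Separated D') (hρ : ρ.IsIrreducible)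
    (σ : Representation ℂ D'.S W') (f : (D.induce ρ).ρ.Equiv (D'.induce σ).ρ) : D = D' := by
  by_contra hne
  have := finite_U (n := n) hm
  obtain ⟨e, he, he'⟩ := exists_isotypic_element (PRep_isIrreducible (m₀ := m₀) D.γ)
  have := IsIrreducible.nontrivial (tensorRep_isIrreducible D.intertwines ρ hρ)
  obtain ⟨x, hx⟩ := exists_ne (0 : ((Fin (n / 2) → Fin 2) → ℂ) ⊗[ℂ] W)
  let f' : (ind (inclH m₀ _) (tensorRep D.intertwines ρ)).Equiv
    (ind (inclH m₀ _) (tensorRep D'.intertwines σ)) := f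
  let fN : Representation.IntertwiningMap
      ((ind (inclH m₀ _) (tensorRep D.intertwines ρ)).comp
        ((inclH m₀ (D.S.comap (PhiS n))).comp SemidirectProduct.inl) : Representation ℂ (U m₀ n) _)
      ((ind (inclH m₀ _) (tensorRep D'.intertwines σ)).comp
        ((inclH m₀ (D'.S.comap (PhiS n))).comp SemidirectProduct.inl) : Representation ℂ (U m₀ n) _) :=
    ⟨f'.toLinearMap, fun u => LinearMap.ext fun v =>
      equiv_map f' (inclH m₀ (D.S.comap (PhiS n)) (SemidirectProduct.inl u)) v⟩
  have h1 := intertwining_asAlgebraHom fN e (IndV.mk (inclH m₀ _) (tensorRep D.intertwines ρ) 1 x)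
  rw [ind_element_mk_one (inclH m₀ _) (tensorRep D.intertwines ρ) SemidirectProduct.inl
    (isotypic_apply ρ he)] at h1
  have h2 : ∀ a, asAlgebraHom ((ind (inclH m₀ _) (tensorRep D'.intertwines σ)).comp
        ((inclH m₀ (D'.S.comap (PhiS n))).comp SemidirectProduct.inl) : Representation ℂ (U m₀ n) _) e a = 0 := by
    intro a
    induction a using ind_induction with
    | hadd a b ha hb => rw [map_add, ha, hb, add_zero]
    | hmk g y =>
      rw [ind_asAlgebraHom_mk (inclH m₀ _) (tensorRep D'.intertwines σ) SemidirectProduct.inl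
        conjU (mul_inclH_inl _), isotypic_apply_eq_zero he' hs (fun h => hne h.1), map_zero]
  rw [h2] at h1
  have h3 : f' (IndV.mk (inclH m₀ _) (tensorRep D.intertwines ρ) 1 x) = 0 := h1
  exact hx (indMk_injective _ (inclH_injective _)
    ((f'.injective (h3.trans (map_zero f').symm)).trans (map_zero _).symm))

/-- A central element of the inducing subgroup acts on an induced representation as on the inducing
one. -/
theorem ind_apply_central {G H X : Type*} [Group G] [Group H] (φ : H →* G) [AddCommGroup X]
    [Module ℂ X] (τ : Representation ℂ H X) {h : H} (hc : ∀ g, g * φ h = φ h * g) {c : ℂ}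
    (hτ : ∀ x, τ h x = c • x) : ind φ τ (φ h) = c • LinearMap.id := by
  refine LinearMap.ext fun a => ?_
  change _ = c • a
  induction a using ind_induction with
  | hadd a b ha hb => rw [map_add, ha, hb, smul_add]
  | hmk g x =>
    have h1 : g * (φ h)⁻¹ = φ h⁻¹ * g := by
      rw [map_inv, mul_inv_eq_iff_eq_mul, mul_assoc, hc, inv_mul_cancel_left]
    have h2 : τ h⁻¹ (τ h x) = x := by
      rw [← Module.End.mul_apply, ← map_mul, inv_mul_cancel, map_one, Module.End.one_apply]
    rw [ind_apply_mk, h1, ← map_smul, ← hτ, ← ind_mk_mul φ τ h⁻¹ g (τ h x), h2]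

theorem tensorRep_smul {h : HGroup m₀ (D.S.comap (PhiS n))} {c : ℂ}
    (hc : ∀ x w, tensorRep D.intertwines ρ h (x ⊗ₜ[ℂ] w) = c • (x ⊗ₜ[ℂ] w))
    (z : ((Fin (n / 2) → Fin 2) → ℂ) ⊗[ℂ] W) : tensorRep D.intertwines ρ h z = c • z := by
  induction z using TensorProduct.induction_on with
  | zero => simp
  | add y z hy hz => rw [map_add, hy, hz, smul_add]
  | tmul x w => exact hc x w

theorem induce_hasSpinType : HasSpinType (D.induce ρ).ρ (-1) (-1) 1 := by
  refine ⟨?_, ?_, ?_⟩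
  · let z : D.S.comap (PhiS n) := ⟨sz n, by rw [Subgroup.mem_comap, PhiS_z]; exact D.S.one_mem⟩
    have hz : (PhiS n).subgroupComap D.S z = 1 := Subtype.ext PhiS_z
    refine ind_apply_central (inclH m₀ (D.S.comap (PhiS n))) (tensorRep D.intertwines ρ)
      (h := SemidirectProduct.inr z) z₁_comm (tensorRep_smul ρ fun x w => ?_)
    rw [tensorRep_inr, hz, D.J_z, map_one, Matrix.neg_mulVec, Matrix.one_mulVec,
      TensorProduct.neg_tmul]
    exact (neg_one_smul ℂ _).symm
  · refine ind_apply_central (inclH m₀ (D.S.comap (PhiS n))) (tensorRep D.intertwines ρ)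
      (h := SemidirectProduct.inl (.of .z, 1)) z₂_comm (tensorRep_smul ρ fun x w => ?_)
    rw [tensorRep_inl, PRep_apply]
    change ((P m₀ D.γ (.of .z) : Mat (n / 2)).mulVec x) ⊗ₜ[ℂ] w = _
    rw [P_z, Matrix.neg_mulVec, Matrix.one_mulVec, TensorProduct.neg_tmul]
    exact (neg_one_smul ℂ _).symm
  · refine ind_apply_central (inclH m₀ (D.S.comap (PhiS n))) (tensorRep D.intertwines ρ)
      (h := SemidirectProduct.inl (1, -1)) z₃_comm (tensorRep_smul ρ fun x w => ?_)
    rw [tensorRep_inl, PRep_apply]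
    change ((P m₀ D.γ 1 : Mat (n / 2)).mulVec x) ⊗ₜ[ℂ] w = _
    rw [map_one, Units.val_one, Matrix.one_mulVec, one_smul]

section Multiplicity

variable (D) {V : Type*} [AddCommGroup V] [Module ℂ V] (σ : Representation ℂ (RGroup m₀ n) V)

/-- The space of intertwining maps from `P_γ` to the restriction of `σ` to `U'`. -/
def multiplicity : Submodule ℂ (((Fin (n / 2) → Fin 2) → ℂ) →ₗ[ℂ] V) where
  carrier := {f | ∀ u x, f (PRep m₀ D.γ u x) = σ (SemidirectProduct.inl u) (f x)}
  add_mem' := fun {f g} hf hg u x => by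
    rw [LinearMap.add_apply, LinearMap.add_apply, map_add, hf, hg]
  zero_mem' := fun u x => by simp
  smul_mem' := fun c f hf u x => by
    rw [LinearMap.smul_apply, LinearMap.smul_apply, map_smul, hf]

theorem J_inv_PRep (s : D.S.comap (PhiS n)) (u : U m₀ n) (x : (Fin (n / 2) → Fin 2) → ℂ) :
    (((D.J s)⁻¹ : (Mat (n / 2))ˣ) : Mat (n / 2)).mulVec (PRep m₀ D.γ (act m₀ n s u) x) =
      PRep m₀ D.γ u ((((D.J s)⁻¹ : (Mat (n / 2))ˣ) : Mat (n / 2)).mulVec x) := by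
  have h : PU m₀ D.γ (act m₀ n s u) = D.J s * PU m₀ D.γ u * (D.J s)⁻¹ :=
    DFunLike.congr_fun (D.intertwines s s.2) u
  rw [PRep_apply, PRep_apply, Matrix.mulVec_mulVec, Matrix.mulVec_mulVec, ← Units.val_mul,
    ← Units.val_mul, h]
  congr 2
  group

/-- The action of the preimage of `S` on the space of intertwining maps: `s` sends `f` to
`σ(s) ∘ f ∘ J(s)⁻¹`. -/
def multiplicityRep : Representation ℂ (D.S.comap (PhiS n)) (D.multiplicity σ) where
  toFun s := LinearMap.restrict
    ((LinearMap.llcomp ℂ _ V V (σ (SemidirectProduct.inr (s : STilde n)))) ∘ₗ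
      (LinearMap.lcomp ℂ V (Matrix.toLinAlgEquiv' (((D.J s)⁻¹ : (Mat (n / 2))ˣ) : Mat (n / 2))))) (by
    intro f hf u x
    obtain ⟨u, rfl⟩ := (act m₀ n s).surjective u
    change σ _ (f (Matrix.mulVec _ (PRep m₀ D.γ _ x))) = σ _ (σ _ (f (Matrix.mulVec _ x)))
    have h : (SemidirectProduct.inr (s : STilde n) * SemidirectProduct.inl u : RGroup m₀ n) =
        SemidirectProduct.inl (act m₀ n s u) * SemidirectProduct.inr (s : STilde n) := by
      ext1 <;> simp
    rw [J_inv_PRep, hf, ← Module.End.mul_apply, ← Module.End.mul_apply, ← map_mul, ← map_mul, h])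
  map_one' := by
    refine LinearMap.ext fun f => Subtype.ext (LinearMap.ext fun x => ?_)
    change σ (SemidirectProduct.inr 1) (f.1 (Matrix.mulVec
      (((D.J 1)⁻¹ : (Mat (n / 2))ˣ) : Mat (n / 2)) x)) = f.1 x
    rw [map_one, map_one, map_one]
    simp
  map_mul' s t := by
    refine LinearMap.ext fun f => Subtype.ext (LinearMap.ext fun x => ?_)
    change σ (SemidirectProduct.inr (s * t)) (f.1 (Matrix.mulVec
      (((D.J (s * t))⁻¹ : (Mat (n / 2))ˣ) : Mat (n / 2)) x)) =
      σ (SemidirectProduct.inr s) (σ (SemidirectProduct.inr t) (f.1 (Matrix.mulVec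
        (((D.J t)⁻¹ : (Mat (n / 2))ˣ) : Mat (n / 2))
        (Matrix.mulVec (((D.J s)⁻¹ : (Mat (n / 2))ˣ) : Mat (n / 2)) x))))
    rw [map_mul, map_mul, map_mul, mul_inv_rev, Units.val_mul, Matrix.mulVec_mulVec]
    rfl

theorem multiplicityRep_apply (s : D.S.comap (PhiS n)) (f : D.multiplicity σ)
    (x : (Fin (n / 2) → Fin 2) → ℂ) : (D.multiplicityRep σ s f).1 x =
      σ (SemidirectProduct.inr (s : STilde n))
        (f.1 ((((D.J s)⁻¹ : (Mat (n / 2))ˣ) : Mat (n / 2)).mulVec x)) := rfl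

/-- On representations with `z₁ ↦ -1`, the action on the space of intertwining maps factors through
`S`. -/
theorem exists_multiplicityRep (hσ : σ (z₁ m₀ n) = (-1 : ℂ) • LinearMap.id) :
    ∃ κ : Representation ℂ D.S (D.multiplicity σ),
      ∀ s, κ ((PhiS n).subgroupComap D.S s) = D.multiplicityRep σ s := by
  refine exists_descend _ (subgroupComap_PhiS_surjective D.S) (D.multiplicityRep σ) fun s hs => ?_
  rcases eq_one_or_of_PhiS (s : STilde n) (congrArg Subtype.val hs) with h | h
  · rw [show s = 1 from Subtype.ext h, map_one]
  · refine LinearMap.ext fun f => Subtype.ext (LinearMap.ext fun x => ?_)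
    have hJ : (((D.J (sz n))⁻¹ : (Mat (n / 2))ˣ) : Mat (n / 2)) = -1 := by
      rw [show D.J (sz n) = -1 from Units.ext D.J_z]
      simp
    have hσ' : σ (SemidirectProduct.inr (sz n)) = (-1 : ℂ) • LinearMap.id := hσ
    rw [multiplicityRep_apply, h, hJ, hσ']
    simp [Matrix.neg_mulVec]

theorem exists_ind_ne_zero (κ : Representation ℂ D.S (D.multiplicity σ))
    (hκ : ∀ s, κ ((PhiS n).subgroupComap D.S s) = D.multiplicityRep σ s)
    (F : ρ.IntertwiningMap κ) (hF : F ≠ 0) :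
    ∃ T : (D.induce ρ).ρ.IntertwiningMap σ, T ≠ 0 := by
  let T : ((Fin (n / 2) → Fin 2) → ℂ) ⊗[ℂ] W →ₗ[ℂ] V :=
    TensorProduct.lift ((D.multiplicity σ).subtype ∘ₗ F.toLinearMap).flip
  have hT : ∀ x w, T (x ⊗ₜ[ℂ] w) = (F w).1 x := fun _ _ => rfl
  refine exists_ind_intertwining (inclH m₀ _) (tensorRep D.intertwines ρ) σ T ?_ ?_
  · intro h z
    have h1 : ∀ u z, T (tensorRep D.intertwines ρ (SemidirectProduct.inl u) z) =
        σ (SemidirectProduct.inl u) (T z) := by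
      intro u z
      induction z using TensorProduct.induction_on with
      | zero => simp
      | add y z hy hz => rw [map_add, map_add, map_add, map_add, hy, hz]
      | tmul x w =>
        rw [tensorRep_inl, hT, hT]
        exact (F w).2 u x
    have h2 : ∀ s : D.S.comap (PhiS n),
        ∀ z, T (tensorRep D.intertwines ρ (SemidirectProduct.inr s) z) =
        σ (SemidirectProduct.inr (s : STilde n)) (T z) := by
      intro s z
      induction z using TensorProduct.induction_on with
      | zero => simp
      | add y z hy hz => rw [map_add, map_add, map_add, map_add, hy, hz]
      | tmul x w =>
        rw [tensorRep_inr, hT, hT]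
        have : F (ρ ((PhiS n).subgroupComap D.S s) w) = D.multiplicityRep σ s (F w) := by
          rw [← hκ]; exact IntertwiningMap.isIntertwining _ _ F _ w
        rw [this, multiplicityRep_apply, Matrix.mulVec_mulVec, Units.inv_mul, Matrix.one_mulVec]
    rw [← SemidirectProduct.inl_left_mul_inr_right h, map_mul, Module.End.mul_apply, h1, h2,
      map_mul, map_mul, Module.End.mul_apply]
    rfl
  · intro h0
    apply hF
    refine DFunLike.ext _ _ fun w => Subtype.ext (LinearMap.ext fun x => ?_)
    exact DFunLike.congr_fun h0 (x ⊗ₜ[ℂ] w)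

end Multiplicity

/-- The classification of the irreducible representations of spin type `(-1, -1, 1)` by separated
data which meet all of them, together with the irreducible representations of the subgroups `S`. -/
theorem isCompleteSetOfReps.{w} (hm : 0 < m₀) {Lab ι : Type} (D : Lab → SpinDatum m₀ n)
    (hD : Function.Injective D) (hsep : ∀ l l', (D l).Separated (D l'))
    (hcover : ∀ (V : Type w) [AddCommGroup V] [Module ℂ V]
      (σ : Representation ℂ (RGroup m₀ n) V), σ.IsIrreducible → HasSpinType σ (-1) (-1) 1 →
      ∃ l, ∃ f ∈ (D l).multiplicity σ, f ≠ 0)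
    (L : ι → Lab) {W : ι → Type} [∀ i, AddCommGroup (W i)] [∀ i, Module ℂ (W i)]
    (ρ : ∀ i, Representation ℂ (D (L i)).S (W i)) (hρ : ∀ i, (ρ i).IsIrreducible)
    (hne : ∀ i j, ∀ h : (D (L j)).S ≤ (D (L i)).S, L i = L j →
      Nonempty (Representation.Equiv
        ((ρ i).comp (Subgroup.inclusion h) : Representation ℂ (D (L j)).S _) (ρ j)) → i = j)
    (hex : ∀ l, IsExhausting.{w} fun x : {i // L i = l} =>
      ((ρ x).comp (Subgroup.inclusion (congrArg (fun l => (D l).S) x.2).ge) :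
        Representation ℂ (D l).S (W x))) :
    IsCompleteSetOfReps.{w} (-1) (-1) 1 fun i => (D (L i)).induce (ρ i) where
  irreducible i := induce_isIrreducible _ hm (hsep _ _) (hρ i)
  spinType i := induce_hasSpinType _
  inequivalent i j := by
    rintro ⟨f⟩
    have h := eq_of_induce_equiv _ hm (hsep _ _) (hρ i) _ f
    have hirr : ∀ {D D' : SpinDatum m₀ n} (h : D = D') {X : Type} [AddCommGroup X] [Module ℂ X]
        (τ : Representation ℂ D.S X), τ.IsIrreducible → Representation.IsIrreducible
        (τ.comp (Subgroup.inclusion (h ▸ le_rfl : D'.S ≤ D.S)) : Representation ℂ D'.S X) := by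
      rintro D _ rfl X _ _ τ hτ
      exact hτ
    rw [induce_congr h] at f
    exact hne i j _ (hD h) (nonempty_equiv_of_induce _ _ hm (hsep _ _) (hirr h _ (hρ i)) (hρ j) f)
  complete V _ _ σ hσ hspin := by
    obtain ⟨l, f, hf, hf0⟩ := hcover V σ hσ hspin
    obtain ⟨κ, hκ⟩ := (D l).exists_multiplicityRep σ hspin.1
    have : Nontrivial ((D l).multiplicity σ) := ⟨⟨f, hf⟩, 0, fun h => hf0 (congrArg Subtype.val h)⟩
    obtain ⟨⟨i, rfl⟩, F, hF⟩ := hex l _ κ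
    obtain ⟨T, hT⟩ := (D (L i)).exists_ind_ne_zero (ρ i) σ κ hκ F hF
    obtain ⟨e⟩ := nonempty_equiv_of_ne_zero (induce_isIrreducible _ hm (hsep _ _) (hρ i)) hσ T hT
    exact ⟨i, ⟨e.symm⟩⟩

end SpinDatum

/-! ### Comparing the representations `P_γ` -/

section Separation

variable {m₀ n : ℕ}

/-- The matrices representing the generators `η̂ⱼ` in `P^ε_γ`, up to scalars. -/
def ySign (k : ℕ) : Bool → ℕ → Mat k
  | true => Y k
  | false => YMinus k

theorem Ylast_mul_ySign (k : ℕ) (ε : Bool) (j : ℕ) :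
    Y k (2 * k) * ySign k (!ε) j = -(ySign k ε j * Y k (2 * k)) := by
  cases ε
  · simp only [ySign, YMinus, Bool.not_false, neg_mul, neg_neg, mul_assoc, Y_sq, mul_one]
  · simp only [ySign, YMinus, Bool.not_true, mul_neg, ← mul_assoc, Y_sq, one_mul]

theorem ySign_sq (k : ℕ) (ε : Bool) (j : ℕ) : ySign k ε j * ySign k ε j = 1 := by
  cases ε
  · rw [ySign, YMinus, conj_mul _ _ _ (Y_sq _ _), Y_sq, mul_one, Y_sq]
  · exact Y_sq k j

theorem mul_orderedProd_of_mul {R : Type*} [Ring R] [Algebra ℂ R] {x y : ℕ → R} {B : R} {c : ℂ}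
    {m : ℕ} (h : ∀ j < m, B * x j = c • (y j * B)) :
    B * orderedProd x m = c ^ m • (orderedProd y m * B) := by
  induction m with
  | zero => simp [orderedProd]
  | succ m ih =>
    rw [orderedProd_succ, orderedProd_succ, ← mul_assoc, ih fun j hj => h j (by omega),
      smul_mul_assoc, mul_assoc, h m (by omega), mul_smul_comm, smul_smul, pow_succ, mul_assoc]

/-- The sign `±1` of `ε`. -/
def signOf : Bool → ℂ
  | true => 1
  | false => -1

/-- The product of all the matrices is a scalar, which determines `ε`. -/
theorem orderedProd_ySign (k : ℕ) :
    ∃ s : ℂ, s ≠ 0 ∧ ∀ ε, orderedProd (ySign k ε) (2 * k + 1) = (signOf ε * s) • 1 := by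
  obtain ⟨s, hs, h⟩ := orderedProd_Y k
  refine ⟨s, hs, fun ε => ?_⟩
  cases ε
  · have h1 := mul_orderedProd_of_mul (x := ySign k false) (y := Y k) (B := Y k (2 * k)) (c := -1)
      (m := 2 * k + 1) fun j _ => by
        rw [neg_one_smul]; exact Ylast_mul_ySign k true j
    have h2 : Y k (2 * k) * (Y k (2 * k) * orderedProd (ySign k false) (2 * k + 1)) =
        orderedProd (ySign k false) (2 * k + 1) := by rw [← mul_assoc, Y_sq, one_mul]
    rw [← h2, h1, h, Odd.neg_one_pow ⟨k, rfl⟩, smul_mul_assoc, one_mul, mul_smul_comm,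
      mul_smul_comm, Y_sq, smul_smul]
    rfl
  · rw [signOf, one_mul]; exact h

theorem isPrimitiveRoot_omega (hm : 0 < m₀) : IsPrimitiveRoot (omega m₀) (2 * m₀) :=
  Complex.isPrimitiveRoot_exp (2 * m₀) (by omega)

/-- The element `η̂ⱼ` of `U'`. -/
abbrev etaU (m₀ : ℕ) {n : ℕ} (j : Fin n) : U m₀ n := (.of (.eta j), 1)

theorem act_etaU (s : STilde n) (j : Fin n) :
    act m₀ n s (etaU m₀ j) = (.of (.eta (PhiS n s j)), Equiv.Perm.sign (PhiS n s)) := by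
  refine Prod.ext (permD_eta _ _) ?_
  change signD m₀ (PhiS n s) (.of (.eta j)) * 1 = _
  rw [mul_one, signD, dLift_eta]

theorem conjU_apply (g : RGroup m₀ n) (u : U m₀ n) :
    conjU g u = g.left * act m₀ n g.right u * g.left⁻¹ := rfl

/-- A translate of `P_γ'` which is equivalent to `P_γ` yields a matrix intertwining the generators. -/
theorem exists_matrix_of_equiv {γ γ' : Fin n → ℕ} {g : RGroup m₀ n}
    (e : (PRep m₀ γ).Equiv ((PRep m₀ γ').comp (conjU g) : Representation ℂ (U m₀ n) _)) :
    ∃ A : Mat (n / 2), A ≠ 0 ∧ ∀ j, A * scaledY m₀ γ j =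
      scaledY m₀ γ' (PhiS n g.right j) * A := by
  let E := LinearMap.toMatrix' e.toLinearEquiv.toLinearMap
  have hE : ∀ x, E.mulVec x = e x := fun x => by
    rw [← Matrix.toLin'_apply, Matrix.toLin'_toMatrix']; rfl
  refine ⟨((PU m₀ γ' g.left)⁻¹ : (Mat (n / 2))ˣ) * E, ?_, fun j => ?_⟩
  · intro h0
    rw [Units.mul_right_eq_zero] at h0
    obtain ⟨x, hx⟩ := exists_ne (0 : (Fin (n / 2) → Fin 2) → ℂ)
    apply hx
    have := hE x
    rw [h0, Matrix.zero_mulVec] at this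
    exact e.injective (this.symm.trans (map_zero e).symm)
  · have hu : ∀ u x, E.mulVec (PRep m₀ γ u x) = PRep m₀ γ' (conjU g u) (E.mulVec x) := by
      intro u x
      rw [hE, hE]
      exact equiv_map e u x
    have h1 : E * (PU m₀ γ (etaU m₀ j) : Mat (n / 2)) =
        (PU m₀ γ' (conjU g (etaU m₀ j)) : Mat (n / 2)) * E := by
      refine Matrix.ext_iff_mulVec.2 fun x => ?_
      rw [← Matrix.mulVec_mulVec, ← Matrix.mulVec_mulVec]
      have := hu (etaU m₀ j) x
      rwa [PRep_apply, PRep_apply] at this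
    have h3 : (PU m₀ γ (etaU m₀ j) : Mat (n / 2)) = scaledY m₀ γ j := P_eta m₀ γ j
    have h4 : (PU m₀ γ' (act m₀ n g.right (etaU m₀ j)) : Mat (n / 2)) =
        scaledY m₀ γ' (PhiS n g.right j) := by
      rw [act_etaU]; exact P_eta m₀ γ' _
    rw [conjU_apply, map_mul, map_mul, Units.val_mul, Units.val_mul, h3, h4, map_inv] at h1
    rw [mul_assoc, h1]
    simp only [mul_assoc, Units.inv_mul_cancel_left]

theorem eq_of_scaled_mul (hm : 0 < m₀) {k : ℕ} {A : Mat k} (hA : A ≠ 0) {a a' : Fin m₀}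
    {y y' : Mat k} (hy : y * y = 1) (hy' : y' * y' = 1)
    (h : A * (omega m₀ ^ (a : ℕ) • y) = (omega m₀ ^ (a' : ℕ) • y') * A) :
    a = a' ∧ A * y = y' * A := by
  have h1 : (omega m₀ ^ (2 * (a : ℕ))) • A = (omega m₀ ^ (2 * (a' : ℕ))) • A := by
    have e1 : A * (omega m₀ ^ (a : ℕ) • y) * (omega m₀ ^ (a : ℕ) • y) =
        (omega m₀ ^ (2 * (a : ℕ))) • A := by
      rw [mul_assoc, smul_mul_smul_comm, hy, mul_smul_comm, mul_one, two_mul, pow_add]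
    rw [← e1, h, mul_assoc, h, ← mul_assoc, smul_mul_smul_comm, hy', smul_mul_assoc, one_mul,
      two_mul, pow_add]
  have h2 := smul_left_injective ℂ hA h1
  have h3 := (isPrimitiveRoot_omega hm).pow_inj (by omega) (by omega) h2
  have h4 : a = a' := Fin.ext (by omega)
  refine ⟨h4, ?_⟩
  rw [← h4, mul_smul_comm, smul_mul_assoc] at h
  exact smul_right_injective _ (pow_ne_zero _ (omega_ne_zero _)) h

/-- Two functions which are the functions `block` of families of diagrams and differ by a permutation
are equal. -/
theorem MultiDiagram.block_eq_of_perm {Λ Λ' : MultiDiagram m₀ n} {σ : Equiv.Perm (Fin n)}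
    (h : ∀ j, Λ.block j = Λ'.block (σ j)) : Λ.block = Λ'.block :=
  block_eq_of_card fun a => by
    rw [← card_block, ← card_block]
    exact Fintype.card_congr (σ.subtypeEquiv fun j => by rw [h])

/-- Every function is the function `block` of a family of diagrams, up to a permutation. -/
theorem MultiDiagram.exists_block_eq (b : Fin n → Fin m₀) :
    ∃ Λ : MultiDiagram m₀ n, ∃ σ : Equiv.Perm (Fin n), ∀ j, Λ.block j = b (σ j) := by
  let Λ : MultiDiagram m₀ n :=
    ⟨fun a => partitionDiagram (Nat.Partition.indiscrete (Fintype.card {j // b j = a})), by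
      simp only [card_partitionDiagram]
      rw [← Fintype.card_sigma, Fintype.card_congr (Equiv.sigmaFiberEquiv b), Fintype.card_fin]⟩
  have hcard : ∀ a, Fintype.card {j // Λ.block j = a} = Fintype.card {j // b j = a} := fun a => by
    rw [card_block]; exact card_partitionDiagram _
  exact ⟨Λ, Equiv.ofFiberEquiv fun a => Fintype.equivOfCardEq (hcard a),
    fun j => (Equiv.ofFiberEquiv_map _ j).symm⟩

end Separation

/-! ### Occurrence of the representations `P_γ` -/

section Occurrence

variable {m₀ n : ℕ}

theorem U_induction {p : U m₀ n → Prop} (h1 : p 1) (hmul : ∀ u v, p u → p v → p (u * v))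
    (hinv : ∀ u, p u → p u⁻¹) (hz : p (.of .z, 1)) (hz3 : p (1, -1)) (heta : ∀ j, p (etaU m₀ j))
    (u : U m₀ n) : p u := by
  let H : Subgroup (U m₀ n) :=
    { carrier := {u | p u}, one_mem' := h1, mul_mem' := fun {a b} ha hb => hmul a b ha hb,
      inv_mem' := fun {a} ha => hinv a ha }
  have h2 : ∀ d, (d, 1) ∈ H := PresentedGroup.generated_by (dRels m₀ n)
    (H.comap (MonoidHom.inl (DHat m₀ n) ℤˣ)) (by
      rintro (_ | j)
      · exact hz
      · exact heta j)
  have h3 : ∀ ε : ℤˣ, (1, ε) ∈ H := by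
    intro ε
    rcases Int.units_eq_one_or ε with rfl | rfl
    · exact h1
    · exact hz3
  have := H.mul_mem (h2 u.1) (h3 u.2)
  rwa [Prod.mk_mul_mk, mul_one, one_mul] at this

variable {V : Type*} [AddCommGroup V] [Module ℂ V] {σ : Representation ℂ (RGroup m₀ n) V}

/-- The representation of `U'` with `η̂ⱼ ↦ ω^{b_j} y_j` occurs in the restriction of `σ`. -/
def Occurs (σ : Representation ℂ (RGroup m₀ n) V) (b : Fin n → Fin m₀) (y : ℕ → Mat (n / 2)) :
    Prop :=
  ∃ f : ((Fin (n / 2) → Fin 2) → ℂ) →ₗ[ℂ] V, f ≠ 0 ∧ ∀ (j : Fin n) x,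
    f ((omega m₀ ^ (b j : ℕ) • y j).mulVec x) = σ (SemidirectProduct.inl (etaU m₀ j)) (f x)

theorem Occurs.exists_mem_multiplicity (hσ : HasSpinType σ (-1) (-1) 1) {b : Fin n → Fin m₀}
    {y : ℕ → Mat (n / 2)} (h : Occurs σ b y) (D : SpinDatum m₀ n)
    (hD : ∀ j, scaledY m₀ D.γ j = omega m₀ ^ (b j : ℕ) • y j) :
    ∃ f ∈ D.multiplicity σ, f ≠ 0 := by
  obtain ⟨f, hf0, hf⟩ := h
  refine ⟨f, fun u => ?_, hf0⟩
  induction u using U_induction with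
  | h1 => intro x; rw [map_one, map_one, map_one]; rfl
  | hmul u v hu hv =>
    intro x
    rw [map_mul, map_mul, map_mul, Module.End.mul_apply, Module.End.mul_apply, hu, hv]
  | hinv u hu =>
    intro x
    have h1 : PRep m₀ D.γ u (PRep m₀ D.γ u⁻¹ x) = x := by
      rw [← Module.End.mul_apply, ← map_mul, mul_inv_cancel, map_one]; rfl
    conv_rhs => rw [← h1]
    rw [hu, ← Module.End.mul_apply, ← map_mul, ← map_mul, inv_mul_cancel, map_one, map_one]
    rfl
  | hz =>
    intro x
    have h1 : σ (SemidirectProduct.inl (.of .z, 1)) = (-1 : ℂ) • LinearMap.id := hσ.2.1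
    rw [h1, PRep_apply]
    change f ((P m₀ D.γ (.of .z) : Mat (n / 2)).mulVec x) = _
    rw [P_z, Matrix.neg_mulVec, Matrix.one_mulVec, map_neg]
    exact (neg_one_smul ℂ _).symm
  | hz3 =>
    intro x
    have h1 : σ (SemidirectProduct.inl (1, -1)) = (1 : ℂ) • LinearMap.id := hσ.2.2
    rw [h1, PRep_apply]
    change f ((P m₀ D.γ 1 : Mat (n / 2)).mulVec x) = _
    rw [map_one, Units.val_one, Matrix.one_mulVec, one_smul]
    rfl
  | heta j =>
    intro x
    rw [← hf, PRep_apply, ← hD]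
    exact congrArg (fun A : Mat (n / 2) => f (A.mulVec x)) (P_eta m₀ D.γ j)

theorem apply_inl_sign (hσ : HasSpinType σ (-1) (-1) 1) (d : DHat m₀ n) (ε : ℤˣ) :
    σ (SemidirectProduct.inl (d, ε)) = σ (SemidirectProduct.inl (d, 1)) := by
  rcases Int.units_eq_one_or ε with rfl | rfl
  · rfl
  · have h1 : σ (SemidirectProduct.inl (1, -1)) = (1 : ℂ) • LinearMap.id := hσ.2.2
    have h2 : ((d, -1) : U m₀ n) = (d, 1) * (1, -1) := by simp
    rw [h2, map_mul, map_mul, h1, one_smul]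
    rfl

/-- Translation by an element of `𝔖̃ₙ`. -/
theorem Occurs.translate (hσ : HasSpinType σ (-1) (-1) 1) {b : Fin n → Fin m₀}
    {y y' : ℕ → Mat (n / 2)} (h : Occurs σ b y) (t : STilde n) (B : (Mat (n / 2))ˣ)
    (hB : ∀ j : Fin n, (B : Mat (n / 2)) * y' j = y (PhiS n t j) * B) :
    Occurs σ (fun j => b (PhiS n t j)) y' := by
  obtain ⟨f, hf0, hf⟩ := h
  refine ⟨σ (SemidirectProduct.inr t⁻¹) ∘ₗ f ∘ₗ Matrix.toLin' (B : Mat (n / 2)), ?_, ?_⟩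
  · intro h0
    apply hf0
    refine LinearMap.ext fun x => ?_
    have h1 := LinearMap.congr_fun h0 (((B⁻¹ : (Mat (n / 2))ˣ) : Mat (n / 2)).mulVec x)
    have h2 : σ (SemidirectProduct.inr t⁻¹) (f x) = 0 := by
      rw [LinearMap.comp_apply, LinearMap.comp_apply, Matrix.toLin'_apply, Matrix.mulVec_mulVec,
        Units.mul_inv, Matrix.one_mulVec] at h1
      exact h1
    have h3 := congrArg (σ (SemidirectProduct.inr t)) h2
    rwa [← Module.End.mul_apply, ← map_mul, ← map_mul, mul_inv_cancel, map_one, map_one,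
      map_zero] at h3
  · intro j x
    have h1 : (SemidirectProduct.inl (etaU m₀ j) * SemidirectProduct.inr t⁻¹ : RGroup m₀ n) =
        SemidirectProduct.inr t⁻¹ * SemidirectProduct.inl (act m₀ n t (etaU m₀ j)) := by
      ext1 <;> simp
    simp only [LinearMap.comp_apply, Matrix.toLin'_apply]
    rw [← Module.End.mul_apply, ← map_mul, h1, map_mul, Module.End.mul_apply, act_etaU,
      apply_inl_sign hσ, ← hf, Matrix.mulVec_mulVec, Matrix.mulVec_mulVec, mul_smul_comm, hB,
      smul_mul_assoc]

/-- A module over the full matrix algebra contains the standard module. -/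
theorem exists_map_of_algHom {I M : Type*} [Fintype I] [DecidableEq I] [AddCommGroup M]
    [Module ℂ M] [Nontrivial M] (θ : Matrix I I ℂ →ₐ[ℂ] Module.End ℂ M) :
    ∃ f : (I → ℂ) →ₗ[ℂ] M, f ≠ 0 ∧ ∀ A x, f (A.mulVec x) = θ A (f x) := by
  obtain ⟨v, hv⟩ := exists_ne (0 : M)
  have : ∃ i, θ (Matrix.single i i 1) v ≠ 0 := by
    by_contra h
    push Not at h
    apply hv
    have h1 : θ (∑ i, Matrix.single i i 1) v = 0 := by
      rw [map_sum, LinearMap.sum_apply, Finset.sum_eq_zero fun i _ => h i]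
    have h2 : (∑ i : I, Matrix.single i i (1 : ℂ)) = 1 := Matrix.sum_single_one
    rwa [h2, map_one] at h1
  obtain ⟨i, hi⟩ := this
  let f : (I → ℂ) →ₗ[ℂ] M :=
    { toFun := fun x => θ (Matrix.vecMulVec x (Pi.single i 1)) v
      map_add' := fun x y => by rw [Matrix.add_vecMulVec, map_add, LinearMap.add_apply]
      map_smul' := fun c x => by rw [Matrix.smul_vecMulVec, map_smul, LinearMap.smul_apply]; rfl }
  have hf : ∀ x, f x = θ (Matrix.vecMulVec x (Pi.single i 1)) v := fun _ => rfl
  refine ⟨f, fun h0 => hi ?_, fun A x => ?_⟩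
  · have := LinearMap.congr_fun h0 (Pi.single i 1)
    rwa [hf, ← Matrix.single_eq_single_vecMulVec_single] at this
  · rw [hf, hf, ← Matrix.mul_vecMulVec, map_mul, Module.End.mul_apply]

end Occurrence

section Existence

theorem ySign_of_lt {k j : ℕ} (h : j < 2 * k) (ε : Bool) : ySign k ε j = Y k j := by
  cases ε
  · rw [ySign, YMinus, Y_anti k (2 * k) j (by omega) le_rfl (by omega), neg_mul, neg_neg, mul_assoc,
      Y_sq, mul_one]
  · rfl

theorem ySign_last (k : ℕ) (ε : Bool) : ySign k ε (2 * k) = signOf ε • Y k (2 * k) := by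
  cases ε
  · rw [ySign, YMinus, mul_assoc, Y_sq, mul_one, signOf, neg_one_smul]
  · rw [signOf, one_smul]; rfl

/-- A system of `2k + 1` anticommuting involutions whose product is a scalar is the image of
`Y_1, …, Y_{2k}, ±Y_{2k+1}`. -/
theorem exists_ySign {R : Type*} [Ring R] [Algebra ℂ R] [Nontrivial R] {k : ℕ}
    (θ : Mat k →ₐ[ℂ] R) {x : ℕ → R} (hθ : ∀ j < 2 * k, θ (Y k j) = x j)
    (h1 : x (2 * k) * x (2 * k) = 1) {t : ℂ} (ht : orderedProd x (2 * k + 1) = t • 1) :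
    ∃ ε, ∀ j < 2 * k + 1, θ (ySign k ε j) = x j := by
  obtain ⟨s, hs, hsY⟩ := orderedProd_Y k
  set y := θ (Y k (2 * k)) with hy
  have hyy : y * y = 1 := by rw [hy, ← map_mul, Y_sq, map_one]
  have hq : θ (orderedProd (Y k) (2 * k)) = s • y := by
    have : orderedProd (Y k) (2 * k) = s • Y k (2 * k) := by
      rw [orderedProd_succ] at hsY
      have := congrArg (· * Y k (2 * k)) hsY
      simpa [mul_assoc, Y_sq] using this
    rw [this, map_smul]
  have hx : θ (orderedProd (Y k) (2 * k)) = orderedProd x (2 * k) := by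
    refine (map_orderedProd (θ : Mat k →+* R) (Y k) (2 * k)).trans ?_
    rw [orderedProd, orderedProd]
    congr 1
    exact List.map_congr_left fun j hj => hθ j (List.mem_range.1 hj)
  rw [orderedProd_succ, ← hx, hq] at ht
  have h2 : x (2 * k) = (s⁻¹ * t) • y := by
    have := congrArg (fun r => s⁻¹ • (y * r)) ht
    simp only [smul_mul_assoc, mul_smul_comm, ← mul_assoc, hyy, one_mul, mul_one, smul_smul,
      inv_mul_cancel₀ hs, one_smul] at this
    exact this
  have h3 : (s⁻¹ * t) * (s⁻¹ * t) = 1 := by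
    rw [h2, smul_mul_smul_comm, hyy] at h1
    have h4 : ((s⁻¹ * t) * (s⁻¹ * t) - 1) • (1 : R) = 0 := by rw [sub_smul, h1, one_smul, sub_self]
    exact sub_eq_zero.1 ((smul_eq_zero.1 h4).resolve_right one_ne_zero)
  have h5 : ∃ ε, signOf ε = s⁻¹ * t := by
    rcases mul_self_eq_one_iff.1 h3 with h | h
    · exact ⟨true, h.symm⟩
    · exact ⟨false, h.symm⟩
  obtain ⟨ε, hε⟩ := h5
  refine ⟨ε, fun j hj => ?_⟩
  rcases Nat.lt_succ_iff_lt_or_eq.1 hj with h | rfl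
  · rw [ySign_of_lt h, hθ j h]
  · rw [ySign_last, map_smul, hε, h2]

variable {m₀ n : ℕ} {V : Type*} [AddCommGroup V] [Module ℂ V]
  {σ : Representation ℂ (RGroup m₀ n) V}

/-- In an irreducible representation of `U'` with `z₂ ↦ -1`, `z₃ ↦ 1`, an operator which commutes with
all generators is a scalar. -/
theorem exists_scalar_of_commute (hm : 0 < m₀) {τ : Representation ℂ (U m₀ n) V}
    (hτ : τ.IsIrreducible) (hz : τ (.of .z, 1) = -1) (hz3 : τ (1, -1) = 1) (q : Module.End ℂ V)
    (hq : ∀ j, q * τ (etaU m₀ j) = τ (etaU m₀ j) * q) : ∃ c : ℂ, q = c • 1 := by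
  have := finite_DHat (n := n) hm
  have key : ∀ u, q * τ u = τ u * q := by
    intro u
    induction u using U_induction with
    | h1 => rw [map_one, mul_one, one_mul]
    | hmul u v hu hv => rw [map_mul, ← mul_assoc, hu, mul_assoc, hv, mul_assoc]
    | hinv u hu =>
      have h1 : τ u * τ u⁻¹ = 1 := by rw [← map_mul, mul_inv_cancel, map_one]
      have h2 : τ u⁻¹ * τ u = 1 := by rw [← map_mul, inv_mul_cancel, map_one]
      calc q * τ u⁻¹ = τ u⁻¹ * (τ u * q) * τ u⁻¹ := by rw [← mul_assoc, h2, one_mul]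
        _ = τ u⁻¹ * q := by rw [← hu, mul_assoc, mul_assoc, h1, mul_one]
    | hz => rw [hz, mul_neg, neg_mul, mul_one, one_mul]
    | hz3 => rw [hz3, mul_one, one_mul]
    | heta j => exact hq j
  obtain ⟨c, hc⟩ := schur_scalar hτ q fun u v => LinearMap.congr_fun (key u) v
  exact ⟨c, LinearMap.ext hc⟩

theorem exists_anticomm (hm : 0 < m₀) [Nontrivial V] {τ : Representation ℂ (U m₀ n) V}
    (hτ : τ.IsIrreducible) (hz : τ (.of .z, 1) = -1) (hz3 : τ (1, -1) = 1) :
    ∃ b : Fin n → Fin m₀, ∃ x : ℕ → Module.End ℂ V, (∀ i < n, x i * x i = 1) ∧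
      (∀ i j, i < n → j < n → i ≠ j → x i * x j = -(x j * x i)) ∧
      ∀ j : Fin n, τ (etaU m₀ j) = omega m₀ ^ (b j : ℕ) • x j := by
  have hanti : ∀ i j : Fin n, i ≠ j →
      τ (etaU m₀ i) * τ (etaU m₀ j) = -(τ (etaU m₀ j) * τ (etaU m₀ i)) := by
    intro i j hij
    have h1 : etaU m₀ i * etaU m₀ j = (.of .z, 1) * (etaU m₀ j * etaU m₀ i) := by
      refine Prod.ext ?_ (by simp)
      change _ = PresentedGroup.of DGen.z * (PresentedGroup.of (.eta j) * PresentedGroup.of (.eta i))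
      rw [← mul_assoc]
      exact eta_comm i j hij
    rw [← map_mul, h1, map_mul, map_mul, hz, neg_one_mul]
  have hsq : ∀ j, ∃ c : ℂ, τ (etaU m₀ j) * τ (etaU m₀ j) = c • 1 := fun j =>
    exists_scalar_of_commute hm hτ hz hz3 _ fun i => by
      by_cases hij : i = j
      · rw [hij, mul_assoc]
      · rw [mul_assoc, hanti j i (Ne.symm hij), mul_neg, ← mul_assoc, hanti j i (Ne.symm hij),
          neg_mul, neg_neg, mul_assoc]
  choose c hc using hsq
  have hcm : ∀ j, c j ^ m₀ = 1 := by
    intro j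
    have h1 : τ (etaU m₀ j) ^ (2 * m₀) = 1 := by
      rw [← map_pow, show (etaU m₀ j) ^ (2 * m₀) = 1 from Prod.ext (eta_pow j) (one_pow _), map_one]
    rw [pow_mul, sq, hc, smul_pow, one_pow] at h1
    have h2 : (c j ^ m₀ - 1) • (1 : Module.End ℂ V) = 0 := by rw [sub_smul, h1, one_smul, sub_self]
    exact sub_eq_zero.1 ((smul_eq_zero.1 h2).resolve_right one_ne_zero)
  have hprim : IsPrimitiveRoot (omega m₀ ^ 2) m₀ :=
    (isPrimitiveRoot_omega hm).pow (by omega) rfl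
  have : NeZero m₀ := ⟨hm.ne'⟩
  choose b hb hbc using fun j => hprim.eq_pow_of_pow_eq_one (hcm j)
  refine ⟨fun j => ⟨b j, hb j⟩, fun j => if h : j < n then
    (omega m₀ ^ b ⟨j, h⟩)⁻¹ • τ (etaU m₀ ⟨j, h⟩) else 1, ?_, ?_, ?_⟩
  · intro i hi
    have h0 := pow_ne_zero (b ⟨i, hi⟩) (omega_ne_zero m₀)
    simp only [dif_pos hi]
    rw [smul_mul_smul_comm, hc, ← hbc, smul_smul, ← pow_mul, mul_comm 2, pow_mul, sq, ← mul_inv,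
      inv_mul_cancel₀ (mul_ne_zero h0 h0), one_smul]
  · intro i j hi hj hij
    simp only [dif_pos hi, dif_pos hj]
    rw [smul_mul_smul_comm, smul_mul_smul_comm, hanti _ _ (by simpa using hij), smul_neg, mul_comm]
  · intro j
    simp only [Fin.is_lt, dif_pos, Fin.eta]
    rw [smul_smul, mul_inv_cancel₀ (pow_ne_zero _ (omega_ne_zero m₀)), one_smul]

/-- Every representation of spin type `(-1, -1, 1)` contains some `P^ε_γ`, with `ε = +` for even
`n`. -/
theorem exists_occurs (hm : 0 < m₀) [Nontrivial V] (hσ : HasSpinType σ (-1) (-1) 1) :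
    ∃ (b : Fin n → Fin m₀) (ε : Bool), (Even n → ε = true) ∧ Occurs σ b (ySign (n / 2) ε) := by
  have := finite_DHat (n := n) hm
  obtain ⟨M, hM⟩ := exists_irreducible_stable
    (σ.comp SemidirectProduct.inl : Representation ℂ (U m₀ n) V)
  have hne : Nontrivial M.toSubmodule := IsIrreducible.nontrivial hM
  have hz : M.toRepresentation (.of .z, 1) = -1 := by
    refine LinearMap.ext fun v => Subtype.ext ?_
    have h1 : σ (SemidirectProduct.inl (.of .z, 1)) = (-1 : ℂ) • LinearMap.id := hσ.2.1
    exact (LinearMap.congr_fun h1 (v : V)).trans (neg_one_smul ℂ (v : V))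
  have hz3 : M.toRepresentation (1, -1) = 1 := by
    refine LinearMap.ext fun v => Subtype.ext ?_
    have h1 : σ (SemidirectProduct.inl (1, -1)) = (1 : ℂ) • LinearMap.id := hσ.2.2
    exact (LinearMap.congr_fun h1 (v : V)).trans (one_smul ℂ (v : V))
  obtain ⟨b, x, h1, h2, hx⟩ := exists_anticomm hm hM hz hz3
  obtain ⟨θ, hθ⟩ := exists_algHom_of_anticomm (k := n / 2) x (fun i hi => h1 i (by omega))
    fun i j hi hj hij => h2 i j (by omega) (by omega) hij
  have hε : ∃ ε : Bool, (Even n → ε = true) ∧ ∀ j < n, θ (ySign (n / 2) ε j) = x j := by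
    rcases Nat.even_or_odd n with he | ho
    · have := Nat.div_mul_cancel he.two_dvd
      exact ⟨true, fun _ => rfl, fun j hj => hθ j (by omega)⟩
    · have hn : 2 * (n / 2) + 1 = n := Nat.two_mul_div_two_add_one_of_odd ho
      obtain ⟨t, ht⟩ := exists_scalar_of_commute hm hM hz hz3
        (orderedProd x (2 * (n / 2) + 1)) fun j => by
          rw [hx, mul_smul_comm, smul_mul_assoc, commute_orderedProd h2 hn.le (by omega)]
      obtain ⟨ε, hε⟩ := exists_ySign θ hθ (h1 _ (by omega)) ht
      exact ⟨ε, fun he => absurd ho (Nat.not_odd_iff_even.2 he), fun j hj => hε j (by omega)⟩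
  obtain ⟨ε, hev, hε⟩ := hε
  obtain ⟨f, hf0, hf⟩ := exists_map_of_algHom θ
  refine ⟨b, ε, hev, M.toSubmodule.subtype ∘ₗ f, fun h0 => hf0 ?_, fun j v => ?_⟩
  · exact LinearMap.ext fun v => Subtype.ext (LinearMap.congr_fun h0 v)
  · have h3 : f ((omega m₀ ^ (b j : ℕ) • ySign (n / 2) ε j).mulVec v) =
        M.toRepresentation (etaU m₀ j) (f v) := by
      rw [hf, map_smul, hε j j.2, hx]
    exact congrArg Subtype.val h3

end Existence

/-! ### The inducing data -/

section Data

variable {m₀ n : ℕ}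

/-- The data of `Π^II` for even `n`. -/
def evenDatum (he : Even n) (blk : Fin n → Fin m₀) : SpinDatum m₀ n where
  γ j := blk j
  S := youngSub blk
  J := nablaII he
  intertwines s hs := intertwine _ _ _ fun j => by
    have h : blk (PhiS n s j) = blk j := hs j
    simp only [scaledY, smul_mul_assoc, mul_smul_comm, nablaII_Y he s, h]
  J_z := spinLift_z ..

theorem scaledY_gammaSign (ho : Odd n) (Λ : MultiDiagram m₀ n) (ε : Bool) (j : Fin n) :
    scaledY m₀ (gammaSign m₀ Λ.gamma ε) j = omega m₀ ^ (Λ.block j : ℕ) • ySign (n / 2) ε j := by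
  cases ε
  · exact scaledY_tauLast ho Λ j
  · rfl

/-- The data of `Π^{℧ε}` for odd `n`. -/
def oddDatum (ho : Odd n) (blk : Fin n → Fin m₀) (h : ∃ Λ : MultiDiagram m₀ n, Λ.block = blk)
    (ε : Bool) : SpinDatum m₀ n where
  γ := gammaSign m₀ (fun j => blk j) ε
  S := altSub blk
  J := nablaSign n ε
  intertwines := by
    obtain ⟨Λ, rfl⟩ := h
    exact intertwine_odd ho Λ ε
  J_z := by
    cases ε
    · rw [nablaSign, nabla'', spinLift_z]
    · rw [nablaSign, nabla', spinLift_z]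

theorem evenDatum_injective (he : Even n) :
    Function.Injective (evenDatum he : (Fin n → Fin m₀) → SpinDatum m₀ n) := fun _ _ h =>
  funext fun j => Fin.ext (congrFun (congrArg SpinDatum.γ h) j)

theorem evenDatum_separated (hm : 0 < m₀) (he : Even n) {Λ Λ' : MultiDiagram m₀ n} :
    (evenDatum he Λ.block).Separated (evenDatum he Λ'.block) := by
  rintro g ⟨e⟩
  obtain ⟨A, hA, h⟩ := exists_matrix_of_equiv e
  have h1 : ∀ j, Λ.block j = Λ'.block (PhiS n g.right j) := fun j =>
    (eq_of_scaled_mul hm hA (Y_sq _ _) (Y_sq _ _) (h j)).1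
  have h2 := MultiDiagram.block_eq_of_perm h1
  exact ⟨by rw [h2], fun j => by rw [← h1, h2]⟩

theorem nablaSign_ySign (ε : Bool) (s : STilde n) (j : Fin n) :
    (nablaSign n ε s : Mat (n / 2)) * ySign (n / 2) ε j =
      (((Equiv.Perm.sign (PhiS n s) : ℤˣ) : ℤ) : ℂ) •
        (ySign (n / 2) ε (PhiS n s j) * nablaSign n ε s) := by
  cases ε
  · exact nabla''_Y s j
  · exact nabla'_Y s j

theorem evenDatum_cover (hm : 0 < m₀) (he : Even n) {V : Type*} [AddCommGroup V] [Module ℂ V]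
    [Nontrivial V] {σ : Representation ℂ (RGroup m₀ n) V} (hσ : HasSpinType σ (-1) (-1) 1) :
    ∃ Λ : MultiDiagram m₀ n, ∃ f ∈ (evenDatum he Λ.block).multiplicity σ, f ≠ 0 := by
  obtain ⟨b, ε, hε, h⟩ := exists_occurs hm hσ
  obtain rfl := hε he
  obtain ⟨Λ, π, hπ⟩ := MultiDiagram.exists_block_eq b
  obtain ⟨t, rfl⟩ := PhiS_surjective π
  obtain ⟨f, hf⟩ := (h.translate hσ t (nablaII he t) (nablaII_Y he t)).exists_mem_multiplicity hσ
    (evenDatum he Λ.block) fun j => by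
      rw [← hπ]; rfl
  exact ⟨Λ, f, hf⟩

/-- Translation by an even element keeps `ε`. -/
theorem Occurs.translate_even {V : Type*} [AddCommGroup V] [Module ℂ V]
    {σ : Representation ℂ (RGroup m₀ n) V} (hσ : HasSpinType σ (-1) (-1) 1) {b : Fin n → Fin m₀}
    {ε : Bool} (h : Occurs σ b (ySign (n / 2) ε)) {t : STilde n}
    (ht : Equiv.Perm.sign (PhiS n t) = 1) :
    Occurs σ (fun j => b (PhiS n t j)) (ySign (n / 2) ε) :=
  h.translate hσ t (nablaSign n ε t) fun j => by
    rw [nablaSign_ySign, ht]; simp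

/-- Translation by an odd element exchanges the two values of `ε`. -/
theorem Occurs.translate_odd {V : Type*} [AddCommGroup V] [Module ℂ V]
    {σ : Representation ℂ (RGroup m₀ n) V} (hσ : HasSpinType σ (-1) (-1) 1) {b : Fin n → Fin m₀}
    {ε : Bool} (h : Occurs σ b (ySign (n / 2) ε)) {t : STilde n}
    (ht : Equiv.Perm.sign (PhiS n t) = -1) :
    Occurs σ (fun j => b (PhiS n t j)) (ySign (n / 2) (!ε)) :=
  h.translate hσ t (nablaSign n ε t * invol (Ylast n) (Y_sq _ _)) fun j => by
    change (nablaSign n ε t : Mat (n / 2)) * Ylast n * _ = _ * (nablaSign n ε t * Ylast n)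
    rw [mul_assoc, Ylast_mul_ySign, mul_neg, ← mul_assoc, nablaSign_ySign, ht]
    simp [mul_assoc]

theorem Occurs.exists_sign {V : Type*} [AddCommGroup V] [Module ℂ V]
    {σ : Representation ℂ (RGroup m₀ n) V} (hσ : HasSpinType σ (-1) (-1) 1) {b : Fin n → Fin m₀}
    {ε : Bool} (h : Occurs σ b (ySign (n / 2) ε)) (t : STilde n) :
    ∃ ε', Occurs σ (fun j => b (PhiS n t j)) (ySign (n / 2) ε') := by
  rcases Int.units_eq_one_or (Equiv.Perm.sign (PhiS n t)) with ht | ht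
  · exact ⟨ε, h.translate_even hσ ht⟩
  · exact ⟨!ε, h.translate_odd hσ ht⟩

/-- For odd `n`, the sign `-` is only needed for functions without an odd permutation preserving the
fibres. -/
theorem oddDatum_cover (hm : 0 < m₀) (ho : Odd n) {V : Type*} [AddCommGroup V] [Module ℂ V]
    [Nontrivial V] {σ : Representation ℂ (RGroup m₀ n) V} (hσ : HasSpinType σ (-1) (-1) 1) :
    ∃ (Λ : MultiDiagram m₀ n) (ε : Bool), (ε = true ∨ Λ.QuasiTrivial) ∧
      ∃ f ∈ (oddDatum ho Λ.block ⟨Λ, rfl⟩ ε).multiplicity σ, f ≠ 0 := by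
  obtain ⟨b, ε, -, h⟩ := exists_occurs hm hσ
  obtain ⟨Λ, π, hπ⟩ := MultiDiagram.exists_block_eq b
  obtain ⟨t, rfl⟩ := PhiS_surjective π
  obtain ⟨ε, h⟩ := h.exists_sign hσ t
  rw [← funext hπ] at h
  have key : ∀ ε, Occurs σ Λ.block (ySign (n / 2) ε) →
      ∃ f ∈ (oddDatum ho Λ.block ⟨Λ, rfl⟩ ε).multiplicity σ, f ≠ 0 := fun ε h =>
    h.exists_mem_multiplicity hσ _ (scaledY_gammaSign ho Λ ε)
  cases ε
  · by_cases hq : Λ.QuasiTrivial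
    · exact ⟨Λ, false, Or.inr hq, key _ h⟩
    · obtain ⟨τ, hτ⟩ := MultiDiagram.exists_youngSign_eq hq rfl
      obtain ⟨t, ht⟩ := PhiS_surjective (τ : Equiv.Perm (Fin n))
      have h' := h.translate_odd hσ (t := t) (by rw [ht]; exact hτ)
      rw [ht, show (fun j => Λ.block ((τ : Equiv.Perm (Fin n)) j)) = Λ.block from
        funext τ.2] at h'
      exact ⟨Λ, true, Or.inl rfl, key _ h'⟩
  · exact ⟨Λ, true, Or.inl rfl, key _ h⟩

theorem signOf_injective : Function.Injective signOf := by
  intro ε ε' h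
  cases ε <;> cases ε' <;> simp [signOf] at h ⊢ <;> norm_num at h

theorem MultiDiagram.QuasiTrivial.block_injective {Λ : MultiDiagram m₀ n} (h : Λ.QuasiTrivial) :
    Function.Injective Λ.block := by
  intro i j hij
  have := Fintype.card_le_one_iff_subsingleton.1 ((card_block Λ (Λ.block j)).le.trans (h _))
  exact congrArg Subtype.val (Subsingleton.elim (α := {i // Λ.block i = Λ.block j}) ⟨i, hij⟩ ⟨j, rfl⟩)

/-- An element conjugating two of the representations preserves the blocks. After composition with
`∇'_n` or `∇''_n` it commutes or anticommutes with all the matrices, so that the scalar by which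
their product acts shows that it is even and that the signs agree. -/
theorem oddDatum_separated (hm : 0 < m₀) (ho : Odd n) {Λ Λ' : MultiDiagram m₀ n} {ε ε' : Bool}
    (hΛ : ε = true ∨ Λ.QuasiTrivial) (hΛ' : ε' = true ∨ Λ'.QuasiTrivial) :
    (oddDatum ho Λ.block ⟨Λ, rfl⟩ ε).Separated (oddDatum ho Λ'.block ⟨Λ', rfl⟩ ε') := by
  rintro g ⟨e⟩
  obtain ⟨A, hA, h⟩ := exists_matrix_of_equiv e
  have h0 : ∀ j : Fin n, Λ.block j = Λ'.block (PhiS n g.right j) ∧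
      A * ySign (n / 2) ε j = ySign (n / 2) ε' (PhiS n g.right j) * A := fun j => by
    have hj : A * scaledY m₀ (gammaSign m₀ Λ.gamma ε) j =
      scaledY m₀ (gammaSign m₀ Λ'.gamma ε') (PhiS n g.right j) * A := h j
    rw [scaledY_gammaSign ho, scaledY_gammaSign ho] at hj
    exact eq_of_scaled_mul hm hA (ySign_sq _ _ _) (ySign_sq _ _ _) hj
  have h1 := fun j => (h0 j).1
  have h2 := MultiDiagram.block_eq_of_perm h1
  have h3 : PhiS n g.right ∈ youngSub Λ'.block := fun j => by rw [← h1, h2]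
  -- comparing the products of the matrices
  obtain ⟨B, hB, hBA⟩ : ∃ B : Mat (n / 2), B ≠ 0 ∧ A = nablaSign n ε' g.right * B :=
    ⟨((nablaSign n ε' g.right)⁻¹ : (Mat (n / 2))ˣ) * A,
      fun h => hA ((Units.mul_right_eq_zero _).1 h), (Units.mul_inv_cancel_left _ _).symm⟩
  set c : ℂ := (((Equiv.Perm.sign (PhiS n g.right) : ℤˣ) : ℤ) : ℂ) with hc
  have hcc : c * c = 1 := by
    rw [hc, ← Int.cast_mul, ← Units.val_mul, Int.units_mul_self]; simp
  have h4 : ∀ j : Fin n, B * ySign (n / 2) ε j = c • (ySign (n / 2) ε' j * B) := by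
    intro j
    have h5 := (h0 j).2
    have h6 : ySign (n / 2) ε' (PhiS n g.right j) * (nablaSign n ε' g.right : Mat (n / 2)) =
        c • ((nablaSign n ε' g.right : Mat (n / 2)) * ySign (n / 2) ε' j) := by
      rw [nablaSign_ySign, smul_smul, hcc, one_smul]
    rw [hBA, ← mul_assoc, h6, smul_mul_assoc, mul_assoc, mul_assoc, ← mul_smul_comm] at h5
    exact (Units.mul_right_inj _).1 h5
  have hn : 2 * (n / 2) + 1 = n := Nat.two_mul_div_two_add_one_of_odd ho
  obtain ⟨s, hs, hprod⟩ := orderedProd_ySign (n / 2)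
  have h7 := mul_orderedProd_of_mul (x := ySign (n / 2) ε) (y := ySign (n / 2) ε') (B := B)
    (m := 2 * (n / 2) + 1) fun j hj => h4 ⟨j, by omega⟩
  have h8 : c ^ (2 * (n / 2) + 1) = c := by rw [pow_succ, pow_mul, sq, hcc, one_pow, one_mul]
  rw [hprod, hprod, h8, mul_smul_comm, mul_one, smul_mul_assoc, one_mul, smul_smul] at h7
  have h9 : signOf ε = c * signOf ε' := by
    have := smul_left_injective ℂ hB h7
    exact mul_right_cancel₀ hs (this.trans (mul_assoc _ _ _).symm)
  have h10 : ε = ε' ∧ Equiv.Perm.sign (PhiS n g.right) = 1 := by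
    have hone : PhiS n g.right = 1 → ε = ε' ∧ Equiv.Perm.sign (PhiS n g.right) = 1 := by
      intro hg
      refine ⟨signOf_injective ?_, by rw [hg, map_one]⟩
      rw [h9, hc, hg]
      simp
    have hqt : Function.Injective Λ'.block → PhiS n g.right = 1 := fun hinj =>
      Equiv.ext fun j => hinj (h3 j)
    rcases hΛ with rfl | hΛ
    · rcases hΛ' with rfl | hΛ'
      · refine ⟨rfl, ?_⟩
        rcases Int.units_eq_one_or (Equiv.Perm.sign (PhiS n g.right)) with h | h
        · exact h
        · rw [hc, h] at h9
          norm_num [signOf] at h9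
      · exact hone (hqt hΛ'.block_injective)
    · exact hone (hqt (h2 ▸ hΛ.block_injective))
  obtain ⟨rfl, h11⟩ := h10
  refine ⟨by simp only [h2], h11, h3⟩

end Data

/-! ### The classification -/

section Classification

variable {m₀ n : ℕ}

/-- The classification for even `n`. -/
theorem isCompleteSetOfReps_even.{w} (hm : 0 < m₀) (he : Even n) :
    IsCompleteSetOfReps.{w} (-1) (-1) 1 fun Λ : MultiDiagram m₀ n => PiII he Λ := by
  refine SpinDatum.isCompleteSetOfReps.{w} hm
    (Lab := {blk : Fin n → Fin m₀ // ∃ Λ : MultiDiagram m₀ n, Λ.block = blk})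
    (fun l => evenDatum he l.1) ((evenDatum_injective he).comp Subtype.val_injective) ?_ ?_
    (fun Λ : MultiDiagram m₀ n => ⟨Λ.block, Λ, rfl⟩)
    (fun Λ => MultiDiagram.outerOn (Λ := Λ) (blk := Λ.block) rfl)
    (fun Λ => MultiDiagram.outerOn_isIrreducible rfl) ?_ ?_
  · rintro ⟨_, Λ, rfl⟩ ⟨_, Λ', rfl⟩
    exact evenDatum_separated hm he
  · intro V _ _ σ hirr hσ
    have := IsIrreducible.nontrivial hirr
    obtain ⟨Λ, f, hf⟩ := evenDatum_cover hm he hσ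
    exact ⟨⟨Λ.block, Λ, rfl⟩, f, hf⟩
  · intro Λ Λ' _ h e
    exact MultiDiagram.eq_of_outerOn_equiv (congrArg Subtype.val h) rfl e
  · intro l M _ _ _ σ
    obtain ⟨⟨Λ, h⟩, f, hf⟩ := MultiDiagram.outerOn_isExhausting.{w} l.2 M σ
    exact ⟨⟨Λ, Subtype.ext h⟩, f, hf⟩

namespace MultiDiagram

theorem card_eq_of_block {Λ Λ' : MultiDiagram m₀ n} (h : Λ.block = Λ'.block) (a : Fin m₀) :
    (Λ.1 a).card = (Λ'.1 a).card := by
  rw [← card_block, ← card_block, h]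

theorem QuasiTrivial.of_block {Λ Λ' : MultiDiagram m₀ n} (hΛ : Λ.QuasiTrivial)
    (h : Λ.block = Λ'.block) : Λ'.QuasiTrivial := fun a => card_eq_of_block h a ▸ hΛ a

end MultiDiagram

theorem SymDiagram.not_quasiTrivial (Λ : SymDiagram m₀ n) : ¬Λ.1.QuasiTrivial := by
  obtain ⟨a, ha⟩ := Λ.2.2
  exact fun h => absurd (h a) (by omega)

theorem SymDiagram.isSplitting (Λ : SymDiagram m₀ n) : IsSplitting Λ.1.outerAlt Λ.1.constituent :=
  MultiDiagram.constituent_isSplitting Λ.2.1 Λ.not_quasiTrivial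

theorem AsymPair.eq_pair {p : AsymPair m₀ n} {Λ : MultiDiagram m₀ n} (h : Λ ∈ p.1) :
    Λ.transpose ≠ Λ ∧ p.1 = {Λ, Λ.transpose} := by
  obtain ⟨_, Λ₀, h₀, rfl⟩ := p
  rcases h with rfl | rfl
  · exact ⟨h₀, rfl⟩
  · rw [MultiDiagram.transpose_transpose]
    exact ⟨h₀.symm, Set.pair_comm _ _⟩

theorem AsymPair.not_quasiTrivial {p : AsymPair m₀ n} {Λ : MultiDiagram m₀ n} (h : Λ ∈ p.1) :
    ¬Λ.QuasiTrivial := fun hq => (AsymPair.eq_pair h).1 (MultiDiagram.quasiTrivial_transpose hq)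

/-- The parameters of the inducing data for odd `n`: the sign `-` is only allowed for quasi-trivial
families. -/
def OddLabel (m₀ n : ℕ) : Type :=
  {l : (Fin n → Fin m₀) × Bool // ∃ Λ : MultiDiagram m₀ n, Λ.block = l.1 ∧
    (l.2 = true ∨ Λ.QuasiTrivial)}

/-- The data attached to a parameter. -/
def OddLabel.datum (ho : Odd n) (l : OddLabel m₀ n) : SpinDatum m₀ n :=
  oddDatum ho l.1.1 (l.2.imp fun _ h => h.1) l.1.2

theorem OddLabel.exists_eq (l : OddLabel m₀ n) : ∃ (Λ : MultiDiagram m₀ n) (ε : Bool)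
    (hε : ε = true ∨ Λ.QuasiTrivial), l = ⟨(Λ.block, ε), Λ, rfl, hε⟩ := by
  obtain ⟨⟨b, ε⟩, hl⟩ := l
  obtain ⟨Λ, h, hε⟩ := id hl
  change Λ.block = b at h
  subst h
  exact ⟨Λ, ε, hε, rfl⟩

theorem OddLabel.datum_injective (ho : Odd n) :
    Function.Injective (OddLabel.datum ho : OddLabel m₀ n → SpinDatum m₀ n) := by
  rintro ⟨⟨b, ε⟩, hl⟩ ⟨⟨b', ε'⟩, hl'⟩ h
  have hn : 0 < n := ho.pos
  have h1 : ∀ j, gammaSign m₀ (fun j => (b j : ℕ)) ε j = gammaSign m₀ (fun j => (b' j : ℕ)) ε' j :=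
    congrFun (congrArg SpinDatum.γ h)
  have hmod : ∀ (b : Fin n → Fin m₀) ε j,
      gammaSign m₀ (fun j => (b j : ℕ)) ε j % m₀ = b j := by
    intro b ε j
    have hb := (b j).2
    cases ε
    · simp only [gammaSign, tauLast]
      split_ifs
      · rw [Nat.mod_eq_of_lt (show (b j : ℕ) + m₀ < 2 * m₀ by omega), Nat.add_mod_right,
          Nat.mod_eq_of_lt hb]
      · exact Nat.mod_eq_of_lt hb
    · exact Nat.mod_eq_of_lt hb
  have hb : b = b' := funext fun j => Fin.ext (by rw [← hmod b ε, ← hmod b' ε', h1])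
  subst hb
  have h2 := h1 ⟨n - 1, by omega⟩
  have hlast := (b ⟨n - 1, by omega⟩).2
  have h3 : n - 1 + 1 = n := by omega
  have hε : ε = ε' := by
    cases ε <;> cases ε' <;> simp only [gammaSign, tauLast, h3, if_true] at h2 ⊢ <;>
      rw [Nat.mod_eq_of_lt (by omega)] at h2 <;> omega
  subst hε
  rfl

variable (c : (p : AsymPair m₀ n) → p.1)

/-- The index set of the classification for odd `n`. -/
abbrev OddIndex (m₀ n : ℕ) : Type :=
  AsymPair m₀ n ⊕ (SymDiagram m₀ n × Fin 2 ⊕ Bool × TriDiagram m₀ n)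

/-- The parameter of the inducing data of a member of the classification. -/
def OddIndex.label : OddIndex m₀ n → OddLabel m₀ n
  | .inl p => ⟨((c p).1.block, true), (c p).1, rfl, Or.inl rfl⟩
  | .inr (.inl x) => ⟨(x.1.1.block, true), x.1.1, rfl, Or.inl rfl⟩
  | .inr (.inr x) => ⟨(x.2.1.block, x.1), x.2.1, rfl, Or.inr x.2.2⟩

/-- The representation of `𝔄ₙ ∩ 𝔖_ν` attached to a member of the classification. -/
def OddIndex.rep (ho : Odd n) :
    ∀ i : OddIndex m₀ n, Rep.{0} ℂ ((OddIndex.label c i).datum ho).S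
  | .inl p => Rep.of (MultiDiagram.outerAltOn (Λ := (c p).1) (blk := (c p).1.block) rfl)
  | .inr (.inl x) =>
    Rep.of (MultiDiagram.constituentOn (Λ := x.1.1) (blk := x.1.1.block) rfl x.2)
  | .inr (.inr x) => Rep.of (Representation.trivial ℂ (altSub x.2.1.block) ℂ)

theorem OddIndex.rep_isIrreducible (ho : Odd n) (i : OddIndex m₀ n) :
    (OddIndex.rep c ho i).ρ.IsIrreducible := by
  rcases i with p | x | x
  · exact MultiDiagram.outerAltOn_isIrreducible
      (MultiDiagram.exists_youngSign_eq (AsymPair.not_quasiTrivial (c p).2) rfl) rfl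
      (AsymPair.eq_pair (c p).2).1
  · exact MultiDiagram.constituentOn_isIrreducible x.1.isSplitting rfl x.2
  · change (Representation.trivial ℂ (altSub x.2.1.block) ℂ).IsIrreducible
    rw [isIrreducible_iff]
    exact ⟨inferInstance, fun Y _ => eq_bot_or_eq_top Y⟩

/-- Members of the classification with the same inducing data are distinguished by their
representations of `𝔄ₙ ∩ 𝔖_ν`. -/
theorem OddIndex.eq_of_equiv (ho : Odd n) (i j : OddIndex m₀ n)
    (h : ((OddIndex.label c j).datum ho).S ≤ ((OddIndex.label c i).datum ho).S)
    (hL : OddIndex.label c i = OddIndex.label c j)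
    (e : Nonempty (Representation.Equiv ((OddIndex.rep c ho i).ρ.comp (Subgroup.inclusion h) :
      Representation ℂ ((OddIndex.label c j).datum ho).S _) (OddIndex.rep c ho j).ρ)) : i = j := by
  have hL1 := congrArg (fun l : OddLabel m₀ n => l.1.1) hL
  have hL2 := congrArg (fun l : OddLabel m₀ n => l.1.2) hL
  rcases i with p | x | x <;> rcases j with q | y | y
  · have hL1 : (c p).1.block = (c q).1.block := hL1
    obtain ⟨e⟩ : Nonempty ((MultiDiagram.outerAltOn hL1).Equiv
      (MultiDiagram.outerAltOn (blk := (c q).1.block) rfl)) := e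
    have hτ := MultiDiagram.exists_youngSign_eq (AsymPair.not_quasiTrivial (c q).2) rfl
    have := IsIrreducible.nontrivial (OddIndex.rep_isIrreducible c ho (.inl p))
    have : Nontrivial (c p).1.OuterModule := this
    have h1 := MultiDiagram.eq_or_transpose_eq hτ hL1 rfl e.toIntertwiningMap (equiv_ne_zero e)
    have h2 := (AsymPair.eq_pair (c p).2).2
    have h3 := (AsymPair.eq_pair (c q).2).2
    have h4 : p.1 = q.1 := by
      rw [h2, h3]
      rcases h1 with h1 | h1
      · rw [h1]
      · rw [← h1, MultiDiagram.transpose_transpose, Set.pair_comm]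
    rw [Subtype.ext h4]
  · have hL1 : (c p).1.block = y.1.1.block := hL1
    exact absurd e (MultiDiagram.outerAltOn_not_equiv_constituentOn
      (MultiDiagram.exists_youngSign_eq y.1.not_quasiTrivial rfl) hL1 rfl
      (AsymPair.eq_pair (c p).2).1 y.1.2.1)
  · have hL1 : (c p).1.block = y.2.1.block := hL1
    exact absurd (MultiDiagram.QuasiTrivial.of_block y.2.2 hL1.symm)
      (AsymPair.not_quasiTrivial (c p).2)
  · have hL1 : x.1.1.block = (c q).1.block := hL1
    obtain ⟨e⟩ : Nonempty ((MultiDiagram.constituentOn hL1 x.2).Equiv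
      (MultiDiagram.outerAltOn (blk := (c q).1.block) rfl)) := e
    exact absurd ⟨e.symm⟩ (MultiDiagram.outerAltOn_not_equiv_constituentOn
      (MultiDiagram.exists_youngSign_eq (AsymPair.not_quasiTrivial (c q).2) rfl) rfl hL1
      (AsymPair.eq_pair (c q).2).1 x.1.2.1)
  · have hL1 : x.1.1.block = y.1.1.block := hL1
    obtain ⟨e⟩ : Nonempty ((MultiDiagram.constituentOn hL1 x.2).Equiv
      (MultiDiagram.constituentOn (blk := y.1.1.block) rfl y.2)) := e
    obtain ⟨h1, h2⟩ := MultiDiagram.constituentOn_equiv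
      (MultiDiagram.exists_youngSign_eq y.1.not_quasiTrivial rfl) hL1 rfl x.1.2.1 x.1.isSplitting e
    rw [show x = y from Prod.ext (Subtype.ext h1) h2]
  · have hL1 : x.1.1.block = y.2.1.block := hL1
    exact absurd (MultiDiagram.QuasiTrivial.of_block y.2.2 hL1.symm) x.1.not_quasiTrivial
  · have hL1 : x.2.1.block = (c q).1.block := hL1
    exact absurd (MultiDiagram.QuasiTrivial.of_block x.2.2 hL1) (AsymPair.not_quasiTrivial (c q).2)
  · have hL1 : x.2.1.block = y.1.1.block := hL1
    exact absurd (MultiDiagram.QuasiTrivial.of_block x.2.2 hL1) y.1.not_quasiTrivial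
  · have hL1 : x.2.1.block = y.2.1.block := hL1
    have h1 : x.2 = y.2 :=
      Subtype.ext (x.2.2.eq_of_card (MultiDiagram.card_eq_of_block hL1))
    rw [show x = y from Prod.ext hL2 h1]

theorem exists_trivial_intertwining {G M : Type*} [Group G] [Subsingleton G] [AddCommGroup M]
    [Module ℂ M] [Nontrivial M] (σ : Representation ℂ G M) :
    ∃ f : (Representation.trivial ℂ G ℂ).IntertwiningMap σ, f ≠ 0 := by
  obtain ⟨v, hv⟩ := exists_ne (0 : M)
  refine ⟨⟨LinearMap.toSpanSingleton ℂ M v, fun s => ?_⟩, fun h0 => hv ?_⟩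
  · rw [Subsingleton.elim s 1, map_one, map_one]
    rfl
  · have := DFunLike.congr_fun h0 (1 : ℂ)
    exact (one_smul ℂ v).symm.trans this

theorem OddIndex.rep_isExhausting.{w} (ho : Odd n) (l : OddLabel m₀ n) :
    IsExhausting.{w} fun x : {i // OddIndex.label c i = l} =>
      ((OddIndex.rep c ho x).ρ.comp (Subgroup.inclusion
        (congrArg (fun l => (l.datum ho).S) x.2).ge) : Representation ℂ (l.datum ho).S _) := by
  obtain ⟨Λ₀, ε, hε, rfl⟩ := l.exists_eq
  intro M _ _ _ σ
  change Representation ℂ (altSub Λ₀.block) M at σ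
  by_cases hq : Λ₀.QuasiTrivial
  · have hsub : Subsingleton (altSub Λ₀.block) := subsingleton_of_forall_eq 1 fun s =>
      Subtype.ext (Equiv.ext fun j => hq.block_injective (s.2.2 j))
    obtain ⟨f, hf⟩ := exists_trivial_intertwining σ
    exact ⟨⟨.inr (.inr (ε, ⟨Λ₀, hq⟩)), rfl⟩, f, hf⟩
  · obtain rfl : ε = true := hε.resolve_right fun h => hq h
    obtain ⟨⟨Λ, h⟩, f, hf⟩ : ∃ x : {Λ : MultiDiagram m₀ n // Λ.block = Λ₀.block},
        ∃ f : (MultiDiagram.outerAltOn x.2).IntertwiningMap σ, f ≠ 0 :=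
      MultiDiagram.outerAltOn_isExhausting.{w} ⟨Λ₀, rfl⟩ M σ
    have hqΛ : ¬Λ.QuasiTrivial := fun hΛ => hq (hΛ.of_block h)
    by_cases hT : Λ.transpose = Λ
    · obtain ⟨a, ha⟩ := not_forall.1 hqΛ
      let x : SymDiagram m₀ n := ⟨Λ, hT, a, by omega⟩
      obtain ⟨κ, hκ⟩ := MultiDiagram.exists_constituentOn_ne_zero x.isSplitting h f hf
      exact ⟨⟨.inr (.inl (x, κ)), Subtype.ext (Prod.ext h rfl)⟩,
        f.comp (MultiDiagram.constituentIncl h κ), hκ⟩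
    · let p : AsymPair m₀ n := ⟨{Λ, Λ.transpose}, Λ, hT, rfl⟩
      have key : ∀ Λ' : MultiDiagram m₀ n, Λ' ∈ p.1 → ∃ h' : Λ'.block = Λ₀.block,
          ∃ f' : (MultiDiagram.outerAltOn h').IntertwiningMap σ, f' ≠ 0 := by
        rintro Λ' (rfl | rfl)
        · exact ⟨h, f, hf⟩
        · have h' := (MultiDiagram.block_transpose Λ).trans h
          obtain ⟨e⟩ := MultiDiagram.outerAltOn_transpose h h'
          refine ⟨h', f.comp e.symm.toIntertwiningMap, fun h0 => hf ?_⟩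
          refine DFunLike.ext _ _ fun v => ?_
          have := DFunLike.congr_fun h0 (e v)
          have h1 : f (e.symm (e v)) = 0 := this
          rwa [e.symm_apply_apply] at h1
      obtain ⟨h', f', hf'⟩ := key (c p).1 (c p).2
      exact ⟨⟨.inl p, Subtype.ext (Prod.ext h' rfl)⟩, f', hf'⟩

/-- The classification for odd `n`. -/
theorem isCompleteSetOfReps_odd.{w} (hm : 0 < m₀) (ho : Odd n) :
    IsCompleteSetOfReps.{w} (-1) (-1) 1
      (Sum.elim (fun p : AsymPair m₀ n => PiAsym ho (c p).1)
        (Sum.elim (fun x : SymDiagram m₀ n × Fin 2 => PiSym ho x.1.1 x.2)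
          (fun x : Bool × TriDiagram m₀ n => PiTri ho x.1 x.2.1))) := by
  have key := SpinDatum.isCompleteSetOfReps.{w} hm (OddLabel.datum ho)
    (OddLabel.datum_injective ho) ?_ ?_ (OddIndex.label c) (fun i => (OddIndex.rep c ho i).ρ)
    (OddIndex.rep_isIrreducible c ho) (OddIndex.eq_of_equiv c ho) (OddIndex.rep_isExhausting c ho)
  · convert key using 1
    funext i
    rcases i with p | x | x <;> rfl
  · intro l l'
    obtain ⟨Λ, ε, hε, rfl⟩ := l.exists_eq
    obtain ⟨Λ', ε', hε', rfl⟩ := l'.exists_eq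
    exact oddDatum_separated hm ho hε hε'
  · intro V _ _ σ hirr hσ
    have := IsIrreducible.nontrivial hirr
    obtain ⟨Λ, ε, hε, f, hf⟩ := oddDatum_cover hm ho hσ
    exact ⟨⟨(Λ.block, ε), Λ, rfl, hε⟩, f, hf⟩

theorem IsCompleteSetOfReps.comp_bijective.{w} {β₁ β₂ β₃ : ℂ} {ι ι' : Type}
    {F : ι → Rep.{0} ℂ (RGroup m₀ n)} (hF : IsCompleteSetOfReps.{w} β₁ β₂ β₃ F) {e : ι' → ι}
    (he : Function.Bijective e) : IsCompleteSetOfReps.{w} β₁ β₂ β₃ (F ∘ e) where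
  irreducible i := hF.irreducible _
  spinType i := hF.spinType _
  inequivalent i j h := he.1 (hF.inequivalent _ _ h)
  complete V _ _ ρ h1 h2 := by
    obtain ⟨i, hi⟩ := hF.complete V ρ h1 h2
    obtain ⟨i, rfl⟩ := he.2 i
    exact ⟨i, hi⟩

theorem isEmpty_triDiagram (h : m₀ < n) : IsEmpty (TriDiagram m₀ n) :=
  ⟨fun Λ => by
    have := Fintype.card_le_of_injective _ Λ.2.block_injective
    rw [Fintype.card_fin, Fintype.card_fin] at this
    omega⟩

/-- For odd `n > m₀` there are no quasi-trivial families. -/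
theorem isCompleteSetOfReps_odd_of_lt.{w} (hm : 0 < m₀) (ho : Odd n) (h : m₀ < n) :
    IsCompleteSetOfReps.{w} (-1) (-1) 1
      (Sum.elim (fun p : AsymPair m₀ n => PiAsym ho (c p).1)
        (fun x : SymDiagram m₀ n × Fin 2 => PiSym ho x.1.1 x.2)) := by
  have hE := isEmpty_triDiagram h
  let e : AsymPair m₀ n ⊕ SymDiagram m₀ n × Fin 2 → OddIndex m₀ n := Sum.map id Sum.inl
  have he : Function.Bijective e := by
    refine ⟨Sum.map_injective.2 ⟨Function.injective_id, Sum.inl_injective⟩, ?_⟩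
    rintro (p | x | x)
    · exact ⟨.inl p, rfl⟩
    · exact ⟨.inr x, rfl⟩
    · exact (hE.false x.2).elim
  convert (isCompleteSetOfReps_odd.{w} c hm ho).comp_bijective he using 1
  funext i
  rcases i with p | x <;> rfl

end Classification

end SpinGSG

end

theorem theorem7p9 (m₀ n : ℕ) (hm : 0 < m₀) (hn : 4 ≤ n) :
    (∀ he : Even n,
      IsCompleteSetOfReps.{u} (-1) (-1) 1 (fun Λ : MultiDiagram m₀ n => PiII he Λ)) ∧
    (∀ ho : Odd n,
      (∀ Λ : SymDiagram m₀ n, IsSplitting Λ.1.outerAlt Λ.1.constituent) ∧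
      ∀ c : (p : AsymPair m₀ n) → p.1,
        (m₀ < n → IsCompleteSetOfReps.{u} (-1) (-1) 1
          (Sum.elim (fun p : AsymPair m₀ n => PiAsym ho (c p).1)
            (fun x : SymDiagram m₀ n × Fin 2 => PiSym ho x.1.1 x.2))) ∧
        (n ≤ m₀ → IsCompleteSetOfReps.{u} (-1) (-1) 1
          (Sum.elim (fun p : AsymPair m₀ n => PiAsym ho (c p).1)
            (Sum.elim (fun x : SymDiagram m₀ n × Fin 2 => PiSym ho x.1.1 x.2)
              (fun x : Bool × TriDiagram m₀ n => PiTri ho x.1 x.2.1))))) := by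
  exact ⟨fun he => isCompleteSetOfReps_even hm he, fun ho => ⟨fun Λ => Λ.isSplitting, fun c =>
    ⟨isCompleteSetOfReps_odd_of_lt c hm ho, fun _ => isCompleteSetOfReps_odd c hm ho⟩⟩⟩
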